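/- Let $n\ge 2$ and let $g(s)=a_0s^{\alpha_0}+a_1s^{\alpha_1}+\dots+a_Ns^{\alpha_N}$ $(s\ge 0)$, where $N\ge 1$, $0=\alpha_0<\alpha_1<\dots<\alpha_N$ are real numbers, $a_j\ge 0$ for all $j$, $a_0>0$ and $a_N>0$. Put $a=\frac{\alpha_N}{1+\alpha_N}\in(0,1)$ and, for $\xi\ge 0$, $K(\xi)=1/g(s(\xi))$, where $s(\xi)\ge 0$ is the unique solution of $s\,g(s)=\xi$. Let $U\subset\mathbb R^n$ be bounded and open, let $U'\Subset U$ (that is, $\overline{U'}$ is compact and contained in $U$), and let $\alpha\ge 2$ with $\alpha>\alpha_*:=\frac{an}{2-a}$. Put $$\kappa_0=\alpha\Big(1+\frac{2-a}{n}\Big)-a,\qquad \kappa_1=\Big(1-\frac{\alpha}{\kappa_0}\Big)^{-1},\qquad \kappa_2=\Big[\Big(1-\frac a\alpha\Big)\Big(1-\frac{\alpha_*}\alpha\Big)\Big]^{-1}.$$ Then there is a constant $C>0$, depending only on $n$, $g$, $U$, $U'$ and $\alpha$, such that the following holds. Let $p(x,t)$ be any local weak solution of $$\frac{\partial p}{\partial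 t}=\nabla\cdot\big(K(|\nabla p|)\nabla p\big)\quad\text{in } U\times(0,\infty),$$ that is: $p\in C((0,\infty);L^2_{\rm loc}(U))$, $p$ has a weak spatial gradient $\nabla p\in L^{2-a}_{\rm loc}(U\times(0,\infty))$, and $\iint p\,\varphi_t\,dx\,dt=\iint K(|\nabla p|)\nabla p\cdot\nabla\varphi\,dx\,dt$ for all $\varphi\in C_c^\infty(U\times(0,\infty))$. (No initial or boundary values are prescribed; in particular $p$ may be the solution of any initial boundary value problem for the equation.) Then for all $T_0\ge 0$, $T>0$ and $\theta\in(0,1)$, $$\sup_{t\in[T_0+\theta T,\,T_0+T]}\|p(t)\|_{L^\infty(U')}\le C(1+T)^{\frac{\kappa_1}{\kappa_0}}\big(1+(\theta T)^{-1}\big)^{\frac{\kappa_1}{\alpha-a}}\big(1+\|p\|_{L^\alpha(U\times(T_0,T_0+T))}\big)^{\kappa_2},$$ where the right-hand side is read as $+\infty$ if $p\notin L^\alpha(U\times(T_0,T_0+T))$. -/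

import Mathlib

open MeasureTheory Set Filter Topology
open scoped ContDiff ENNReal

/-- A generalized Forchheimer polynomial
`g(s) = a₀ s^{α₀} + a₁ s^{α₁} + … + a_N s^{α_N}`, with `N ≥ 1`, real powers
`0 = α₀ < α₁ < … < α_N`, and coefficients `a_j ≥ 0`, `a₀ > 0`, `a_N > 0`. -/
structure ForchheimerPolynomial where
  N : ℕ
  one_le_N : 1 ≤ N
  expo : Fin (N + 1) → ℝ
  coeff : Fin (N + 1) → ℝ
  expo_zero : expo 0 = 0
  expo_strictMono : StrictMono expo
  coeff_nonneg : ∀ j, 0 ≤ coeff j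
  coeff_zero_pos : 0 < coeff 0
  coeff_last_pos : 0 < coeff (Fin.last N)

namespace ForchheimerPolynomial

variable (g : ForchheimerPolynomial)

/-- The value `g(s)`, for `s ≥ 0`. -/
noncomputable def eval (s : ℝ) : ℝ := ∑ j, g.coeff j * s ^ g.expo j

/-- The number `a = α_N / (1 + α_N)`. -/
noncomputable def a : ℝ := g.expo (Fin.last g.N) / (1 + g.expo (Fin.last g.N))

/-- `s(ξ)`: the solution `s ≥ 0` of `s g(s) = ξ`, for `ξ ≥ 0`. It exists and is unique by
`existsUnique_mul_eval` below. -/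
noncomputable def sOf (ξ : ℝ) : ℝ := Function.invFunOn (fun s => s * g.eval s) (Ici 0) ξ

/-- The function `K(ξ) = 1 / g(s(ξ))`, for `ξ ≥ 0`. -/
noncomputable def K (ξ : ℝ) : ℝ := 1 / g.eval (g.sOf ξ)

theorem expo_nonneg (j : Fin (g.N + 1)) : 0 ≤ g.expo j := by
  rw [← g.expo_zero]
  exact g.expo_strictMono.monotone (Fin.zero_le j)

theorem coeff_zero_le_eval {s : ℝ} (hs : 0 ≤ s) : g.coeff 0 ≤ g.eval s := by
  have h := Finset.single_le_sum (f := fun j => g.coeff j * s ^ g.expo j) (s := Finset.univ)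
    (fun j _ => mul_nonneg (g.coeff_nonneg j) (Real.rpow_nonneg hs _)) (Finset.mem_univ 0)
  simpa [eval, g.expo_zero] using h

theorem continuous_eval : Continuous g.eval := by
  unfold eval
  refine continuous_finsetSum _ fun j _ => continuous_const.mul ?_
  exact Real.continuous_rpow_const (g.expo_nonneg j)

theorem eval_monotoneOn : MonotoneOn g.eval (Ici 0) := by
  intro s hs t _ hst
  refine Finset.sum_le_sum fun j _ => ?_
  exact mul_le_mul_of_nonneg_left (Real.rpow_le_rpow hs hst (g.expo_nonneg j)) (g.coeff_nonneg j)

theorem strictMonoOn_mul_eval : StrictMonoOn (fun s => s * g.eval s) (Ici 0) := by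
  intro s hs t ht hst
  have h1 := g.eval_monotoneOn hs ht hst.le
  have h2 := g.coeff_zero_le_eval ht
  have h3 := g.coeff_zero_pos
  have hs' : (0 : ℝ) ≤ s := hs
  calc s * g.eval s ≤ s * g.eval t := mul_le_mul_of_nonneg_left h1 hs'
    _ < t * g.eval t := mul_lt_mul_of_pos_right hst (by linarith)

theorem existsUnique_mul_eval {ξ : ℝ} (hξ : 0 ≤ ξ) : ∃! s : ℝ, 0 ≤ s ∧ s * g.eval s = ξ := by
  have h3 := g.coeff_zero_pos
  have hb : (0 : ℝ) ≤ ξ / g.coeff 0 := by positivity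
  have hc : ContinuousOn (fun s => s * g.eval s) (Icc 0 (ξ / g.coeff 0)) :=
    (continuous_id.mul g.continuous_eval).continuousOn
  have hmem : ξ ∈ Icc ((fun s => s * g.eval s) 0) ((fun s => s * g.eval s) (ξ / g.coeff 0)) := by
    refine ⟨by simpa using hξ, ?_⟩
    calc ξ = ξ / g.coeff 0 * g.coeff 0 := by field_simp
      _ ≤ _ := mul_le_mul_of_nonneg_left (g.coeff_zero_le_eval hb) hb
  obtain ⟨s, hs, hsξ⟩ := intermediate_value_Icc hb hc hmem
  refine ⟨s, ⟨hs.1, hsξ⟩, ?_⟩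
  rintro t ⟨ht, htξ⟩
  exact g.strictMonoOn_mul_eval.injOn ht hs.1 (htξ.trans hsξ.symm)

theorem sOf_spec {ξ : ℝ} (hξ : 0 ≤ ξ) : 0 ≤ g.sOf ξ ∧ g.sOf ξ * g.eval (g.sOf ξ) = ξ := by
  obtain ⟨s, ⟨hs, hsξ⟩, -⟩ := g.existsUnique_mul_eval hξ
  have h : ∃ s ∈ Ici (0 : ℝ), (fun s => s * g.eval s) s = ξ := ⟨s, hs, hsξ⟩
  exact ⟨Function.invFunOn_mem h, Function.invFunOn_eq h⟩

end ForchheimerPolynomial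

/-- The test functions on space-time: smooth, with compact support in `U × (0, ∞)`. -/
def IsTestFunction {n : ℕ} (U : Set (EuclideanSpace ℝ (Fin n)))
    (φ : EuclideanSpace ℝ (Fin n) × ℝ → ℝ) : Prop :=
  ContDiff ℝ ∞ φ ∧ HasCompactSupport φ ∧ tsupport φ ⊆ U ×ˢ Ioi (0 : ℝ)

/-- `G` is the weak spatial gradient of `p` on `U × (0, ∞)`: for every test function `φ` and
every spatial direction `v`, `∫∫ p ∂_v φ dx dt = - ∫∫ (G · v) φ dx dt`. -/
def IsWeakSpatialGradient {n : ℕ} (U : Set (EuclideanSpace ℝ (Fin n)))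
    (p : ℝ → EuclideanSpace ℝ (Fin n) → ℝ)
    (G : ℝ → EuclideanSpace ℝ (Fin n) → EuclideanSpace ℝ (Fin n)) : Prop :=
  ∀ φ : EuclideanSpace ℝ (Fin n) × ℝ → ℝ, IsTestFunction U φ →
    ∀ v : EuclideanSpace ℝ (Fin n),
      ∫ z in U ×ˢ Ioi (0 : ℝ), p z.2 z.1 * fderiv ℝ φ z (v, 0) =
        - ∫ z in U ×ˢ Ioi (0 : ℝ), inner ℝ (G z.2 z.1) v * φ z

/-- Local weak solutions `p(x,t)`, written `p t x`, of `∂p/∂t = ∇ · (K(|∇p|) ∇p)` in `U × (0, ∞)`: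
`p ∈ C((0,∞); L²_loc(U))`, the weak spatial gradient `∇p` exists and lies in
`L^{2-a}_loc(U × (0,∞))`, and for every test function `φ`
`∫∫ p ∂φ/∂t dx dt = ∫∫ K(|∇p|) ∇p · ∇φ dx dt`.
No initial or boundary values are prescribed, so that the solutions of every initial boundary
value problem for the equation are included. -/
structure IsLocalWeakSolution {n : ℕ} (g : ForchheimerPolynomial)
    (U : Set (EuclideanSpace ℝ (Fin n))) (p : ℝ → EuclideanSpace ℝ (Fin n) → ℝ) : Prop where
  aestronglyMeasurable : AEStronglyMeasurable
    (fun z : EuclideanSpace ℝ (Fin n) × ℝ => p z.2 z.1) (volume.restrict (U ×ˢ Ioi (0 : ℝ)))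
  memLp_two : ∀ V : Set (EuclideanSpace ℝ (Fin n)), IsCompact V → V ⊆ U →
    ∀ t : ℝ, 0 < t → MemLp (p t) 2 (volume.restrict V)
  continuous_two : ∀ V : Set (EuclideanSpace ℝ (Fin n)), IsCompact V → V ⊆ U →
    ∀ t₀ : ℝ, 0 < t₀ →
      Tendsto (fun t => eLpNorm (fun x => p t x - p t₀ x) 2 (volume.restrict V)) (𝓝 t₀) (𝓝 0)
  equation : ∃ G : ℝ → EuclideanSpace ℝ (Fin n) → EuclideanSpace ℝ (Fin n),
    (∀ Q : Set (EuclideanSpace ℝ (Fin n) × ℝ), IsCompact Q → Q ⊆ U ×ˢ Ioi (0 : ℝ) →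
      MemLp (fun z : EuclideanSpace ℝ (Fin n) × ℝ => G z.2 z.1) (ENNReal.ofReal (2 - g.a))
        (volume.restrict Q)) ∧
    IsWeakSpatialGradient U p G ∧
    ∀ φ : EuclideanSpace ℝ (Fin n) × ℝ → ℝ, IsTestFunction U φ →
      ∫ z in U ×ˢ Ioi (0 : ℝ), p z.2 z.1 * fderiv ℝ φ z (0, 1) =
        ∫ z in U ×ˢ Ioi (0 : ℝ), fderiv ℝ φ z (g.K ‖G z.2 z.1‖ • G z.2 z.1, 0)

/-- The threshold exponent `α_* = a n / (2 - a)`. -/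
noncomputable def alphaStar (a : ℝ) (n : ℕ) : ℝ := a * n / (2 - a)

/-- `κ₀ = α (1 + (2 - a) / n) - a`. -/
noncomputable def kappa0 (a : ℝ) (n : ℕ) (α : ℝ) : ℝ := α * (1 + (2 - a) / n) - a

/-- `κ₁ = 1 / δ₁` with `δ₁ = 1 - α / κ₀`. -/
noncomputable def kappa1 (a : ℝ) (n : ℕ) (α : ℝ) : ℝ := 1 / (1 - α / kappa0 a n α)

/-- `κ₂ = 1 / δ₂` with `δ₂ = (1 - a / α) (1 - α_* / α)`. -/
noncomputable def kappa2 (a : ℝ) (n : ℕ) (α : ℝ) : ℝ :=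
  1 / ((1 - a / α) * (1 - alphaStar a n / α))

/-! The proof is Moser's iteration for a degenerate parabolic equation. Put `q = 2 - a`. The two
structural facts about `K` are that the flux `K(|∇p|)∇p` lies in the dual space `L^{q'}`, `q' =
q/(1-a)` (`exists_flux_rpow_le`), and that `K(ξ)ξ²` controls `ξ^q` up to an additive constant
(`exists_rpow_le_K_mul_sq`).

Testing the equation with a function `f(p)ζ^k`, where `f = F'` and `F(s)` behaves like
`(1+s²)^{α/2}`, gives Caccioppoli's inequality: the supremum in time of `∫ F(p)ζ^k` and the
dissipation `∬ f'(p)ζ^k K|∇p|²` are both bounded by a multiple of `∬ F(p)ζ^{k-2}`. By coercivity the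
dissipation controls the `q`-th power of the gradient of a power of `p`, so the Sobolev inequality
on time slices applies; `q < 2 ≤ n` makes it subcritical. Hölder's inequality between the two bounds
yields `exists_moser_step`, which improves the integrability exponent from `α` to `κ₀(α)` at the
price of the outer power `ν = 1 + (2-a)/n`.

The map `κ₀` is affine with slope `ν` and fixed point `α_*`, so iteration from `α > α_*` drives the
exponents to infinity like `ν^j(α - α_*)`, the rate at which the outer powers grow. Hence
`exists_moser_bound`: `|p|` is bounded by a power `1/(α - α_*)` of the initial integral wherever the
cutoff is `1`. One cutoff serves all steps; instead of shrinking cylinders its exponent grows.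
Working with `1 + p²` in place of `p²` absorbs the additive constants of coercivity and of the
lower-order powers.

Two points need care because a local weak solution has little regularity. First, `f(p)ζ^k` is not an
admissible test function. The equation is therefore mollified in space and time: mollifications of
`p`, of its gradient and of the flux satisfy a linear relation exactly, the energy identity holds
for them (`energy_identity`), and the limit is taken with a varying dominating function, the
mollification of `|p|² + |∇p|^q + |A|^{q'}`, where `A` is the flux (`nonempty_fluxApproximation`,
`FluxApproximation.energy_le`, `FluxApproximation.sobolev_le`). Secondly, `F` must have bounded
second derivative for this, so the powers are truncated smoothly by `satPow`, with constants
independent of the level `M`, and `M → ∞` at the end of each step.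

Finally the bound, valid almost everywhere in space-time, is carried to every time by continuity in
`L²` (`ae_abs_le_of_prod`), and the exponents obtained are compared with the larger ones in the
statement. -/

namespace ForchheimerPolynomial

variable (g : ForchheimerPolynomial)

/-! ### Growth and coercivity of the Forchheimer nonlinearity. -/

theorem expo_last_pos : 0 < g.expo (Fin.last g.N) := by
  rw [← g.expo_zero]
  refine g.expo_strictMono ?_
  rw [Fin.lt_def]
  have := g.one_le_N
  simpa using (by omega : 0 < g.N)

theorem a_pos : 0 < g.a := by
  have := g.expo_last_pos
  unfold a; positivity

theorem one_sub_a : 1 - g.a = 1 / (1 + g.expo (Fin.last g.N)) := by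
  have := g.expo_last_pos
  unfold a; field_simp; ring

theorem a_lt_one : g.a < 1 := by
  have := g.expo_last_pos
  have h : 0 < 1 - g.a := by rw [one_sub_a]; positivity
  linarith

theorem eval_pos {s : ℝ} (hs : 0 ≤ s) : 0 < g.eval s :=
  g.coeff_zero_pos.trans_le (g.coeff_zero_le_eval hs)

theorem K_nonneg {ξ : ℝ} (hξ : 0 ≤ ξ) : 0 ≤ g.K ξ :=
  one_div_nonneg.2 (g.eval_pos (g.sOf_spec hξ).1).le

theorem K_le {ξ : ℝ} (hξ : 0 ≤ ξ) : g.K ξ ≤ 1 / g.coeff 0 :=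
  one_div_le_one_div_of_le g.coeff_zero_pos (g.coeff_zero_le_eval (g.sOf_spec hξ).1)

/-- The magnitude of the flux is `s(ξ)` itself, so growth questions about `K` become questions about
the polynomial equation `s g(s) = ξ`. -/
theorem K_mul_self {ξ : ℝ} (hξ : 0 ≤ ξ) : g.K ξ * ξ = g.sOf ξ := by
  obtain ⟨h0, h1⟩ := g.sOf_spec hξ
  have := g.eval_pos h0
  have h2 : g.K ξ * (g.sOf ξ * g.eval (g.sOf ξ)) = g.sOf ξ := by
    unfold K; field_simp
  rwa [h1] at h2

theorem sOf_monotoneOn : MonotoneOn g.sOf (Ici 0) := by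
  intro x hx y hy hxy
  obtain ⟨hx0, hx1⟩ := g.sOf_spec hx
  obtain ⟨hy0, hy1⟩ := g.sOf_spec hy
  by_contra! h
  have := g.strictMonoOn_mul_eval hy0 hx0 h
  simp only [hx1, hy1] at this
  linarith

/-- Measurability comes from monotonicity: `s(ξ)` increases and `g` increases, so `K` is antitone on
the half-line, and composing with `max ξ 0` makes it antitone on `ℝ`. -/
theorem measurable_K_norm {X F : Type*} [MeasurableSpace X] [NormedAddCommGroup F]
    {μ : Measure X} {G : X → F} (hG : AEStronglyMeasurable G μ) :
    AEStronglyMeasurable (fun x => g.K ‖G x‖) μ := by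
  have h1 : Antitone fun ξ : ℝ => g.K (max ξ 0) := by
    intro x y hxy
    have hm : max x 0 ≤ max y 0 := max_le_max_right 0 hxy
    have hx : (0 : ℝ) ≤ max x 0 := le_max_right _ _
    have hy : (0 : ℝ) ≤ max y 0 := le_max_right _ _
    exact one_div_le_one_div_of_le (g.eval_pos (g.sOf_spec hx).1)
      (g.eval_monotoneOn (g.sOf_spec hx).1 (g.sOf_spec hy).1 (g.sOf_monotoneOn hx hy hm))
  have h2 := h1.measurable.comp_aemeasurable hG.norm.aemeasurable
  refine h2.aestronglyMeasurable.congr (Eventually.of_forall fun x => ?_)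
  simp

/-- The flux grows at most like `ξ ^ (1 - a)`. -/
theorem exists_flux_rpow_le : ∃ C : ℝ, 0 < C ∧ ∀ ξ : ℝ, 0 ≤ ξ →
    (g.K ξ * ξ) ^ ((2 - g.a) / (1 - g.a)) ≤ C * ξ ^ (2 - g.a) := by
  have hc := g.coeff_last_pos
  have he := g.expo_last_pos
  have ha := g.a_lt_one
  have hq : (2 - g.a) / (1 - g.a) = (1 + g.expo (Fin.last g.N)) * (2 - g.a) := by
    rw [one_sub_a]; field_simp
  refine ⟨(g.coeff (Fin.last g.N) ^ (2 - g.a))⁻¹, by positivity, fun ξ hξ => ?_⟩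
  obtain ⟨h0, h1⟩ := g.sOf_spec hξ
  rw [K_mul_self g hξ, hq, Real.rpow_mul h0, ← div_eq_inv_mul,
    le_div_iff₀ (by positivity), ← Real.mul_rpow (by positivity) hc.le]
  refine Real.rpow_le_rpow (by positivity) ?_ (by linarith)
  conv_rhs => rw [← h1]
  -- Of `g(s)` only the leading term is kept: `ξ = s g(s) ≥ a_N s^{1+α_N}`.
  have h := Finset.single_le_sum (f := fun j => g.coeff j * g.sOf ξ ^ g.expo j) (s := Finset.univ)
    (fun j _ => mul_nonneg (g.coeff_nonneg j) (Real.rpow_nonneg h0 _))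
    (Finset.mem_univ (Fin.last g.N))
  rcases h0.eq_or_lt with h00 | h00
  · rw [← h00, Real.zero_rpow (by positivity)]; simp
  · rw [Real.rpow_add h00, Real.rpow_one, mul_assoc]
    refine mul_le_mul_of_nonneg_left ?_ h0
    rw [mul_comm]; exact h

/-- Coercivity: `ξ ^ (2 - a)` is controlled by `1 + K(ξ) ξ²`. -/
theorem exists_rpow_le_K_mul_sq : ∃ C : ℝ, 1 ≤ C ∧ ∀ ξ : ℝ, 0 ≤ ξ →
    ξ ^ (2 - g.a) ≤ C * (1 + g.K ξ * ξ ^ 2) := by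
  have he := g.expo_last_pos
  have ha := g.a_lt_one
  have ha0 := g.a_pos
  set S := ∑ j, g.coeff j with hS
  have hS0 : 0 ≤ S := Finset.sum_nonneg fun j _ => g.coeff_nonneg j
  refine ⟨1 + S ^ (2 - g.a) + S ^ (1 - g.a), ?_, fun ξ hξ => ?_⟩
  · have := Real.rpow_nonneg hS0 (2 - g.a)
    have := Real.rpow_nonneg hS0 (1 - g.a)
    linarith
  have e1 := Real.rpow_nonneg hS0 (2 - g.a)
  have e2 := Real.rpow_nonneg hS0 (1 - g.a)
  obtain ⟨h0, h1⟩ := g.sOf_spec hξ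
  -- In the variable `s` the claim compares `(s g(s))^{2-a}` with `1 + s² g(s)`.
  have hK : g.K ξ * ξ ^ 2 = g.sOf ξ ^ 2 * g.eval (g.sOf ξ) := by
    have h2 : g.sOf ξ ^ 2 * g.eval (g.sOf ξ) = g.sOf ξ * (g.sOf ξ * g.eval (g.sOf ξ)) := by ring
    rw [h2, h1, sq, ← mul_assoc, K_mul_self g hξ]
  rw [hK]
  conv_lhs => rw [← h1]
  set s := g.sOf ξ
  have hev := g.eval_pos h0
  -- For `s ≤ 1` the left side is bounded and the summand `1` suffices; for `s ≥ 1` the top power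
  -- dominates every term of `g`.
  rcases le_total s 1 with hs | hs
  · have hle : g.eval s ≤ S := Finset.sum_le_sum fun j _ => by
      have := Real.rpow_le_one h0 hs (g.expo_nonneg j)
      nlinarith [g.coeff_nonneg j]
    calc (s * g.eval s) ^ (2 - g.a) ≤ S ^ (2 - g.a) :=
          Real.rpow_le_rpow (by positivity) (by nlinarith) (by linarith)
      _ ≤ 1 + S ^ (2 - g.a) + S ^ (1 - g.a) := by linarith
      _ ≤ _ := le_mul_of_one_le_right (by positivity) (by nlinarith [sq_nonneg s, mul_nonneg (sq_nonneg s) hev.le])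
  · have hle : g.eval s ≤ S * s ^ g.expo (Fin.last g.N) := by
      rw [hS, Finset.sum_mul]
      refine Finset.sum_le_sum fun j _ => mul_le_mul_of_nonneg_left ?_ (g.coeff_nonneg j)
      exact Real.rpow_le_rpow_of_exponent_le hs (g.expo_strictMono.monotone (Fin.le_last j))
    have hs0 : 0 < s := by linarith
    -- The exponent `a` is chosen exactly so that `α_N (1 - a) = a`.
    have h3 : g.eval s ^ (1 - g.a) ≤ S ^ (1 - g.a) * s ^ g.a := by
      calc g.eval s ^ (1 - g.a) ≤ (S * s ^ g.expo (Fin.last g.N)) ^ (1 - g.a) :=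
            Real.rpow_le_rpow hev.le hle (by linarith)
        _ = S ^ (1 - g.a) * s ^ g.a := by
            rw [Real.mul_rpow hS0 (by positivity), ← Real.rpow_mul h0, one_sub_a, mul_one_div]
            rfl
    calc (s * g.eval s) ^ (2 - g.a) = s ^ (2 - g.a) * (g.eval s * g.eval s ^ (1 - g.a)) := by
          rw [Real.mul_rpow h0 hev.le]
          congr 1
          rw [show 2 - g.a = 1 + (1 - g.a) by ring, Real.rpow_add hev, Real.rpow_one]
      _ ≤ s ^ (2 - g.a) * (g.eval s * (S ^ (1 - g.a) * s ^ g.a)) := by gcongr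
      _ = S ^ (1 - g.a) * (s ^ 2 * g.eval s) := by
          have : s ^ (2 - g.a) * s ^ g.a = s ^ 2 := by
            rw [← Real.rpow_add hs0]; simp
          linear_combination (S ^ (1 - g.a) * g.eval s) * this
      _ ≤ _ := by
          have : 0 ≤ s ^ 2 * g.eval s := by positivity
          exact mul_le_mul (by linarith) (by linarith) this (by positivity)

end ForchheimerPolynomial

/-! ### Dominated convergence with varying dominating functions. -/

section DominatedConvergence

variable {X : Type*} [MeasurableSpace X] {μ : Measure X}

/-- Dominated convergence with a convergent sequence of dominating functions. -/
theorem tendsto_integral_of_dominated_of_tendsto {f g : ℕ → X → ℝ} {f₀ g₀ : X → ℝ}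
    (hf : ∀ m, AEStronglyMeasurable (f m) μ) (hg : ∀ m, Integrable (g m) μ)
    (hg₀ : Integrable g₀ μ) (hfg : ∀ m, ∀ᵐ x ∂μ, |f m x| ≤ g m x)
    (hft : ∀ᵐ x ∂μ, Tendsto (fun m => f m x) atTop (𝓝 (f₀ x)))
    (hgt : ∀ᵐ x ∂μ, Tendsto (fun m => g m x) atTop (𝓝 (g₀ x)))
    (hint : Tendsto (fun m => ∫ x, g m x ∂μ) atTop (𝓝 (∫ x, g₀ x ∂μ))) :
    Integrable f₀ μ ∧ Tendsto (fun m => ∫ x, f m x ∂μ) atTop (𝓝 (∫ x, f₀ x ∂μ)) := by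
  have hall : ∀ᵐ x ∂μ, ∀ m, |f m x| ≤ g m x := ae_all_iff.2 hfg
  have hf₀m : AEStronglyMeasurable f₀ μ := aestronglyMeasurable_of_tendsto_ae atTop hf hft
  have hle : ∀ᵐ x ∂μ, |f₀ x| ≤ g₀ x := by
    filter_upwards [hall, hft, hgt] with x h1 h2 h3
    exact le_of_tendsto_of_tendsto' h2.abs h3 h1
  have hg₀0 : ∀ᵐ x ∂μ, 0 ≤ g₀ x := hle.mono fun x hx => (abs_nonneg _).trans hx
  have hf₀ : Integrable f₀ μ := hg₀.mono' hf₀m hle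
  have hfi : ∀ m, Integrable (f m) μ := fun m => (hg m).mono' (hf m) (hfg m)
  refine ⟨hf₀, ?_⟩
  -- Scheffé's argument: the positive part of `g₀ - g m` is dominated by `g₀`, because `g m ≥ 0`.
  have hpos : Tendsto (fun m => ∫ x, max (g₀ x - g m x) 0 ∂μ) atTop (𝓝 0) := by
    have := tendsto_integral_of_dominated_convergence (μ := μ)
      (F := fun m x => max (g₀ x - g m x) 0) (f := fun _ => (0 : ℝ)) g₀
      (fun m => ((hg₀.sub (hg m)).pos_part).aestronglyMeasurable) hg₀
      (fun m => by
        filter_upwards [hall, hg₀0] with x h1 h2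
        have := (abs_nonneg _).trans (h1 m)
        rw [Real.norm_of_nonneg (le_max_right _ _)]
        exact max_le (by linarith) h2)
      (by
        filter_upwards [hgt] with x h1
        have h2 := (tendsto_const_nhds (x := g₀ x)).sub h1
        simpa using h2.max (tendsto_const_nhds (x := (0 : ℝ))))
    simpa using this
  -- From `|u| = u + 2 max(-u, 0)` and the convergence of the integrals, the dominating functions
  -- converge in `L¹`.
  have habs : Tendsto (fun m => ∫ x, |g m x - g₀ x| ∂μ) atTop (𝓝 0) := by
    have h1 : ∀ m, ∫ x, |g m x - g₀ x| ∂μ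
        = (∫ x, g m x ∂μ) - (∫ x, g₀ x ∂μ) + 2 * ∫ x, max (g₀ x - g m x) 0 ∂μ := by
      intro m
      rw [← integral_sub (hg m) hg₀, ← integral_const_mul,
        ← integral_add (f := fun x => g m x - g₀ x) (g := fun x => 2 * max (g₀ x - g m x) 0)
          ((hg m).sub hg₀) (((hg₀.sub (hg m)).pos_part).const_mul 2)]
      refine integral_congr_ae (Eventually.of_forall fun x => ?_)
      simp only
      rcases le_total (g m x) (g₀ x) with h | h
      · rw [abs_of_nonpos (by linarith), max_eq_left (by linarith)]; ring
      · rw [abs_of_nonneg (by linarith), max_eq_right (by linarith)]; ring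
    simp_rw [h1]
    have h2 := ((hint.sub (tendsto_const_nhds (x := ∫ x, g₀ x ∂μ)))).add (hpos.const_mul 2)
    simpa using h2
  -- Clipping `f m` to `[-g₀, g₀]` puts it within reach of the classical theorem; the error of
  -- clipping is at most `|g m - g₀|`.
  have hclip : Tendsto (fun m => ∫ x, max (-g₀ x) (min (f m x) (g₀ x)) ∂μ) atTop
      (𝓝 (∫ x, f₀ x ∂μ)) := by
    refine tendsto_integral_of_dominated_convergence g₀ (fun m => ?_) hg₀ (fun m => ?_) ?_
    · exact (hg₀.aestronglyMeasurable.neg).sup ((hf m).inf hg₀.aestronglyMeasurable)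
    · filter_upwards [hg₀0] with x h
      rw [Real.norm_eq_abs, abs_le]
      exact ⟨le_max_left _ _, max_le (by linarith) (min_le_right _ _)⟩
    · filter_upwards [hft, hle] with x h1 h2
      rw [abs_le] at h2
      have h3 := (tendsto_const_nhds (x := -g₀ x)).max (h1.min (tendsto_const_nhds (x := g₀ x)))
      rwa [min_eq_left h2.2, max_eq_right h2.1] at h3
  have hcm : ∀ m, Integrable (fun x => max (-g₀ x) (min (f m x) (g₀ x))) μ := fun m =>
    hg₀.neg.sup ((hfi m).inf hg₀)
  have hdiff : Tendsto (fun m => (∫ x, f m x ∂μ) -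
      ∫ x, max (-g₀ x) (min (f m x) (g₀ x)) ∂μ) atTop (𝓝 0) := by
    refine squeeze_zero_norm (fun m => ?_) habs
    rw [← integral_sub (hfi m) (hcm m)]
    refine norm_integral_le_of_norm_le ((hg m).sub hg₀).abs ?_
    filter_upwards [hall, hg₀0] with x h1 h2
    have h3 := abs_le.1 (h1 m)
    simp only [Real.norm_eq_abs]
    have h4 := neg_abs_le (g m x - g₀ x)
    have h5 := le_abs_self (g m x - g₀ x)
    have h6 := abs_nonneg (g m x - g₀ x)
    rw [abs_le]
    rcases le_total (f m x) (g₀ x) with h | h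
    · rw [min_eq_left h]
      rcases le_total (-g₀ x) (f m x) with h' | h'
      · rw [max_eq_right h']; constructor <;> linarith
      · rw [max_eq_left h']; constructor <;> linarith
    · rw [min_eq_right h, max_eq_right (by linarith)]; constructor <;> linarith
  simpa using hdiff.add hclip

end DominatedConvergence

/-! ### Mollification: Jensen's inequality and derivatives. -/

theorem ContDiffBump.exists_seq {X : Type*} [NormedAddCommGroup X] (δ : ℝ) (hδ : 0 < δ) : ∃ φ : ℕ → ContDiffBump (0 : X),
    Tendsto (fun m => (φ m).rOut) atTop (𝓝 0) ∧ (∀ m, (φ m).rOut ≤ 2 * (φ m).rIn) ∧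
      ∀ m, (φ m).rOut ≤ δ := by
  -- The ratio of the radii stays equal to `2`, since almost everywhere convergence of the
  -- mollifications needs this ratio bounded.
  refine ⟨fun m => ⟨δ / (m + 1) / 2, δ / (m + 1), by positivity, half_lt_self (by positivity)⟩,
    ?_, fun m => ?_, fun m => ?_⟩
  · exact tendsto_const_div_atTop_nhds_zero_nat δ |>.comp (tendsto_add_atTop_nat 1) |>.congr
      fun m => by simp
  · simp only; linarith
  · simp only
    exact div_le_self hδ.le (by linarith [Nat.cast_nonneg (α := ℝ) m])

section Mollification

open ContinuousLinearMap
open scoped Convolution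

variable {X : Type*} [NormedAddCommGroup X] [NormedSpace ℝ X] [FiniteDimensional ℝ X]
  [MeasurableSpace X] [BorelSpace X] {μ : Measure X} [μ.IsAddHaarMeasure]
  {F : Type*} [NormedAddCommGroup F] [NormedSpace ℝ F]

theorem integrable_mollifier_smul (φ : ContDiffBump (0 : X)) {g : X → F}
    (hg : Integrable g μ) (z : X) : Integrable (fun y => φ.normed μ (z - y) • g y) μ := by
  have hc : Continuous fun y => φ.normed μ (z - y) :=
    φ.continuous_normed.comp (continuous_const.sub continuous_id)
  obtain ⟨C, hC⟩ := φ.continuous_normed.bounded_above_of_compact_support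
    (φ.hasCompactSupport_normed (μ := μ))
  exact hg.bdd_smul C hc.aestronglyMeasurable (Eventually.of_forall fun y => hC _)

theorem integral_mollifier_sub (φ : ContDiffBump (0 : X)) (z : X) :
    ∫ y, φ.normed μ (z - y) ∂μ = 1 := by
  rw [integral_sub_left_eq_self (fun y => φ.normed μ y)]
  exact φ.integral_normed

/-- A convex power lies above its tangent at `m`. For `m > 0` this is Bernoulli's inequality at `(s
- m)/m`. -/
theorem rpow_tangent_le {r m s : ℝ} (hr : 1 ≤ r) (hm : 0 ≤ m) (hs : 0 ≤ s) :
    m ^ r + r * m ^ (r - 1) * (s - m) ≤ s ^ r := by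
  rcases hm.eq_or_lt with rfl | hm
  · rw [Real.zero_rpow (by positivity)]
    rcases hr.eq_or_lt with rfl | hr
    · simp
    · rw [Real.zero_rpow (by linarith)]; simpa using Real.rpow_nonneg hs r
  · have h := one_add_mul_self_le_rpow_one_add (s := (s - m) / m) (by
      rw [le_div_iff₀ hm]; linarith) hr
    have h1 : 1 + (s - m) / m = s / m := by field_simp; ring
    rw [h1, Real.div_rpow hs hm.le, le_div_iff₀ (by positivity)] at h
    rw [Real.rpow_sub_one hm.ne']
    calc _ = (1 + r * ((s - m) / m)) * m ^ r := by field_simp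
      _ ≤ _ := h

/-- Jensen's inequality for mollifications. -/
theorem norm_mollify_rpow_le (φ : ContDiffBump (0 : X)) {g : X → F} {r : ℝ} (hr : 1 ≤ r)
    (hg : Integrable g μ) (hgr : Integrable (fun y => ‖g y‖ ^ r) μ) (z : X) :
    ‖(φ.normed μ ⋆[lsmul ℝ ℝ, μ] g) z‖ ^ r
      ≤ (φ.normed μ ⋆[lsmul ℝ ℝ, μ] fun y => ‖g y‖ ^ r) z := by
  rw [convolution_lsmul_swap, convolution_lsmul_swap]
  have h0 : ∀ y, 0 ≤ φ.normed μ (z - y) := fun y => φ.nonneg_normed _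
  set m := ∫ y, φ.normed μ (z - y) * ‖g y‖ ∂μ with hm
  have hi1 : Integrable (fun y => φ.normed μ (z - y) * ‖g y‖) μ :=
    integrable_mollifier_smul φ hg.norm z
  have hi2 : Integrable (fun y => φ.normed μ (z - y) * ‖g y‖ ^ r) μ :=
    integrable_mollifier_smul φ hgr z
  have hi0 : Integrable (fun y => φ.normed μ (z - y)) μ :=
    Integrable.of_integral_ne_zero (by rw [integral_mollifier_sub]; exact one_ne_zero)
  have hm0 : 0 ≤ m := integral_nonneg fun y => mul_nonneg (h0 y) (norm_nonneg _)
  have h1 : ‖∫ y, φ.normed μ (z - y) • g y ∂μ‖ ≤ m := by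
    refine (norm_integral_le_integral_norm _).trans_eq ?_
    refine integral_congr_ae (Eventually.of_forall fun y => ?_)
    simp [norm_smul, abs_of_nonneg (h0 y)]
  calc _ ≤ m ^ r := Real.rpow_le_rpow (norm_nonneg _) h1 (by linarith)
    -- The tangent is taken at the mean `m`, so its linear term integrates to zero against the
    -- kernel of mass one.
    _ = ∫ y, φ.normed μ (z - y) * (m ^ r + r * m ^ (r - 1) * (‖g y‖ - m)) ∂μ := by
      have : ∀ y, φ.normed μ (z - y) * (m ^ r + r * m ^ (r - 1) * (‖g y‖ - m))
          = (m ^ r - r * m ^ (r - 1) * m) * φ.normed μ (z - y)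
            + r * m ^ (r - 1) * (φ.normed μ (z - y) * ‖g y‖) := fun y => by ring
      simp_rw [this]
      rw [integral_add (hi0.const_mul _) (hi1.const_mul _), integral_const_mul,
        integral_const_mul, integral_mollifier_sub, ← hm]
      ring
    _ ≤ ∫ y, φ.normed μ (z - y) * ‖g y‖ ^ r ∂μ := by
      refine integral_mono ?_ hi2 fun y => ?_
      · have : ∀ y, φ.normed μ (z - y) * (m ^ r + r * m ^ (r - 1) * (‖g y‖ - m))
          = (m ^ r - r * m ^ (r - 1) * m) * φ.normed μ (z - y)
            + r * m ^ (r - 1) * (φ.normed μ (z - y) * ‖g y‖) := fun y => by ring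
        simp_rw [this]
        exact (hi0.const_mul _).add (hi1.const_mul _)
      · exact mul_le_mul_of_nonneg_left (rpow_tangent_le hr hm0 (norm_nonneg _)) (h0 y)
    _ = _ := rfl

theorem mollify_mono (φ : ContDiffBump (0 : X)) {f g : X → ℝ} (hf : Integrable f μ)
    (hg : Integrable g μ) (hfg : ∀ x, f x ≤ g x) (z : X) :
    (φ.normed μ ⋆[lsmul ℝ ℝ, μ] f) z ≤ (φ.normed μ ⋆[lsmul ℝ ℝ, μ] g) z := by
  rw [convolution_lsmul_swap, convolution_lsmul_swap]
  exact integral_mono (integrable_mollifier_smul φ hf z) (integrable_mollifier_smul φ hg z)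
    fun y => mul_le_mul_of_nonneg_left (hfg y) (φ.nonneg_normed _)

theorem contDiff_mollify (φ : ContDiffBump (0 : X)) {g : X → F} (hg : Integrable g μ) :
    ContDiff ℝ ∞ (φ.normed μ ⋆[lsmul ℝ ℝ, μ] g) :=
  φ.hasCompactSupport_normed.contDiff_convolution_left _ φ.contDiff_normed hg.locallyIntegrable

/-- All derivatives fall on the kernel, which is the test function to be inserted into the weak
formulation. -/
theorem fderiv_mollify_apply [CompleteSpace F] (φ : ContDiffBump (0 : X)) {g : X → F} (hg : Integrable g μ)
    (z v : X) : fderiv ℝ (φ.normed μ ⋆[lsmul ℝ ℝ, μ] g) z v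
      = ∫ y, fderiv ℝ (φ.normed μ) (z - y) v • g y ∂μ := by
  have hc : ContDiff ℝ 1 (φ.normed μ) := φ.contDiff_normed
  have hd := φ.hasCompactSupport_normed.hasFDerivAt_convolution_left (μ := μ) (lsmul ℝ ℝ)
    hc hg.locallyIntegrable z
  have hs : HasCompactSupport (fderiv ℝ (φ.normed μ)) := φ.hasCompactSupport_normed.fderiv ℝ
  have he := hs.convolutionExists_left ((lsmul ℝ ℝ : ℝ →L[ℝ] F →L[ℝ] F).precompL X)
    (hc.continuous_fderiv one_ne_zero) hg.locallyIntegrable z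
  rw [hd.fderiv, convolution_eq_swap, ← ContinuousLinearMap.apply_apply' v,
    ← ContinuousLinearMap.integral_comp_comm]
  · rfl
  · exact (he.integrable_swap)

end Mollification

/-- The space `ℝⁿ`. -/
abbrev Euc (n : ℕ) : Type := EuclideanSpace ℝ (Fin n)

instance isAddHaarMeasure_volume_euc_prod (n : ℕ) :
    (volume : Measure (Euc n × ℝ)).IsAddHaarMeasure :=
  inferInstanceAs ((volume : Measure (Euc n)).prod (volume : Measure ℝ)).IsAddHaarMeasure

/-! ### Local square integrability of solutions in space-time. -/

section LocalIntegrability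

variable {n : ℕ} {g : ForchheimerPolynomial} {U : Set (Euc n)} {p : ℝ → Euc n → ℝ}

/-- Continuity in time bounds the norm near each time by the norm at that time plus one; compactness
of the time set does the rest. -/
theorem IsLocalWeakSolution.exists_eLpNorm_two_le (hp : IsLocalWeakSolution g U p)
    {V : Set (Euc n)} (hV : IsCompact V) (hVU : V ⊆ U) {I : Set ℝ} (hI : IsCompact I)
    (hI0 : I ⊆ Ioi 0) :
    ∃ C : ℝ≥0∞, C ≠ ⊤ ∧ ∀ t ∈ I, eLpNorm (p t) 2 (volume.restrict V) ≤ C := by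
  refine hI.induction_on (p := fun I => ∃ C : ℝ≥0∞, C ≠ ⊤ ∧
    ∀ t ∈ I, eLpNorm (p t) 2 (volume.restrict V) ≤ C) ⟨0, by simp⟩ ?_ ?_ ?_
  · rintro s t hst ⟨C, hC, h⟩
    exact ⟨C, hC, fun x hx => h x (hst hx)⟩
  · rintro s t ⟨C, hC, h⟩ ⟨C', hC', h'⟩
    refine ⟨max C C', by simp [hC, hC'], fun x hx => ?_⟩
    rcases hx with hx | hx
    · exact (h x hx).trans (le_max_left _ _)
    · exact (h' x hx).trans (le_max_right _ _)
  · intro t₀ ht₀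
    have h0 : 0 < t₀ := hI0 ht₀
    have hm := hp.memLp_two V hV hVU t₀ h0
    have hev := (hp.continuous_two V hV hVU t₀ h0).eventually_lt_const
      (u := 1) (by simp)
    refine ⟨{t | 0 < t ∧ eLpNorm (fun x => p t x - p t₀ x) 2 (volume.restrict V) < 1},
      mem_nhdsWithin_of_mem_nhds (inter_mem (lt_mem_nhds h0) hev),
      1 + eLpNorm (p t₀) 2 (volume.restrict V), by simp [hm.eLpNorm_ne_top], ?_⟩
    rintro t ⟨ht, ht1⟩
    have hmt := hp.memLp_two V hV hVU t ht
    have : p t = (fun x => p t x - p t₀ x) + p t₀ := by ext x; simp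
    rw [this]
    exact (eLpNorm_add_le (hmt.1.sub hm.1) hm.1 (by norm_num)).trans (add_le_add_left ht1.le _)

theorem IsLocalWeakSolution.memLp_two_prod (hp : IsLocalWeakSolution g U p)
    {Q : Set (Euc n × ℝ)} (hQ : IsCompact Q) (hQU : Q ⊆ U ×ˢ Ioi (0 : ℝ)) :
    MemLp (fun z : Euc n × ℝ => p z.2 z.1) 2 (volume.restrict Q) := by
  have hV := hQ.image continuous_fst
  have hI := hQ.image continuous_snd
  have hVU : Prod.fst '' Q ⊆ U := by
    rintro _ ⟨z, hz, rfl⟩; exact (hQU hz).1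
  have hI0 : Prod.snd '' Q ⊆ Ioi 0 := by
    rintro _ ⟨z, hz, rfl⟩; exact (hQU hz).2
  set V := Prod.fst '' Q
  set I := Prod.snd '' Q
  have hsub : Q ⊆ V ×ˢ I := fun z hz => ⟨⟨z, hz, rfl⟩, ⟨z, hz, rfl⟩⟩
  obtain ⟨C, hC, hle⟩ := hp.exists_eLpNorm_two_le hV hVU hI hI0
  refine MemLp.mono_measure (μ := volume.restrict (V ×ˢ I)) (Measure.restrict_mono hsub le_rfl) ?_
  have hmeas : AEStronglyMeasurable (fun z : Euc n × ℝ => p z.2 z.1)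
      (volume.restrict (V ×ˢ I)) :=
    hp.aestronglyMeasurable.mono_measure (Measure.restrict_mono (prod_mono hVU hI0) le_rfl)
  refine ⟨hmeas, ?_⟩
  rw [eLpNorm_lt_top_iff_lintegral_rpow_enorm_lt_top (by norm_num) (by norm_num)]
  have hm2 : AEMeasurable (fun z : Euc n × ℝ => ‖p z.2 z.1‖ₑ ^ (2 : ℝ≥0∞).toReal)
      ((volume.restrict V).prod (volume.restrict I)) := by
    rw [Measure.prod_restrict]
    exact hmeas.enorm.pow_const _
  rw [Measure.volume_eq_prod, ← Measure.prod_restrict, lintegral_prod_symm _ hm2]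
  calc _ ≤ ∫⁻ t in I, C ^ (2 : ℝ) := by
        refine setLIntegral_mono' hI.measurableSet fun t ht => ?_
        have h1 := hle t ht
        rw [eLpNorm_eq_lintegral_rpow_enorm_toReal (by norm_num) (by norm_num)] at h1
        have h2 := ENNReal.rpow_le_rpow h1 (z := 2) (by norm_num)
        rw [← ENNReal.rpow_mul] at h2
        simpa using h2
    _ < ⊤ := by
        rw [setLIntegral_const]
        exact ENNReal.mul_lt_top (ENNReal.rpow_lt_top_of_nonneg (by norm_num) hC)
          hI.measure_lt_top

end LocalIntegrability

/-! ### Smooth approximation of the solution, its gradient and its flux. -/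

/-- Smooth approximations of a function `p`, of its spatial gradient `G` and of the flux `A`,
which satisfy the differential equation on `Q` and are dominated by a sequence converging
in `L¹`. -/
structure FluxApproximation {n : ℕ} (q q' : ℝ) (Q : Set (Euc n × ℝ)) (p : Euc n × ℝ → ℝ)
    (G A : Euc n × ℝ → Euc n) where
  P : ℕ → Euc n × ℝ → ℝ
  H : ℕ → Euc n × ℝ → Euc n
  B : ℕ → Euc n × ℝ → Euc n
  d : ℕ → Euc n × ℝ → ℝ
  d₀ : Euc n × ℝ → ℝ
  contDiff_P : ∀ m, ContDiff ℝ ∞ (P m)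
  contDiff_H : ∀ m, ContDiff ℝ ∞ (H m)
  contDiff_B : ∀ m, ContDiff ℝ ∞ (B m)
  fderiv_space : ∀ m, ∀ z ∈ Q, ∀ v, fderiv ℝ (P m) z (v, 0) = inner ℝ (H m z) v
  fderiv_time : ∀ m, ∀ z ∈ Q, fderiv ℝ (P m) z (0, 1) =
    ∑ i, fderiv ℝ (B m) z (EuclideanSpace.single i 1, 0) i
  tendsto : ∀ᵐ z, z ∈ Q → Tendsto (fun m => P m z) atTop (𝓝 (p z)) ∧
    Tendsto (fun m => H m z) atTop (𝓝 (G z)) ∧ Tendsto (fun m => B m z) atTop (𝓝 (A z))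
  integrable_d : ∀ m, Integrable (d m)
  integrable_d₀ : Integrable d₀
  tendsto_d : ∀ᵐ z, Tendsto (fun m => d m z) atTop (𝓝 (d₀ z))
  integral_d : ∀ m, ∫ z, d m z = ∫ z, d₀ z
  P_le : ∀ m z, P m z ^ 2 ≤ d m z
  H_le : ∀ m z, ‖H m z‖ ^ q ≤ d m z
  B_le : ∀ m z, ‖B m z‖ ^ q' ≤ d m z

section Approximation

open ContinuousLinearMap
open scoped Convolution

variable {n : ℕ} {g : ForchheimerPolynomial} {U : Set (Euc n)} {p : ℝ → Euc n → ℝ}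

theorem ContinuousLinearMap.apply_prod_zero_eq_sum (T : Euc n × ℝ →L[ℝ] ℝ) (v : Euc n) :
    T (v, 0) = ∑ i, T (EuclideanSpace.single i 1, 0) * v i := by
  have h := (EuclideanSpace.basisFun (Fin n) ℝ).sum_repr v
  conv_lhs => rw [← h]
  have h2 : T ((∑ i, (EuclideanSpace.basisFun (Fin n) ℝ).repr v i •
      EuclideanSpace.basisFun (Fin n) ℝ i, 0)) =
      (T.comp (ContinuousLinearMap.inl ℝ (Euc n) ℝ))
        (∑ i, (EuclideanSpace.basisFun (Fin n) ℝ).repr v i •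
          EuclideanSpace.basisFun (Fin n) ℝ i) := rfl
  rw [h2, map_sum]
  refine Finset.sum_congr rfl fun i _ => ?_
  rw [map_smul]
  simp [mul_comm]

theorem isTestFunction_mollifier (φ : ContDiffBump (0 : Euc n × ℝ)) {z : Euc n × ℝ}
    (hz : Metric.closedBall z φ.rOut ⊆ U ×ˢ Ioi (0 : ℝ)) :
    IsTestFunction U fun y => φ.normed volume (z - y) := by
  have hsub : tsupport (fun y => φ.normed volume (z - y)) ⊆ Metric.closedBall z φ.rOut := by
    refine closure_minimal (fun y hy => ?_) Metric.isClosed_closedBall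
    have h1 : z - y ∈ Function.support (φ.normed volume) := hy
    rw [φ.support_normed_eq, Metric.mem_ball, dist_zero_right, ← dist_eq_norm] at h1
    rw [Metric.mem_closedBall, dist_comm]; exact h1.le
  refine ⟨φ.contDiff_normed.comp (contDiff_const.sub contDiff_id), ?_, hsub.trans hz⟩
  exact HasCompactSupport.of_support_subset_isCompact (isCompact_closedBall z φ.rOut)
    (subset_closure.trans hsub)

/-- The sign produced by reflecting the kernel is what cancels the minus sign in the definition of
the weak gradient. -/
theorem fderiv_mollifier_sub (φ : ContDiffBump (0 : Euc n × ℝ)) (z y : Euc n × ℝ) :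
    fderiv ℝ (fun y => φ.normed volume (z - y)) y = - fderiv ℝ (φ.normed volume) (z - y) := by
  have hd : DifferentiableAt ℝ (φ.normed volume) (z - y) :=
    (φ.contDiff_normed (n := 1)).differentiable one_ne_zero _
  have h := hd.hasFDerivAt.comp y ((hasFDerivAt_id y).const_sub z)
  have h2 := h.fderiv
  simp only [Function.comp_def] at h2
  rw [h2]; ext <;> simp

theorem mollifier_sub_eq_zero (φ : ContDiffBump (0 : Euc n × ℝ)) {z y : Euc n × ℝ}
    (hy : y ∉ Metric.closedBall z φ.rOut) : φ.normed volume (z - y) = 0 ∧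
      fderiv ℝ (φ.normed volume) (z - y) = 0 := by
  have h : z - y ∉ tsupport (φ.normed (volume : Measure (Euc n × ℝ))) := by
    rw [φ.tsupport_normed_eq, Metric.mem_closedBall, dist_zero_right, ← dist_eq_norm, dist_comm]
    exact hy
  exact ⟨image_eq_zero_of_notMem_tsupport h, fderiv_of_notMem_tsupport (𝕜 := ℝ) h⟩

theorem setIntegral_eq_integral_of_eq_zero_off {X : Type*} [MeasurableSpace X] {μ : Measure X}
    {Ω Q : Set X} (hQ : Q ⊆ Ω) {F : X → ℝ} (hF : ∀ y ∉ Q, F y = 0) :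
    ∫ y in Ω, F y ∂μ = ∫ y, F y ∂μ :=
  setIntegral_eq_integral_of_forall_compl_eq_zero fun y hy => hF y fun h => hy (hQ h)

/-- Mollification commutes with the linear relation between `p` and its flux. So `B` is the
mollification of the flux, not the flux of the mollified gradient, and no error term appears in the
equation. Domination is by the mollification of one integrable function, through Jensen's
inequality. -/
theorem IsLocalWeakSolution.nonempty_fluxApproximation (hU : IsOpen U)
    (hp : IsLocalWeakSolution g U p) {G : ℝ → Euc n → Euc n}
    (hG : ∀ Q : Set (Euc n × ℝ), IsCompact Q → Q ⊆ U ×ˢ Ioi (0 : ℝ) →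
      MemLp (fun z : Euc n × ℝ => G z.2 z.1) (ENNReal.ofReal (2 - g.a)) (volume.restrict Q))
    (hGw : IsWeakSpatialGradient U p G)
    (heq : ∀ φ : Euc n × ℝ → ℝ, IsTestFunction U φ →
      ∫ z in U ×ˢ Ioi (0 : ℝ), p z.2 z.1 * fderiv ℝ φ z (0, 1) =
        ∫ z in U ×ˢ Ioi (0 : ℝ), fderiv ℝ φ z (g.K ‖G z.2 z.1‖ • G z.2 z.1, 0))
    {Q : Set (Euc n × ℝ)} (hQ : IsCompact Q) (hQU : Q ⊆ U ×ˢ Ioi (0 : ℝ)) :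
    Nonempty (FluxApproximation (2 - g.a) ((2 - g.a) / (1 - g.a)) Q (fun z => p z.2 z.1)
      (fun z => G z.2 z.1) (fun z => g.K ‖G z.2 z.1‖ • G z.2 z.1)) := by
  have ha := g.a_lt_one
  have ha0 := g.a_pos
  have hq' : 1 ≤ (2 - g.a) / (1 - g.a) := by rw [le_div_iff₀ (by linarith)]; linarith
  obtain ⟨δ, hδ, hδU⟩ := hQ.exists_cthickening_subset_open (hU.prod isOpen_Ioi) hQU
  -- For `z ∈ Q` every kernel of radius at most `δ` centred at `z` lives in `R`. Cutting the data
  -- off to `R` therefore leaves the mollified relations on `Q` unchanged and makes the data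
  -- globally integrable.
  set R := Metric.cthickening δ Q with hR
  have hRc : IsCompact R := hQ.cthickening
  have hRm : MeasurableSet R := hRc.measurableSet
  have hRfin : IsFiniteMeasure (volume.restrict R : Measure (Euc n × ℝ)) :=
    ⟨by rw [Measure.restrict_apply_univ]; exact hRc.measure_lt_top⟩
  have hball : ∀ z ∈ Q, ∀ r ≤ δ, Metric.closedBall z r ⊆ R := fun z hz r hr y hy =>
    Metric.mem_cthickening_of_dist_le y z δ Q hz ((Metric.mem_closedBall.1 hy).trans hr)
  -- the data, cut off to the compact neighbourhood `R`
  have hpL := hp.memLp_two_prod hRc hδU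
  have hGL := hG R hRc hδU
  set p₁ : Euc n × ℝ → ℝ := R.indicator fun z => p z.2 z.1 with hp₁
  set G₁ : Euc n × ℝ → Euc n := R.indicator fun z => G z.2 z.1 with hG₁
  set A₁ : Euc n × ℝ → Euc n := R.indicator fun z => g.K ‖G z.2 z.1‖ • G z.2 z.1 with hA₁
  have hA₁' : ∀ z, A₁ z = g.K ‖G₁ z‖ • G₁ z := by
    intro z
    by_cases hz : z ∈ R <;> simp [hA₁, hG₁, hz]
  have hip : Integrable p₁ :=
    (integrable_indicator_iff hRm).2 (hpL.integrable (by norm_num))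
  have hiG : Integrable G₁ := (integrable_indicator_iff hRm).2
    (hGL.integrable (ENNReal.one_le_ofReal.2 (by linarith)))
  have hAm : AEStronglyMeasurable A₁ volume := by
    have : A₁ = fun z => g.K ‖G₁ z‖ • G₁ z := funext hA₁'
    rw [this]
    exact (g.measurable_K_norm hiG.1).smul hiG.1
  have hiA : Integrable A₁ := by
    refine (hiG.norm.const_mul (1 / g.coeff 0)).mono' hAm (Eventually.of_forall fun z => ?_)
    rw [hA₁', norm_smul, Real.norm_of_nonneg (g.K_nonneg (norm_nonneg _))]
    exact mul_le_mul_of_nonneg_right (g.K_le (norm_nonneg _)) (norm_nonneg _)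
  have hip2 : Integrable fun z => ‖p₁ z‖ ^ (2 : ℝ) := by
    have h := hpL.integrable_norm_rpow (by norm_num) (by norm_num)
    have h2 := (integrable_indicator_iff hRm).2 h
    refine h2.congr (Eventually.of_forall fun z => ?_)
    by_cases hz : z ∈ R <;> simp [hp₁, hz]
  have hiGq : Integrable fun z => ‖G₁ z‖ ^ (2 - g.a) := by
    have h := hGL.integrable_norm_rpow (by simp; linarith) (by simp)
    rw [ENNReal.toReal_ofReal (by linarith)] at h
    have h2 := (integrable_indicator_iff hRm).2 h
    refine h2.congr (Eventually.of_forall fun z => ?_)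
    by_cases hz : z ∈ R
    · simp [hG₁, hz]
    · simp [hG₁, hz, Real.zero_rpow (show (2 - g.a) ≠ 0 by linarith)]
  obtain ⟨C, hC, hCle⟩ := g.exists_flux_rpow_le
  -- The growth bound for the flux turns `L^{2-a}` integrability of the gradient into integrability
  -- in the conjugate exponent.
  have hiAq : Integrable fun z => ‖A₁ z‖ ^ ((2 - g.a) / (1 - g.a)) := by
    refine (hiGq.const_mul C).mono'
      ((hAm.norm.aemeasurable.pow_const _).aestronglyMeasurable)
      (Eventually.of_forall fun z => ?_)
    rw [Real.norm_of_nonneg (by positivity), hA₁', norm_smul,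
      Real.norm_of_nonneg (g.K_nonneg (norm_nonneg _))]
    exact hCle _ (norm_nonneg _)
  set d₀ : Euc n × ℝ → ℝ := fun z => ‖p₁ z‖ ^ (2 : ℝ) + ‖G₁ z‖ ^ (2 - g.a)
    + ‖A₁ z‖ ^ ((2 - g.a) / (1 - g.a)) with hd₀
  have hid : Integrable d₀ := (hip2.add hiGq).add hiAq
  obtain ⟨φ, hφ0, hφ2, hφδ⟩ := ContDiffBump.exists_seq (X := Euc n × ℝ) δ hδ
  have hae : ∀ {F : Type} [NormedAddCommGroup F] [NormedSpace ℝ F] [CompleteSpace F]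
      {f : Euc n × ℝ → F}, Integrable f → ∀ᵐ z, Tendsto
        (fun m => ((φ m).normed volume ⋆[lsmul ℝ ℝ, volume] f) z) atTop (𝓝 (f z)) :=
    fun hf => ContDiffBump.ae_convolution_tendsto_right_of_locallyIntegrable hφ0
      (Eventually.of_forall hφ2) hf.locallyIntegrable
  have hsupp : ∀ m, ∀ z ∈ Q, ∀ y ∉ R, (φ m).normed volume (z - y) = 0 ∧
      fderiv ℝ ((φ m).normed volume) (z - y) = 0 := fun m z hz y hy =>
    mollifier_sub_eq_zero (φ m) fun h => hy (hball z hz _ (hφδ m) h)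
  refine ⟨{
    P := fun m => (φ m).normed volume ⋆[lsmul ℝ ℝ, volume] p₁
    H := fun m => (φ m).normed volume ⋆[lsmul ℝ ℝ, volume] G₁
    B := fun m => (φ m).normed volume ⋆[lsmul ℝ ℝ, volume] A₁
    d := fun m => (φ m).normed volume ⋆[lsmul ℝ ℝ, volume] d₀
    d₀ := d₀
    contDiff_P := fun m => contDiff_mollify _ hip
    contDiff_H := fun m => contDiff_mollify _ hiG
    contDiff_B := fun m => contDiff_mollify _ hiA
    fderiv_space := ?_
    fderiv_time := ?_
    tendsto := ?_
    integrable_d := fun m => ((φ m).integrable_normed).integrable_convolution _ hid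
    integrable_d₀ := hid
    tendsto_d := hae hid
    integral_d := ?_
    P_le := ?_
    H_le := ?_
    B_le := ?_ }⟩
  · intro m z hz v
    rw [fderiv_mollify_apply _ hip]
    have hw := hGw _ (isTestFunction_mollifier (φ m) ((hball z hz _ (hφδ m)).trans hδU)) v
    simp only [fderiv_mollifier_sub] at hw
    rw [setIntegral_eq_integral_of_eq_zero_off hδU (fun y hy => by simp [(hsupp m z hz y hy).2]),
      setIntegral_eq_integral_of_eq_zero_off hδU (fun y hy => by simp [(hsupp m z hz y hy).1])] at hw
    have h1 : ∫ y, fderiv ℝ ((φ m).normed volume) (z - y) (v, 0) • p₁ y =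
        - ∫ y, p y.2 y.1 * (-fderiv ℝ ((φ m).normed volume) (z - y)) (v, 0) := by
      rw [← integral_neg]
      refine integral_congr_ae (Eventually.of_forall fun y => ?_)
      by_cases hy : y ∈ R
      · simp [hp₁, hy, mul_comm]
      · simp [hp₁, hy, (hsupp m z hz y hy).2]
    rw [h1, hw, neg_neg, convolution_lsmul_swap, real_inner_comm, ← innerSL_apply_apply ℝ,
      ← ContinuousLinearMap.integral_comp_comm _ (integrable_mollifier_smul (φ m) hiG z)]
    refine integral_congr_ae (Eventually.of_forall fun y => ?_)
    by_cases hy : y ∈ R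
    · simp [hG₁, hy, real_inner_comm, mul_comm]
    · simp [(hsupp m z hz y hy).1]
  · intro m z hz
    have hw := heq _ (isTestFunction_mollifier (φ m) ((hball z hz _ (hφδ m)).trans hδU))
    simp only [fderiv_mollifier_sub] at hw
    rw [setIntegral_eq_integral_of_eq_zero_off hδU (fun y hy => by simp [(hsupp m z hz y hy).2]),
      setIntegral_eq_integral_of_eq_zero_off hδU (fun y hy => by simp [(hsupp m z hz y hy).2])] at hw
    rw [fderiv_mollify_apply _ hip]
    have h1 : ∫ y, fderiv ℝ ((φ m).normed volume) (z - y) (0, 1) • p₁ y =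
        - ∫ y, p y.2 y.1 * (-fderiv ℝ ((φ m).normed volume) (z - y)) (0, 1) := by
      rw [← integral_neg]
      refine integral_congr_ae (Eventually.of_forall fun y => ?_)
      by_cases hy : y ∈ R
      · simp [hp₁, hy, mul_comm]
      · simp [hp₁, hy, (hsupp m z hz y hy).2]
    have hi : ∀ w : Euc n × ℝ,
        Integrable fun y => fderiv ℝ ((φ m).normed volume) (z - y) w • A₁ y := by
      intro w
      have hcd : ContDiff ℝ 1 ((φ m).normed (volume : Measure (Euc n × ℝ))) :=
        (φ m).contDiff_normed
      have hc : Continuous fun y => fderiv ℝ ((φ m).normed volume) (z - y) w :=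
        ((hcd.continuous_fderiv one_ne_zero).comp (continuous_const.sub continuous_id)).clm_apply
          continuous_const
      obtain ⟨C, hC⟩ := (hcd.continuous_fderiv one_ne_zero).bounded_above_of_compact_support
        (((φ m).hasCompactSupport_normed (μ := volume)).fderiv ℝ)
      exact hiA.bdd_smul (C * ‖w‖) hc.aestronglyMeasurable (Eventually.of_forall fun y =>
        (ContinuousLinearMap.le_opNorm _ _).trans (by gcongr; exact hC _))
    rw [h1, hw, ← integral_neg]
    have h2 : ∀ i : Fin n, fderiv ℝ ((φ m).normed volume ⋆[lsmul ℝ ℝ, volume] A₁) z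
        (EuclideanSpace.single i 1, 0) i = ∫ y, fderiv ℝ ((φ m).normed volume) (z - y)
          (EuclideanSpace.single i 1, 0) * A₁ y i := by
      intro i
      rw [fderiv_mollify_apply _ hiA]
      have := (EuclideanSpace.proj (𝕜 := ℝ) i).integral_comp_comm (hi (EuclideanSpace.single i 1, 0))
      simpa using this.symm
    simp_rw [h2]
    rw [← integral_finsetSum]
    · refine integral_congr_ae (Eventually.of_forall fun y => ?_)
      by_cases hy : y ∈ R
      · simp only [← ContinuousLinearMap.apply_prod_zero_eq_sum]
        simp [hA₁, hy]
      · simp [(hsupp m z hz y hy).2]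
    · intro i _
      have := (EuclideanSpace.proj (𝕜 := ℝ) i).integrable_comp (hi (EuclideanSpace.single i 1, 0))
      simpa using this
  · filter_upwards [hae hip, hae hiG, hae hiA] with z h1 h2 h3 hz
    have hzR : z ∈ R := Metric.self_subset_cthickening Q hz
    refine ⟨?_, ?_, ?_⟩
    · simpa [hp₁, hzR] using h1
    · simpa [hG₁, hzR] using h2
    · simpa [hA₁, hzR] using h3
  -- A kernel of unit mass preserves integrals, so the dominating functions all have the same
  -- integral.
  · intro m
    rw [integral_convolution _ (φ m).integrable_normed hid, (φ m).integral_normed]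
    simp
  · intro m z
    have h := norm_mollify_rpow_le (φ m) (r := 2) (by norm_num) hip hip2 z
    rw [Real.rpow_two, Real.norm_eq_abs, sq_abs] at h
    refine h.trans (mollify_mono (φ m) hip2 hid (fun y => ?_) z)
    simp only [hd₀, add_assoc]
    exact le_add_of_nonneg_right (by positivity)
  · intro m z
    refine (norm_mollify_rpow_le (φ m) (by linarith) hiG hiGq z).trans
      (mollify_mono (φ m) hiGq hid (fun y => ?_) z)
    have h1 : 0 ≤ ‖p₁ y‖ ^ (2 : ℝ) := by positivity
    have h2 : 0 ≤ ‖A₁ y‖ ^ ((2 - g.a) / (1 - g.a)) := by positivity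
    simp only [hd₀]; linarith
  · intro m z
    refine (norm_mollify_rpow_le (φ m) hq' hiA hiAq z).trans
      (mollify_mono (φ m) hiAq hid (fun y => ?_) z)
    exact le_add_of_nonneg_left (by positivity)

end Approximation

/-! ### The energy identity for smooth functions. -/

section EnergyIdentity

variable {n : ℕ}

theorem HasCompactSupport.slice_left {F : Type*} [Zero F] {W : Euc n × ℝ → F}
    (hW : HasCompactSupport W) (t : ℝ) : HasCompactSupport fun x => W (x, t) := by
  refine HasCompactSupport.intro (hW.isCompact.image continuous_fst) fun x hx => ?_
  exact image_eq_zero_of_notMem_tsupport fun h => hx ⟨(x, t), h, rfl⟩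

theorem HasCompactSupport.slice_right {F : Type*} [Zero F] {W : Euc n × ℝ → F}
    (hW : HasCompactSupport W) (x : Euc n) : HasCompactSupport fun t => W (x, t) := by
  refine HasCompactSupport.intro (hW.isCompact.image continuous_snd) fun t ht => ?_
  exact image_eq_zero_of_notMem_tsupport fun h => ht ⟨(x, t), h, rfl⟩

theorem HasFDerivAt.slice_left {F : Type*} [NormedAddCommGroup F] [NormedSpace ℝ F]
    {W : Euc n × ℝ → F} {W' : Euc n × ℝ →L[ℝ] F} {x : Euc n} {t : ℝ}
    (hW : HasFDerivAt W W' (x, t)) :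
    HasFDerivAt (fun y => W (y, t)) (W'.comp (ContinuousLinearMap.inl ℝ (Euc n) ℝ)) x :=
  HasFDerivAt.comp (f := fun y : Euc n => (y, t)) x hW (hasFDerivAt_prodMk_left x t)

theorem restrict_univ_prod_Iic (τ : ℝ) :
    (volume : Measure (Euc n × ℝ)).restrict (univ ×ˢ Iic τ) =
      (volume : Measure (Euc n)).prod ((volume : Measure ℝ).restrict (Iic τ)) := by
  rw [Measure.volume_eq_prod, ← Measure.prod_restrict, Measure.restrict_univ]

theorem integral_fderiv_time {W : Euc n × ℝ → ℝ} (hW : ContDiff ℝ 1 W)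
    (hWc : HasCompactSupport W) (τ : ℝ) :
    ∫ z in univ ×ˢ Iic τ, fderiv ℝ W z (0, 1) = ∫ x, W (x, τ) := by
  have hc : Continuous fun z => fderiv ℝ W z (0, 1) :=
    (hW.continuous_fderiv one_ne_zero).clm_apply continuous_const
  have hi : Integrable fun z => fderiv ℝ W z (0, 1) :=
    hc.integrable_of_hasCompactSupport (hWc.fderiv_apply ℝ _)
  have hi2 := hi.restrict (s := univ ×ˢ Iic τ)
  rw [restrict_univ_prod_Iic] at hi2 ⊢
  rw [integral_prod _ hi2]
  refine integral_congr_ae (Eventually.of_forall fun x => ?_)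
  simp only
  have hd : ∀ t, HasDerivAt (fun t => W (x, t)) (fderiv ℝ W (x, t) (0, 1)) t := fun t => by
    have h1 := (hW.differentiable one_ne_zero (x, t)).hasFDerivAt
    have h2 : HasFDerivAt (fun t : ℝ => (x, t)) (ContinuousLinearMap.inr ℝ (Euc n) ℝ) t :=
      hasFDerivAt_prodMk_right x t
    have h3 := (h1.comp t h2).hasDerivAt
    simp only [Function.comp_def, ContinuousLinearMap.comp_apply,
      ContinuousLinearMap.inr_apply] at h3
    exact h3
  have hs : ContDiff ℝ 1 fun t => W (x, t) := hW.comp (contDiff_const.prodMk contDiff_id)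
  rw [← HasCompactSupport.integral_Iic_deriv_eq hs (hWc.slice_right x) τ]
  exact integral_congr_ae (Eventually.of_forall fun t => ((hd t).deriv).symm)

/-- On each time slice the compactly supported function is integrated by parts against the constant
`1`. -/
theorem integral_fderiv_space {W : Euc n × ℝ → ℝ} (hW : ContDiff ℝ 1 W)
    (hWc : HasCompactSupport W) (τ : ℝ) (v : Euc n) :
    ∫ z in univ ×ˢ Iic τ, fderiv ℝ W z (v, 0) = 0 := by
  have hc : Continuous fun z => fderiv ℝ W z (v, 0) :=
    (hW.continuous_fderiv one_ne_zero).clm_apply continuous_const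
  have hi : Integrable fun z => fderiv ℝ W z (v, 0) :=
    hc.integrable_of_hasCompactSupport (hWc.fderiv_apply ℝ _)
  have hi2 := hi.restrict (s := univ ×ˢ Iic τ)
  rw [restrict_univ_prod_Iic] at hi2 ⊢
  rw [integral_prod_symm _ hi2]
  refine integral_eq_zero_of_ae (Eventually.of_forall fun t => ?_)
  have hs : ContDiff ℝ 1 fun x => W (x, t) := hW.comp (contDiff_id.prodMk contDiff_const)
  have hd : ∀ x, fderiv ℝ (fun y => W (y, t)) x v = fderiv ℝ W (x, t) (v, 0) := fun x => by
    rw [(hW.differentiable one_ne_zero (x, t)).hasFDerivAt.slice_left.fderiv]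
    simp
  simp only [← hd, Pi.zero_apply]
  have h := integral_mul_fderiv_eq_neg_fderiv_mul_of_integrable (μ := volume) (𝕜 := ℝ)
    (f := fun _ : Euc n => (1 : ℝ)) (g := fun x => W (x, t)) (v := v) (by simp)
    (by
      simp only [one_mul]
      exact ((hs.continuous_fderiv one_ne_zero).clm_apply
        continuous_const).integrable_of_hasCompactSupport ((hWc.slice_left t).fderiv_apply ℝ _))
    (by
      simp only [one_mul]
      exact hs.continuous.integrable_of_hasCompactSupport (hWc.slice_left t))
    (fun x _ => by fun_prop) (fun x _ => hs.differentiable one_ne_zero x)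
  simpa using h

/-- The energy identity for a smooth solution of `∂P/∂t = ∇ · B`, tested with `f(P) η`. -/
theorem energy_identity {P η : Euc n × ℝ → ℝ} {H B : Euc n × ℝ → Euc n}
    (hP : ContDiff ℝ 1 P) (hB : ContDiff ℝ 1 B) (hη : ContDiff ℝ 1 η)
    (hηc : HasCompactSupport η) {F f f' : ℝ → ℝ} (hF : ∀ s, HasDerivAt F (f s) s)
    (hf : ∀ s, HasDerivAt f (f' s) s) (hf' : Continuous f')
    (hs : ∀ z ∈ tsupport η, ∀ v, fderiv ℝ P z (v, 0) = inner ℝ (H z) v)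
    (ht : ∀ z ∈ tsupport η, fderiv ℝ P z (0, 1) =
      ∑ i, fderiv ℝ B z (EuclideanSpace.single i 1, 0) i) (τ : ℝ) :
    ∫ x, F (P (x, τ)) * η (x, τ) = ∫ z in univ ×ˢ Iic τ, (F (P z) * fderiv ℝ η z (0, 1)
      - f' (P z) * η z * inner ℝ (H z) (B z) - f (P z) * fderiv ℝ η z (B z, 0)) := by
  have hfc : ContDiff ℝ 1 f := contDiff_one_iff_deriv.2
    ⟨fun s => (hf s).differentiableAt, by rw [funext fun s => (hf s).deriv]; exact hf'⟩
  have hFc : ContDiff ℝ 1 F := contDiff_one_iff_deriv.2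
    ⟨fun s => (hF s).differentiableAt, by rw [funext fun s => (hF s).deriv]; exact hfc.continuous⟩
  have hBi : ∀ i, ContDiff ℝ 1 fun z => B z i := fun i =>
    (EuclideanSpace.proj (𝕜 := ℝ) i).contDiff.comp hB
  set W₀ : Euc n × ℝ → ℝ := fun z => F (P z) * η z with hW₀
  set W : Fin n → Euc n × ℝ → ℝ := fun i z => (f (P z) * η z) * B z i with hW
  have hW₀c : ContDiff ℝ 1 W₀ := (hFc.comp hP).mul hη
  have hW₀s : HasCompactSupport W₀ := hηc.mul_left
  have hWc : ∀ i, ContDiff ℝ 1 (W i) := fun i => ((hfc.comp hP).mul hη).mul (hBi i)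
  have hWs : ∀ i, HasCompactSupport (W i) := fun i => (hηc.mul_left).mul_right
  -- The integrand is the space-time divergence of `F(P)η` in time and `-f(P)ηB` in space: the term
  -- `f(P)η ∂P/∂t` cancels `f(P)η ∇·B` by the equation. The equation is known only on the support of
  -- `η`; elsewhere both sides vanish.
  have hpt : ∀ z, F (P z) * fderiv ℝ η z (0, 1) - f' (P z) * η z * inner ℝ (H z) (B z)
      - f (P z) * fderiv ℝ η z (B z, 0) = fderiv ℝ W₀ z (0, 1)
        - ∑ i, fderiv ℝ (W i) z (EuclideanSpace.single i 1, 0) := by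
    intro z
    have dP := (hP.differentiable one_ne_zero z).hasFDerivAt
    have dη := (hη.differentiable one_ne_zero z).hasFDerivAt
    have dB := (hB.differentiable one_ne_zero z).hasFDerivAt
    have dW₀ : HasFDerivAt W₀ (F (P z) • fderiv ℝ η z + η z • (f (P z) • fderiv ℝ P z)) z :=
      ((hF (P z)).comp_hasFDerivAt z dP).mul dη
    have dWi : ∀ i, HasFDerivAt (W i) ((f (P z) * η z) •
        ((EuclideanSpace.proj (𝕜 := ℝ) i).comp (fderiv ℝ B z)) + B z i •
          (f (P z) • fderiv ℝ η z + η z • (f' (P z) • fderiv ℝ P z))) z := fun i =>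
      (((hf (P z)).comp_hasFDerivAt z dP).mul dη).mul
        ((EuclideanSpace.proj (𝕜 := ℝ) i).hasFDerivAt.comp z dB)
    rw [dW₀.fderiv]
    simp_rw [fun i => (dWi i).fderiv]
    by_cases hz : z ∈ tsupport η
    · have e1 := (fderiv ℝ η z).apply_prod_zero_eq_sum (B z)
      have e2 := (fderiv ℝ P z).apply_prod_zero_eq_sum (B z)
      rw [hs z hz] at e2
      rw [e1, e2]
      simp only [_root_.add_apply, _root_.smul_apply, smul_eq_mul,
        ContinuousLinearMap.comp_apply, PiLp.proj_apply, ht z hz]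
      have : ∀ i : Fin n, f (P z) * η z * fderiv ℝ B z (EuclideanSpace.single i 1, 0) i +
          B z i * (f (P z) * fderiv ℝ η z (EuclideanSpace.single i 1, 0) +
            η z * (f' (P z) * fderiv ℝ P z (EuclideanSpace.single i 1, 0))) =
          f (P z) * η z * fderiv ℝ B z (EuclideanSpace.single i 1, 0) i +
          f (P z) * (fderiv ℝ η z (EuclideanSpace.single i 1, 0) * B z i) +
          f' (P z) * η z * (fderiv ℝ P z (EuclideanSpace.single i 1, 0) * B z i) :=
        fun i => by ring
      simp_rw [this]
      rw [Finset.sum_add_distrib, Finset.sum_add_distrib, ← Finset.mul_sum, ← Finset.mul_sum,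
        ← Finset.mul_sum]
      ring
    · simp [image_eq_zero_of_notMem_tsupport hz, fderiv_of_notMem_tsupport (𝕜 := ℝ) hz]
  simp_rw [hpt]
  have hi₀ : Integrable fun z => fderiv ℝ W₀ z (0, 1) :=
    ((hW₀c.continuous_fderiv one_ne_zero).clm_apply
      continuous_const).integrable_of_hasCompactSupport (hW₀s.fderiv_apply ℝ _)
  have hi : ∀ i, Integrable fun z => fderiv ℝ (W i) z (EuclideanSpace.single i 1, 0) := fun i =>
    (((hWc i).continuous_fderiv one_ne_zero).clm_apply
      continuous_const).integrable_of_hasCompactSupport ((hWs i).fderiv_apply ℝ _)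
  rw [integral_sub hi₀.restrict (integrable_finsetSum _ fun i _ => (hi i).restrict),
    integral_finsetSum _ (fun i _ => (hi i).restrict), integral_fderiv_time hW₀c hW₀s]
  simp [integral_fderiv_space (hWc _) (hWs _), hW₀]

end EnergyIdentity

/-! ### Smoothly truncated powers, with bounds uniform in the truncation level. -/

/-- A bounded substitute for `x ^ β`, increasing to it as `M → ∞`. -/
noncomputable def satPow (M β x : ℝ) : ℝ := (M * x / (M + x)) ^ β

/-- The truncated energy density, increasing to `(1 + s²) ^ (1 + β)`. -/
noncomputable def truncEnergy (M β s : ℝ) : ℝ := (1 + s ^ 2) * satPow M β (1 + s ^ 2)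

/-- The derivative of `truncEnergy`. -/
noncomputable def truncTest (M β s : ℝ) : ℝ :=
  2 * s * satPow M β (1 + s ^ 2) * (1 + β * (M / (M + (1 + s ^ 2))))

/-- The second derivative of `truncEnergy`. -/
noncomputable def truncTestDeriv (M β s : ℝ) : ℝ :=
  2 * satPow M β (1 + s ^ 2) * (1 + β * (M / (M + (1 + s ^ 2)))) +
    4 * s ^ 2 * satPow M β (1 + s ^ 2) * (β * (M / (M + (1 + s ^ 2))) / (1 + s ^ 2) *
      (1 + β * (M / (M + (1 + s ^ 2)))) -
        β * (M / (M + (1 + s ^ 2))) / (M + (1 + s ^ 2)))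

/-- The truncated power to which the Sobolev inequality is applied. -/
noncomputable def truncRoot (M β q s : ℝ) : ℝ :=
  (1 + s ^ 2) ^ (1 / 2 : ℝ) * satPow M β (1 + s ^ 2) ^ (1 / q)

/-- The derivative of `truncRoot`. -/
noncomputable def truncRootDeriv (M β q s : ℝ) : ℝ :=
  s * (1 + s ^ 2) ^ (1 / 2 - 1 : ℝ) * satPow M β (1 + s ^ 2) ^ (1 / q) *
    (1 + 2 / q * (β * (M / (M + (1 + s ^ 2)))))

section TruncatedPowers

variable {M β q : ℝ}

theorem satPow_pos (hM : 0 < M) {x : ℝ} (hx : 0 < x) : 0 < satPow M β x := by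
  unfold satPow; positivity

theorem satPow_le (hM : 0 < M) (hβ : 0 ≤ β) {x : ℝ} (hx : 0 < x) : satPow M β x ≤ M ^ β := by
  refine Real.rpow_le_rpow (by positivity) ?_ hβ
  rw [div_le_iff₀ (by positivity)]; nlinarith

theorem satPow_le_rpow (hM : 0 < M) (hβ : 0 ≤ β) {x : ℝ} (hx : 0 < x) :
    satPow M β x ≤ x ^ β := by
  refine Real.rpow_le_rpow (by positivity) ?_ hβ
  rw [div_le_iff₀ (by positivity)]; nlinarith

theorem tendsto_satPow (β : ℝ) {x : ℝ} (hx : 0 < x) :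
    Tendsto (fun m : ℕ => satPow (m + 1) β x) atTop (𝓝 (x ^ β)) := by
  refine Tendsto.rpow_const ?_ (Or.inl hx.ne')
  have h1 : Tendsto (fun m : ℕ => ((m : ℝ) + 1) + x) atTop atTop :=
    tendsto_atTop_add_const_right _ _
      (tendsto_atTop_add_const_right _ _ tendsto_natCast_atTop_atTop)
  -- Uses `Mx/(M+x) = x - x²/(M+x)`.
  have h2 := (tendsto_const_nhds (x := x)).sub ((tendsto_const_nhds (x := x ^ 2)).div_atTop h1)
  rw [sub_zero] at h2
  refine h2.congr fun m => ?_
  have : (m : ℝ) + 1 + x ≠ 0 := by positivity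
  field_simp; ring

/-- The logarithmic derivative is that of `x^β` multiplied by the ratio `M/(M+x) ∈ (0,1]`. Hence the
structural inequalities for pure powers survive truncation with constants that depend on `β` but not
on `M`. -/
theorem hasDerivAt_satPow (hM : 0 < M) {x : ℝ} (hx : 0 < x) :
    HasDerivAt (satPow M β) (satPow M β x * (β * (M / (M + x)) / x)) x := by
  have hu : HasDerivAt (fun x => M * x / (M + x)) ((M * 1 * (M + x) - M * x * 1) / (M + x) ^ 2) x :=
    ((hasDerivAt_id x).const_mul M).div ((hasDerivAt_id x).const_add M) (by positivity)
  have hpos : 0 < M * x / (M + x) := by positivity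
  have h : HasDerivAt (satPow M β) _ x := hu.rpow_const (p := β) (Or.inl hpos.ne')
  refine h.congr_deriv ?_
  rw [Real.rpow_sub_one hpos.ne']
  unfold satPow
  field_simp
  ring

theorem hasDerivAt_one_add_sq (s : ℝ) : HasDerivAt (fun s : ℝ => 1 + s ^ 2) (2 * s) s := by
  simpa using (hasDerivAt_pow 2 s).const_add 1

theorem hasDerivAt_satPow_sq (hM : 0 < M) (s : ℝ) :
    HasDerivAt (fun s => satPow M β (1 + s ^ 2))
      (satPow M β (1 + s ^ 2) * (β * (M / (M + (1 + s ^ 2))) / (1 + s ^ 2)) * (2 * s)) s :=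
  HasDerivAt.comp (h₂ := satPow M β) s (hasDerivAt_satPow hM (by positivity : 0 < 1 + s ^ 2))
    (hasDerivAt_one_add_sq s)

theorem hasDerivAt_truncEnergy (hM : 0 < M) (s : ℝ) :
    HasDerivAt (truncEnergy M β) (truncTest M β s) s := by
  have h : HasDerivAt (truncEnergy M β) _ s :=
    (hasDerivAt_one_add_sq s).mul (hasDerivAt_satPow_sq (β := β) hM s)
  refine h.congr_deriv ?_
  unfold truncTest
  field_simp

theorem hasDerivAt_truncTest (hM : 0 < M) (s : ℝ) :
    HasDerivAt (truncTest M β) (truncTestDeriv M β s) s := by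
  have h1 : HasDerivAt (fun s : ℝ => 1 + β * (M / (M + (1 + s ^ 2))))
      (β * ((0 * (M + (1 + s ^ 2)) - M * (2 * s)) / (M + (1 + s ^ 2)) ^ 2)) s :=
    ((((hasDerivAt_const s M).div ((hasDerivAt_one_add_sq s).const_add M)
      (by positivity))).const_mul β).const_add 1
  have h : HasDerivAt (truncTest M β) _ s :=
    (((hasDerivAt_id s).const_mul 2).mul (hasDerivAt_satPow_sq (β := β) hM s)).mul h1
  refine h.congr_deriv ?_
  unfold truncTestDeriv
  simp only [id, Pi.mul_apply]
  field_simp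
  ring

theorem hasDerivAt_truncRoot (hM : 0 < M) (s : ℝ) :
    HasDerivAt (truncRoot M β q) (truncRootDeriv M β q s) s := by
  have hx : 0 < 1 + s ^ 2 := by positivity
  have hc := satPow_pos (β := β) hM hx
  have h1 := (hasDerivAt_one_add_sq s).rpow_const (p := (1 / 2 : ℝ)) (Or.inl hx.ne')
  have h2 := (hasDerivAt_satPow_sq (β := β) hM s).rpow_const (p := 1 / q) (Or.inl hc.ne')
  have h : HasDerivAt (truncRoot M β q) _ s := h1.mul h2
  refine h.congr_deriv ?_
  unfold truncRootDeriv
  rw [Real.rpow_sub_one hc.ne', Real.rpow_sub_one hx.ne']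
  field_simp

theorem continuous_satPow_sq (hM : 0 < M) : Continuous fun s : ℝ => satPow M β (1 + s ^ 2) :=
  continuous_iff_continuousAt.2 fun s => (hasDerivAt_satPow_sq hM s).continuousAt

theorem continuous_truncTestDeriv (hM : 0 < M) : Continuous (truncTestDeriv M β) := by
  have h1 := continuous_satPow_sq (β := β) hM
  have h2 : ∀ s : ℝ, M + (1 + s ^ 2) ≠ 0 := fun s => by positivity
  have h3 : ∀ s : ℝ, 1 + s ^ 2 ≠ 0 := fun s => by positivity
  unfold truncTestDeriv
  fun_prop (disch := assumption)

theorem continuous_truncRootDeriv (hM : 0 < M) : Continuous (truncRootDeriv M β q) := by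
  have h1 : Continuous fun s : ℝ => satPow M β (1 + s ^ 2) ^ (1 / q) :=
    (continuous_satPow_sq hM).rpow_const fun s => Or.inl (satPow_pos hM (by positivity)).ne'
  have h2 : ∀ s : ℝ, M + (1 + s ^ 2) ≠ 0 := fun s => by positivity
  have h3 : Continuous fun s : ℝ => (1 + s ^ 2) ^ (1 / 2 - 1 : ℝ) :=
    (continuous_const.add (continuous_pow 2)).rpow_const fun s =>
      Or.inl (by positivity : 0 < 1 + s ^ 2).ne'
  unfold truncRootDeriv
  fun_prop (disch := assumption)

theorem truncEnergy_pos (hM : 0 < M) (s : ℝ) : 0 < truncEnergy M β s :=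
  mul_pos (by positivity) (satPow_pos hM (by positivity))

theorem satRatio_mem (hM : 0 < M) (s : ℝ) :
    0 < M / (M + (1 + s ^ 2)) ∧ M / (M + (1 + s ^ 2)) ≤ 1 := by
  refine ⟨by positivity, ?_⟩
  rw [div_le_one (by positivity)]; nlinarith

/-- The discarded part is a nonnegative multiple of a bracket, and the bracket is nonnegative
because `1/(M+x) ≤ 1/x`. -/
theorem truncTestDeriv_ge (hM : 0 < M) (hβ : 0 ≤ β) (s : ℝ) :
    2 * satPow M β (1 + s ^ 2) * (1 + β * (M / (M + (1 + s ^ 2)))) ≤ truncTestDeriv M β s := by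
  have hx : 0 < 1 + s ^ 2 := by positivity
  have hc := satPow_pos (β := β) hM hx
  obtain ⟨h0, h1⟩ := satRatio_mem hM s
  set θ := M / (M + (1 + s ^ 2))
  unfold truncTestDeriv
  refine le_add_of_nonneg_right (mul_nonneg (by positivity) ?_)
  have e1 : β * θ / (M + (1 + s ^ 2)) ≤ β * θ / (1 + s ^ 2) :=
    div_le_div_of_nonneg_left (by positivity) hx (by linarith)
  have e2 : β * θ / (1 + s ^ 2) ≤ β * θ / (1 + s ^ 2) * (1 + β * θ) :=
    le_mul_of_one_le_right (by positivity) (by nlinarith [mul_nonneg hβ h0.le])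
  linarith

theorem satPow_le_truncTestDeriv (hM : 0 < M) (hβ : 0 ≤ β) (s : ℝ) :
    2 * satPow M β (1 + s ^ 2) ≤ truncTestDeriv M β s := by
  refine le_trans (le_mul_of_one_le_right ?_ ?_) (truncTestDeriv_ge hM hβ s)
  · have := satPow_pos (β := β) hM (by positivity : 0 < 1 + s ^ 2); positivity
  · have := (satRatio_mem hM s).1
    nlinarith

theorem truncTestDeriv_le (hM : 0 < M) (hβ : 0 ≤ β) (s : ℝ) :
    truncTestDeriv M β s ≤ 2 * (1 + β) * (1 + 2 * β) * satPow M β (1 + s ^ 2) := by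
  have hx : 0 < 1 + s ^ 2 := by positivity
  have hc := satPow_pos (β := β) hM hx
  obtain ⟨h0, h1⟩ := satRatio_mem hM s
  set θ := M / (M + (1 + s ^ 2))
  set c := satPow M β (1 + s ^ 2)
  have hb : β * θ ≤ β := mul_le_of_le_one_right hβ h1
  have hb0 : 0 ≤ β * θ := by positivity
  have e1 : 0 ≤ β * θ / (M + (1 + s ^ 2)) := by positivity
  have e2 : s ^ 2 * (β * θ / (1 + s ^ 2) * (1 + β * θ) - β * θ / (M + (1 + s ^ 2)))
      ≤ β * (1 + β) := by
    calc _ ≤ s ^ 2 * (β * θ / (1 + s ^ 2) * (1 + β * θ)) := by gcongr; linarith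
      _ = s ^ 2 / (1 + s ^ 2) * (β * θ * (1 + β * θ)) := by ring
      _ ≤ 1 * (β * (1 + β)) := by
        gcongr
        rw [div_le_one hx]; linarith
      _ = _ := one_mul _
  calc truncTestDeriv M β s = 2 * c * (1 + β * θ) + 4 * c *
        (s ^ 2 * (β * θ / (1 + s ^ 2) * (1 + β * θ) - β * θ / (M + (1 + s ^ 2)))) := by
        unfold truncTestDeriv; ring
    _ ≤ 2 * c * (1 + β) + 4 * c * (β * (1 + β)) := by gcongr
    _ = _ := by ring

/-- This inequality between `f²` and `F f'` is what allows Young's inequality to absorb the flux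
term of the cutoff into the dissipation. -/
theorem truncTest_sq_le (hM : 0 < M) (hβ : 0 ≤ β) (s : ℝ) :
    truncTest M β s ^ 2 ≤ 2 * (1 + β) * truncEnergy M β s * truncTestDeriv M β s := by
  have hx : 0 < 1 + s ^ 2 := by positivity
  have hc := satPow_pos (β := β) hM hx
  have hge := truncTestDeriv_ge hM hβ s
  obtain ⟨h0, h1⟩ := satRatio_mem hM s
  unfold truncTest truncEnergy
  set θ := M / (M + (1 + s ^ 2))
  set c := satPow M β (1 + s ^ 2)
  have hb : β * θ ≤ β := mul_le_of_le_one_right hβ h1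
  have hb0 : 0 ≤ β * θ := by positivity
  calc _ = 2 * (1 + β * θ) * (s ^ 2 * c) * (2 * c * (1 + β * θ)) := by ring
    _ ≤ 2 * (1 + β) * ((1 + s ^ 2) * c) * truncTestDeriv M β s := by gcongr; linarith

theorem abs_truncTest_le (hM : 0 < M) (hβ : 0 ≤ β) (s : ℝ) :
    |truncTest M β s| ≤ 2 * (1 + β) * M ^ β * |s| := by
  have hx : 0 < 1 + s ^ 2 := by positivity
  have hc := satPow_pos (β := β) hM hx
  have hcM := satPow_le hM hβ hx
  obtain ⟨h0, h1⟩ := satRatio_mem hM s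
  unfold truncTest
  set θ := M / (M + (1 + s ^ 2))
  set c := satPow M β (1 + s ^ 2)
  have hb : β * θ ≤ β := mul_le_of_le_one_right hβ h1
  have hb0 : 0 ≤ β * θ := by positivity
  rw [abs_mul, abs_mul, abs_mul, abs_two, abs_of_pos hc, abs_of_pos (by linarith : 0 < 1 + β * θ)]
  calc 2 * |s| * c * (1 + β * θ) ≤ 2 * |s| * M ^ β * (1 + β) := by gcongr
    _ = _ := by ring

theorem truncRoot_nonneg (hM : 0 < M) (s : ℝ) : 0 ≤ truncRoot M β q s :=
  mul_nonneg (by positivity) (Real.rpow_nonneg (satPow_pos hM (by positivity)).le _)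

/-- The root is weighted so that its `q`-th power is a truncated `(α-a)`-power of `(1+s²)^{1/2}`,
where `α = 2+2β` and `q = 2-a`, while the `q`-th power of its derivative is controlled by the
truncation factor alone. That factor also bounds `f'` from below. -/
theorem truncRoot_rpow (hM : 0 < M) (hq : 0 < q) (s : ℝ) :
    truncRoot M β q s ^ q = (1 + s ^ 2) ^ (q / 2) * satPow M β (1 + s ^ 2) := by
  have hc := satPow_pos (β := β) hM (by positivity : 0 < 1 + s ^ 2)
  unfold truncRoot
  rw [Real.mul_rpow (by positivity) (by positivity), ← Real.rpow_mul (by positivity),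
    ← Real.rpow_mul hc.le, one_div_mul_cancel hq.ne', Real.rpow_one]
  congr 2; ring

theorem truncRoot_rpow_le (hM : 0 < M) (hq : 0 < q) (hq2 : q ≤ 2) (s : ℝ) :
    truncRoot M β q s ^ q ≤ truncEnergy M β s := by
  rw [truncRoot_rpow hM hq]
  refine mul_le_mul_of_nonneg_right ?_ (satPow_pos hM (by positivity)).le
  calc (1 + s ^ 2) ^ (q / 2) ≤ (1 + s ^ 2) ^ (1 : ℝ) :=
        Real.rpow_le_rpow_of_exponent_le (by nlinarith) (by linarith)
    _ = _ := Real.rpow_one _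

theorem abs_truncRootDeriv_rpow_le (hM : 0 < M) (hβ : 0 ≤ β) (hq : 1 ≤ q) (hq2 : q ≤ 2) (s : ℝ) :
    |truncRootDeriv M β q s| ^ q ≤ (1 + 2 * β) ^ 2 * satPow M β (1 + s ^ 2) := by
  have hx : 0 < 1 + s ^ 2 := by positivity
  have hc := satPow_pos (β := β) hM hx
  obtain ⟨h0, h1⟩ := satRatio_mem hM s
  -- The first factor of the root, `(1+s²)^{1/2}`, is Lipschitz with constant one.
  have hs : |s| * (1 + s ^ 2) ^ (1 / 2 - 1 : ℝ) ≤ 1 := by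
    have e : (1 / 2 - 1 : ℝ) = -(1 / 2) := by norm_num
    rw [e, Real.rpow_neg hx.le, ← Real.sqrt_eq_rpow, ← div_eq_mul_inv,
      div_le_one (by positivity)]
    exact Real.abs_le_sqrt (by linarith)
  have hle : |truncRootDeriv M β q s| ≤ (1 + 2 * β) * satPow M β (1 + s ^ 2) ^ (1 / q) := by
    unfold truncRootDeriv
    set θ := M / (M + (1 + s ^ 2))
    set c := satPow M β (1 + s ^ 2)
    have hb : β * θ ≤ β := mul_le_of_le_one_right hβ h1
    have hb0 : 0 ≤ β * θ := by positivity
    have hq3 : 2 / q ≤ 2 := by rw [div_le_iff₀ (by linarith)]; linarith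
    rw [abs_mul, abs_mul, abs_mul, abs_of_pos (by positivity : 0 < (1 + s ^ 2) ^ (1 / 2 - 1 : ℝ)),
      abs_of_pos (by positivity : 0 < c ^ (1 / q)),
      abs_of_pos (by positivity : 0 < 1 + 2 / q * (β * θ))]
    calc |s| * (1 + s ^ 2) ^ (1 / 2 - 1 : ℝ) * c ^ (1 / q) * (1 + 2 / q * (β * θ))
        ≤ 1 * c ^ (1 / q) * (1 + 2 * β) := by gcongr
      _ = _ := by ring
  calc _ ≤ ((1 + 2 * β) * satPow M β (1 + s ^ 2) ^ (1 / q)) ^ q :=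
        Real.rpow_le_rpow (abs_nonneg _) hle (by linarith)
    _ = (1 + 2 * β) ^ q * satPow M β (1 + s ^ 2) := by
        rw [Real.mul_rpow (by positivity) (by positivity), ← Real.rpow_mul hc.le,
          one_div_mul_cancel (by positivity), Real.rpow_one]
    _ ≤ _ := by
        gcongr
        rw [← Real.rpow_two]
        exact Real.rpow_le_rpow_of_exponent_le (by linarith) hq2

end TruncatedPowers

/-! ### Passage to the limit in the energy identity. -/

section Limits

theorem add_rpow_le_four_mul {x y q : ℝ} (hx : 0 ≤ x) (hy : 0 ≤ y) (hq : 0 ≤ q) (hq2 : q ≤ 2) :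
    (x + y) ^ q ≤ 4 * (x ^ q + y ^ q) := by
  have h2 : (2 : ℝ) ^ q ≤ 4 := by
    calc (2 : ℝ) ^ q ≤ 2 ^ (2 : ℝ) := Real.rpow_le_rpow_of_exponent_le (by norm_num) hq2
      _ = 4 := by norm_num
  have hx' := Real.rpow_nonneg hx q
  have hy' := Real.rpow_nonneg hy q
  rcases le_total x y with h | h
  · calc (x + y) ^ q ≤ (2 * y) ^ q := Real.rpow_le_rpow (by positivity) (by linarith) hq
      _ = 2 ^ q * y ^ q := Real.mul_rpow (by norm_num) hy
      _ ≤ 4 * (x ^ q + y ^ q) := by gcongr; linarith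
  · calc (x + y) ^ q ≤ (2 * x) ^ q := Real.rpow_le_rpow (by positivity) (by linarith) hq
      _ = 2 ^ q * x ^ q := Real.mul_rpow (by norm_num) hx
      _ ≤ 4 * (x ^ q + y ^ q) := by gcongr; linarith

/-- Fatou's lemma for an almost everywhere convergent sequence. -/
theorem lintegral_le_liminf_of_ae_tendsto {X : Type*} [MeasurableSpace X] {μ : Measure X}
    {f : ℕ → X → ℝ≥0∞} {f₀ : X → ℝ≥0∞} (hf : ∀ m, AEMeasurable (f m) μ)
    (h : ∀ᵐ x ∂μ, Tendsto (fun m => f m x) atTop (𝓝 (f₀ x))) :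
    ∫⁻ x, f₀ x ∂μ ≤ liminf (fun m => ∫⁻ x, f m x ∂μ) atTop := by
  refine le_trans (le_of_eq (lintegral_congr_ae ?_)) (lintegral_liminf_le' hf)
  filter_upwards [h] with x hx
  exact hx.liminf_eq.symm

theorem ae_ae_slice_of_ae {n : ℕ} {P : Euc n × ℝ → Prop} (h : ∀ᵐ z, P z) :
    ∀ᵐ t : ℝ, ∀ᵐ x : Euc n, P (x, t) := by
  have h1 := (Measure.measurePreserving_swap (μ := (volume : Measure ℝ))
    (ν := (volume : Measure (Euc n)))).quasiMeasurePreserving.ae h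
  exact Measure.ae_ae_of_ae_prod h1

variable {n : ℕ} {q q' : ℝ} {Q : Set (Euc n × ℝ)} {p : Euc n × ℝ → ℝ} {G A : Euc n × ℝ → Euc n}

theorem FluxApproximation.d_nonneg (Φ : FluxApproximation q q' Q p G A) (m : ℕ)
    (z : Euc n × ℝ) : 0 ≤ Φ.d m z :=
  (sq_nonneg _).trans (Φ.P_le m z)

/-- The dominating functions are multiples of `d m` plus the indicator of the compact set `Q`. They
converge almost everywhere and their integrals do not depend on `m`, which is the situation of the
generalized dominated convergence theorem. -/
theorem FluxApproximation.tendsto_setIntegral (Φ : FluxApproximation q q' Q p G A)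
    (hQ : IsCompact Q) {X : ℕ → Euc n × ℝ → ℝ} {X₀ : Euc n × ℝ → ℝ} (hX : ∀ m, Continuous (X m))
    {C : ℝ} (hle : ∀ m, ∀ z ∈ Q, |X m z| ≤ C * (Φ.d m z + 1))
    (hz : ∀ m, ∀ z ∉ Q, X m z = 0) (hz₀ : ∀ z ∉ Q, X₀ z = 0)
    (hlim : ∀ᵐ z, z ∈ Q → Tendsto (fun m => X m z) atTop (𝓝 (X₀ z))) :
    Integrable X₀ ∧ ∀ S : Set (Euc n × ℝ), MeasurableSet S →
      Tendsto (fun m => ∫ z in S, X m z) atTop (𝓝 (∫ z in S, X₀ z)) := by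
  have hi1 : Integrable (Q.indicator fun _ : Euc n × ℝ => (1 : ℝ)) :=
    (integrable_indicator_iff hQ.measurableSet).2 (integrableOn_const hQ.measure_lt_top.ne)
  have key : ∀ S : Set (Euc n × ℝ), MeasurableSet S → Integrable (S.indicator X₀) ∧
      Tendsto (fun m => ∫ z, S.indicator (X m) z) atTop (𝓝 (∫ z, S.indicator X₀ z)) := by
    intro S hS
    refine tendsto_integral_of_dominated_of_tendsto
      (g := fun m z => |C| * (Φ.d m z + Q.indicator (fun _ => (1 : ℝ)) z))
      (g₀ := fun z => |C| * (Φ.d₀ z + Q.indicator (fun _ => (1 : ℝ)) z))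
      (fun m => (hX m).aestronglyMeasurable.indicator hS)
      (fun m => ((Φ.integrable_d m).add hi1).const_mul _)
      ((Φ.integrable_d₀.add hi1).const_mul _) (fun m => Eventually.of_forall fun z => ?_) ?_ ?_ ?_
    · have h0 : 0 ≤ |C| * (Φ.d m z + Q.indicator (fun _ => (1 : ℝ)) z) := by
        have := Φ.d_nonneg m z
        have : 0 ≤ Q.indicator (fun _ => (1 : ℝ)) z := indicator_nonneg (fun _ _ => zero_le_one) z
        positivity
      by_cases hzS : z ∈ S
      · rw [indicator_of_mem hzS]
        by_cases hzQ : z ∈ Q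
        · rw [indicator_of_mem hzQ]
          refine (hle m z hzQ).trans (mul_le_mul_of_nonneg_right (le_abs_self C) ?_)
          have := Φ.d_nonneg m z
          linarith
        · rw [hz m z hzQ, abs_zero]; exact h0
      · rw [indicator_of_notMem hzS, abs_zero]; exact h0
    · filter_upwards [hlim] with z h
      by_cases hzS : z ∈ S
      · simp only [indicator_of_mem hzS]
        by_cases hzQ : z ∈ Q
        · exact h hzQ
        · simp [hz _ z hzQ, hz₀ z hzQ]
      · simp [indicator_of_notMem hzS]
    · filter_upwards [Φ.tendsto_d] with z h
      exact (h.add tendsto_const_nhds).const_mul _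
    · have : ∀ m, ∫ z, |C| * (Φ.d m z + Q.indicator (fun _ => (1 : ℝ)) z)
          = ∫ z, |C| * (Φ.d₀ z + Q.indicator (fun _ => (1 : ℝ)) z) := fun m => by
        rw [integral_const_mul, integral_const_mul, integral_add (Φ.integrable_d m) hi1,
          integral_add Φ.integrable_d₀ hi1, Φ.integral_d]
      simp_rw [this]
      exact tendsto_const_nhds
  refine ⟨by simpa using (key univ MeasurableSet.univ).1, fun S hS => ?_⟩
  simpa only [integral_indicator hS] using (key S hS).2

/-- The energy inequality for limits of smooth solutions, tested with `f(p) η`. -/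
theorem FluxApproximation.energy_le (Φ : FluxApproximation q q' Q p G A) (hQ : IsCompact Q)
    (hqq : q.HolderConjugate q') (hq' : 2 ≤ q') {η : Euc n × ℝ → ℝ} (hη : ContDiff ℝ 1 η)
    (hη0 : ∀ z, 0 ≤ η z) (hηQ : tsupport η ⊆ Q) {F f f' : ℝ → ℝ}
    (hF : ∀ s, HasDerivAt F (f s) s) (hf : ∀ s, HasDerivAt f (f' s) s) (hf' : Continuous f')
    {L : ℝ} (hf'L : ∀ s, |f' s| ≤ L) (hfL : ∀ s, |f s| ≤ L * |s|) (hF0 : ∀ s, 0 ≤ F s)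
    (hFL : ∀ s, F s ≤ L * (1 + s ^ 2)) {X : Euc n × ℝ → ℝ}
    (hX : ∀ z, X z = F (p z) * fderiv ℝ η z (0, 1) - f' (p z) * η z * inner ℝ (G z) (A z)
      - f (p z) * fderiv ℝ η z (A z, 0)) :
    Integrable X ∧ (∀ τ, 0 ≤ ∫ z in univ ×ˢ Iic τ, X z) ∧
      ∀ᵐ τ, ∫⁻ x, ENNReal.ofReal (F (p (x, τ)) * η (x, τ)) ≤
        ENNReal.ofReal (∫ z in univ ×ˢ Iic τ, X z) := by
  have hηc : HasCompactSupport η := hQ.of_isClosed_subset (isClosed_tsupport η) hηQ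
  have hL : 0 ≤ L := (abs_nonneg _).trans (hf'L 0)
  have hfc : Continuous f := continuous_iff_continuousAt.2 fun s => (hf s).continuousAt
  have hFc : Continuous F := continuous_iff_continuousAt.2 fun s => (hF s).continuousAt
  have hDη := hη.continuous_fderiv one_ne_zero
  obtain ⟨C₁, hC₁⟩ := hη.continuous.bounded_above_of_compact_support hηc
  obtain ⟨C₂, hC₂⟩ := hDη.bounded_above_of_compact_support (hηc.fderiv ℝ)
  have hC₁0 : 0 ≤ C₁ := (norm_nonneg _).trans (hC₁ 0)
  have hC₂0 : 0 ≤ C₂ := (norm_nonneg _).trans (hC₂ 0)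
  set Y : ℕ → Euc n × ℝ → ℝ := fun m z => F (Φ.P m z) * fderiv ℝ η z (0, 1)
    - f' (Φ.P m z) * η z * inner ℝ (Φ.H m z) (Φ.B m z)
    - f (Φ.P m z) * fderiv ℝ η z (Φ.B m z, 0) with hY
  have hPc := fun m => (Φ.contDiff_P m).continuous
  have hHc := fun m => (Φ.contDiff_H m).continuous
  have hBc := fun m => (Φ.contDiff_B m).continuous
  have hYc : ∀ m, Continuous (Y m) := fun m => by
    refine ((((hFc.comp (hPc m)).mul (hDη.clm_apply continuous_const))).sub
      (((hf'.comp (hPc m)).mul hη.continuous).mul ((hHc m).inner (hBc m)))).sub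
      ((hfc.comp (hPc m)).mul (hDη.clm_apply ((hBc m).prodMk continuous_const)))
  have hbound : ∀ m z, |Y m z| ≤ (4 * L * (C₁ + C₂)) * (Φ.d m z + 1) := by
    intro m z
    have hd := Φ.d_nonneg m z
    have hP := Φ.P_le m z
    have hH := Φ.H_le m z
    have hB := Φ.B_le m z
    have e1 : |F (Φ.P m z) * fderiv ℝ η z (0, 1)| ≤ (L * (1 + Φ.d m z)) * C₂ := by
      rw [abs_mul, abs_of_nonneg (hF0 _)]
      refine mul_le_mul ((hFL _).trans (by gcongr)) ?_ (abs_nonneg _) (by positivity)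
      refine ((fderiv ℝ η z).le_opNorm _).trans ?_
      have : ‖((0 : Euc n), (1 : ℝ))‖ = 1 := by simp [Prod.norm_def]
      rw [this, mul_one]; exact hC₂ z
    -- Boundedness of `f'` is essential here; Young's inequality with the conjugate exponents splits
    -- the product of gradient and flux.
    have e2 : |f' (Φ.P m z) * η z * inner ℝ (Φ.H m z) (Φ.B m z)| ≤ L * C₁ * (2 * Φ.d m z) := by
      rw [abs_mul, abs_mul]
      refine mul_le_mul (mul_le_mul (hf'L _) (hC₁ z) (abs_nonneg _) hL) ?_ (abs_nonneg _)
        (by positivity)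
      refine (abs_real_inner_le_norm _ _).trans ((Real.young_inequality_of_nonneg
        (norm_nonneg _) (norm_nonneg _) hqq).trans ?_)
      have h1 : ‖Φ.H m z‖ ^ q / q ≤ ‖Φ.H m z‖ ^ q := div_le_self (by positivity) hqq.lt.le
      have h2 : ‖Φ.B m z‖ ^ q' / q' ≤ ‖Φ.B m z‖ ^ q' :=
        div_le_self (by positivity) hqq.symm.lt.le
      linarith
    -- Since `q' ≥ 2`, the flux is locally square integrable and can be paired with `f(p)`, which
    -- grows linearly.
    have hB2 : ‖Φ.B m z‖ ^ 2 ≤ 1 + Φ.d m z := by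
      rcases le_total ‖Φ.B m z‖ 1 with h | h
      · nlinarith [norm_nonneg (Φ.B m z)]
      · rw [← Real.rpow_two]
        linarith [Real.rpow_le_rpow_of_exponent_le h hq']
    have e3 : |f (Φ.P m z) * fderiv ℝ η z (Φ.B m z, 0)| ≤ L * C₂ * (1 + 2 * Φ.d m z) := by
      rw [abs_mul]
      have h1 : |fderiv ℝ η z (Φ.B m z, 0)| ≤ C₂ * ‖Φ.B m z‖ := by
        refine ((fderiv ℝ η z).le_opNorm _).trans ?_
        have : ‖(Φ.B m z, (0 : ℝ))‖ = ‖Φ.B m z‖ := by simp [Prod.norm_def]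
        rw [this]; gcongr; exact hC₂ z
      calc _ ≤ (L * |Φ.P m z|) * (C₂ * ‖Φ.B m z‖) :=
            mul_le_mul (hfL _) h1 (abs_nonneg _) (by positivity)
        _ = L * C₂ * (|Φ.P m z| * ‖Φ.B m z‖) := by ring
        _ ≤ _ := by
          gcongr
          nlinarith [sq_nonneg (|Φ.P m z| - ‖Φ.B m z‖), sq_abs (Φ.P m z)]
    have e4 : |Y m z| ≤ |F (Φ.P m z) * fderiv ℝ η z (0, 1)|
        + |f' (Φ.P m z) * η z * inner ℝ (Φ.H m z) (Φ.B m z)|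
        + |f (Φ.P m z) * fderiv ℝ η z (Φ.B m z, 0)| :=
      (abs_sub _ _).trans (add_le_add_left (abs_sub _ _) _)
    have l1 := mul_nonneg hL hC₁0
    have l2 := mul_nonneg hL hC₂0
    nlinarith [mul_nonneg l1 hd, mul_nonneg l2 hd]
  have hz : ∀ z ∉ Q, η z = 0 ∧ fderiv ℝ η z = 0 := fun z hzQ =>
    ⟨image_eq_zero_of_notMem_tsupport fun h => hzQ (hηQ h),
      fderiv_of_notMem_tsupport (𝕜 := ℝ) fun h => hzQ (hηQ h)⟩
  obtain ⟨hXi, hXt⟩ := Φ.tendsto_setIntegral hQ (X := Y) (X₀ := X) hYc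
    (fun m z _ => hbound m z) (fun m z hzQ => by simp [hY, hz z hzQ])
    (fun z hzQ => by simp [hX, hz z hzQ])
    (by
      filter_upwards [Φ.tendsto] with z h hzQ
      obtain ⟨h1, h2, h3⟩ := h hzQ
      rw [hX]
      refine ((((hFc.tendsto _).comp h1).mul_const _).sub
        ((((hf'.tendsto _).comp h1).mul_const _).mul (h2.inner h3))).sub
        (((hfc.tendsto _).comp h1).mul ?_)
      exact ((fderiv ℝ η z).continuous.tendsto _).comp (h3.prodMk_nhds tendsto_const_nhds))
  have hid : ∀ m τ, ∫ x, F (Φ.P m (x, τ)) * η (x, τ) = ∫ z in univ ×ˢ Iic τ, Y m z := fun m τ =>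
    energy_identity ((Φ.contDiff_P m).of_le (by norm_cast))
      ((Φ.contDiff_B m).of_le (by norm_cast)) hη hηc
      hF hf hf' (fun z hzη => Φ.fderiv_space m z (hηQ hzη))
      (fun z hzη => Φ.fderiv_time m z (hηQ hzη)) τ
  have hS : ∀ τ : ℝ, MeasurableSet ((univ : Set (Euc n)) ×ˢ Iic τ) := fun τ =>
    MeasurableSet.univ.prod measurableSet_Iic
  -- Nonnegativity of the right side passes to the limit at every `τ`. It is recorded because
  -- `ENNReal.ofReal` would hide a negative value.
  refine ⟨hXi, fun τ => ?_, ?_⟩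
  · refine ge_of_tendsto' (hXt _ (hS τ)) fun m => ?_
    rw [← hid]
    exact integral_nonneg fun x => mul_nonneg (hF0 _) (hη0 _)
  -- On the left only almost everywhere convergence on almost every slice is available, so Fatou's
  -- lemma turns the identity into an inequality.
  · filter_upwards [ae_ae_slice_of_ae Φ.tendsto] with τ hτ
    have hsl : Continuous fun x : Euc n => (x, τ) := continuous_id.prodMk continuous_const
    have hc : ∀ m, Continuous fun x => F (Φ.P m (x, τ)) * η (x, τ) := fun m =>
      (hFc.comp ((hPc m).comp hsl)).mul (hη.continuous.comp hsl)
    refine (lintegral_le_liminf_of_ae_tendsto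
      (f := fun m x => ENNReal.ofReal (F (Φ.P m (x, τ)) * η (x, τ)))
      (fun m => (hc m).measurable.ennreal_ofReal.aemeasurable) ?_).trans ?_
    · filter_upwards [hτ] with x hx
      refine (ENNReal.continuous_ofReal.tendsto _).comp ?_
      by_cases hxQ : (x, τ) ∈ Q
      · exact ((hFc.tendsto _).comp (hx hxQ).1).mul_const _
      · simp [hz _ hxQ]
    · have hm : ∀ m, ∫⁻ x, ENNReal.ofReal (F (Φ.P m (x, τ)) * η (x, τ))
          = ENNReal.ofReal (∫ z in univ ×ˢ Iic τ, Y m z) := fun m => by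
        rw [← hid, ofReal_integral_eq_lintegral_ofReal
          ((hc m).integrable_of_hasCompactSupport ((hηc.slice_left τ).mul_left))
          (Eventually.of_forall fun x => mul_nonneg (hF0 _) (hη0 _))]
      simp_rw [hm]
      exact ((ENNReal.continuous_ofReal.tendsto _).comp (hXt _ (hS τ))).liminf_eq.le

end Limits

/-! ### The Sobolev inequality on time slices. -/

section Sobolev

/-- The spatial part of the derivative of a function on space-time. -/
noncomputable def spaceDeriv {n : ℕ} (χ : Euc n × ℝ → ℝ) (z : Euc n × ℝ) : Euc n →L[ℝ] ℝ :=
  (fderiv ℝ χ z).comp (ContinuousLinearMap.inl ℝ (Euc n) ℝ)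

theorem spaceDeriv_apply {n : ℕ} (χ : Euc n × ℝ → ℝ) (z : Euc n × ℝ) (v : Euc n) :
    spaceDeriv χ z v = fderiv ℝ χ z (v, 0) := rfl

/-- The constant of the Sobolev inequality for the exponent `q`. -/
noncomputable def sobolevConst (n : ℕ) (q : ℝ) : ℝ≥0∞ :=
  (SNormLESNormFDerivOfEqConst ℝ (volume : Measure (Euc n)) q : ℝ≥0∞) ^ q

theorem sobolevConst_ne_top (n : ℕ) {q : ℝ} (hq : 0 ≤ q) : sobolevConst n q ≠ ⊤ :=
  ENNReal.rpow_ne_top_of_nonneg hq ENNReal.coe_ne_top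

variable {n : ℕ} {q : ℝ}

/-- The Gagliardo–Nirenberg–Sobolev inequality raised to the power `q`, so that its right side is
additive and can be integrated in time. -/
theorem lintegral_rpow_le_lintegral_fderiv (hq : 1 ≤ q) (hqn : q < n) {u : Euc n → ℝ}
    (hu : ContDiff ℝ 1 u) (huc : HasCompactSupport u) :
    (∫⁻ x, ‖u x‖ₑ ^ (n * q / (n - q))) ^ ((n - q) / n) ≤
      sobolevConst n q * ∫⁻ x, ‖fderiv ℝ u x‖ₑ ^ q := by
  have hq0 : 0 < q := by linarith
  have hn0 : (0 : ℝ) < n := by linarith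
  have hnq : 0 < n - q := by linarith
  have hr : 0 < n * q / (n - q) := by positivity
  lift q to NNReal using hq0.le
  set r : NNReal := ⟨n * q / (n - q), hr.le⟩ with hrdef
  have hrc : (r : ℝ) = n * q / (n - q) := rfl
  have hfin : Module.finrank ℝ (Euc n) = n := by simp
  have h := eLpNorm_le_eLpNorm_fderiv_of_eq (volume : Measure (Euc n)) hu huc (p := q) (p' := r)
    (by exact_mod_cast hq) (by rw [hfin]; exact_mod_cast hn0) (by
      rw [hfin, hrc]; push_cast; field_simp)
  rw [eLpNorm_eq_lintegral_rpow_enorm_toReal (by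
      simpa using (fun h => hr.ne' (hrc ▸ congrArg NNReal.toReal h) : r ≠ 0)) (by simp),
    eLpNorm_eq_lintegral_rpow_enorm_toReal (by exact_mod_cast hq0.ne') (by simp)] at h
  simp only [ENNReal.coe_toReal, hrc] at h
  have h2 := ENNReal.rpow_le_rpow h hq0.le
  rw [ENNReal.mul_rpow_of_nonneg _ _ hq0.le, ← ENNReal.rpow_mul, ← ENNReal.rpow_mul,
    one_div_mul_cancel hq0.ne', ENNReal.rpow_one] at h2
  have e : 1 / (n * (q : ℝ) / (n - q)) * q = (n - q) / n := by field_simp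
  rw [e] at h2
  exact h2

variable {q' : ℝ} {Q : Set (Euc n × ℝ)} {p : Euc n × ℝ → ℝ} {G A : Euc n × ℝ → Euc n}

/-- The Sobolev inequality on time slices, integrated in time, for `h(p) χ`. -/
theorem FluxApproximation.sobolev_le (Φ : FluxApproximation q q' Q p G A) (hQ : IsCompact Q)
    (hq : 1 ≤ q) (hq2 : q ≤ 2) (hqn : q < n) {χ : Euc n × ℝ → ℝ} (hχ : ContDiff ℝ 1 χ)
    (hχ0 : ∀ z, 0 ≤ χ z) (hχQ : tsupport χ ⊆ Q) {h h' : ℝ → ℝ}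
    (hh : ∀ s, HasDerivAt h (h' s) s) (hh' : Continuous h') {L : ℝ} (hh'L : ∀ s, |h' s| ≤ L)
    (hh0 : ∀ s, 0 ≤ h s) (hhL : ∀ s, h s ^ q ≤ L * (1 + s ^ 2)) {D : Euc n × ℝ → ℝ}
    (hD : ∀ z, D z = (|h' (p z)| * χ z * ‖G z‖ + h (p z) * ‖spaceDeriv χ z‖) ^ q) (τ : ℝ) :
    Integrable D ∧
    ∫⁻ t in Iic τ, (∫⁻ x, ENNReal.ofReal (h (p (x, t)) * χ (x, t)) ^ (n * q / (n - q)))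
      ^ ((n - q) / n) ≤ sobolevConst n q * ENNReal.ofReal (∫ z in univ ×ˢ Iic τ, D z) := by
  have hq0 : 0 < q := by linarith
  have hn0 : (0 : ℝ) < n := by linarith
  have hnq : 0 < n - q := by linarith
  have hχc : HasCompactSupport χ := hQ.of_isClosed_subset (isClosed_tsupport χ) hχQ
  have hL : 0 ≤ L := (abs_nonneg _).trans (hh'L 0)
  have hhc : Continuous h := continuous_iff_continuousAt.2 fun s => (hh s).continuousAt
  have hhc1 : ContDiff ℝ 1 h := contDiff_one_iff_deriv.2
    ⟨fun s => (hh s).differentiableAt, by rw [funext fun s => (hh s).deriv]; exact hh'⟩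
  have hDχ : Continuous (spaceDeriv χ) :=
    (hχ.continuous_fderiv one_ne_zero).clm_comp continuous_const
  have hz : ∀ z ∉ Q, χ z = 0 ∧ spaceDeriv χ z = 0 := fun z hzQ => by
    refine ⟨image_eq_zero_of_notMem_tsupport fun h => hzQ (hχQ h), ?_⟩
    unfold spaceDeriv
    rw [fderiv_of_notMem_tsupport (𝕜 := ℝ) fun h => hzQ (hχQ h), ContinuousLinearMap.zero_comp]
  obtain ⟨C₁, hC₁⟩ := hχ.continuous.bounded_above_of_compact_support hχc
  obtain ⟨C₂, hC₂⟩ := hDχ.bounded_above_of_compact_support 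
    (HasCompactSupport.intro hQ fun z hzQ => (hz z hzQ).2)
  have hC₁0 : 0 ≤ C₁ := (norm_nonneg _).trans (hC₁ 0)
  have hC₂0 : 0 ≤ C₂ := (norm_nonneg _).trans (hC₂ 0)
  set D' : ℕ → Euc n × ℝ → ℝ := fun m z =>
    (|h' (Φ.P m z)| * χ z * ‖Φ.H m z‖ + h (Φ.P m z) * ‖spaceDeriv χ z‖) ^ q with hD'
  have hPc := fun m => (Φ.contDiff_P m).continuous
  have hHc := fun m => (Φ.contDiff_H m).continuous
  have hbase : ∀ m z, 0 ≤ |h' (Φ.P m z)| * χ z * ‖Φ.H m z‖ + h (Φ.P m z) * ‖spaceDeriv χ z‖ :=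
    fun m z => by
      have := hχ0 z
      have := hh0 (Φ.P m z)
      positivity
  have hD'0 : ∀ m z, 0 ≤ D' m z := fun m z => Real.rpow_nonneg (hbase m z) q
  have hD'c : ∀ m, Continuous (D' m) := fun m =>
    (((((hh'.comp (hPc m)).abs).mul hχ.continuous).mul (hHc m).norm).add
      ((hhc.comp (hPc m)).mul hDχ.norm)).rpow_const fun z => Or.inr hq0.le
  have hbound : ∀ m z, |D' m z| ≤ (4 * ((L * C₁) ^ q + L * C₂ ^ q)) * (Φ.d m z + 1) := by
    intro m z
    have hd := Φ.d_nonneg m z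
    rw [abs_of_nonneg (hD'0 m z)]
    have hχ1 : χ z ≤ C₁ := (le_abs_self _).trans (hC₁ z)
    have e1 : (|h' (Φ.P m z)| * χ z * ‖Φ.H m z‖) ^ q ≤ (L * C₁) ^ q * Φ.d m z := by
      have := hχ0 z
      rw [Real.mul_rpow (by positivity) (norm_nonneg _)]
      gcongr
      · exact hh'L _
      · exact Φ.H_le m z
    have e2 : (h (Φ.P m z) * ‖spaceDeriv χ z‖) ^ q ≤ L * (1 + Φ.d m z) * C₂ ^ q := by
      rw [Real.mul_rpow (hh0 _) (norm_nonneg _)]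
      gcongr
      · exact (hhL _).trans (by gcongr; exact Φ.P_le m z)
      · exact hC₂ z
    have hχ0z := hχ0 z
    have hh0z := hh0 (Φ.P m z)
    have e3 := add_rpow_le_four_mul (x := |h' (Φ.P m z)| * χ z * ‖Φ.H m z‖)
      (y := h (Φ.P m z) * ‖spaceDeriv χ z‖) (by positivity) (by positivity) hq0.le hq2
    have l1 : 0 ≤ (L * C₁) ^ q := by positivity
    calc D' m z ≤ 4 * ((L * C₁) ^ q * Φ.d m z + L * (1 + Φ.d m z) * C₂ ^ q) :=
          e3.trans (by gcongr)
      _ ≤ _ := by nlinarith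
  obtain ⟨hDi, hDt⟩ := Φ.tendsto_setIntegral hQ (X := D') (X₀ := D) hD'c
    (fun m z _ => hbound m z) (fun m z hzQ => by simp [hD', hz z hzQ, hq0.ne'])
    (fun z hzQ => by simp [hD, hz z hzQ, hq0.ne'])
    (by
      filter_upwards [Φ.tendsto] with z h hzQ
      obtain ⟨h1, h2, -⟩ := h hzQ
      rw [hD]
      refine Tendsto.rpow_const ?_ (Or.inr hq0.le)
      exact (((((hh'.tendsto _).comp h1).abs).mul_const _).mul h2.norm).add
        (((hhc.tendsto _).comp h1).mul_const _))
  refine ⟨hDi, ?_⟩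
  have hsl : ∀ t : ℝ, Continuous fun x : Euc n => (x, t) := fun t =>
    continuous_id.prodMk continuous_const
  -- the Sobolev inequality for the approximations, on a time slice
  have hslice : ∀ m t, (∫⁻ x, ENNReal.ofReal (h (Φ.P m (x, t)) * χ (x, t)) ^ (n * q / (n - q)))
      ^ ((n - q) / n) ≤ sobolevConst n q * ∫⁻ x, ENNReal.ofReal (D' m (x, t)) := by
    intro m t
    have hPm : ContDiff ℝ 1 (Φ.P m) := (Φ.contDiff_P m).of_le (by norm_cast)
    have hw : ContDiff ℝ 1 fun z => h (Φ.P m z) * χ z := (hhc1.comp hPm).mul hχ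
    have hws : ContDiff ℝ 1 fun x => h (Φ.P m (x, t)) * χ (x, t) :=
      hw.comp (contDiff_id.prodMk contDiff_const)
    have hwc : HasCompactSupport fun x => h (Φ.P m (x, t)) * χ (x, t) :=
      (hχc.slice_left t).mul_left
    have hS := lintegral_rpow_le_lintegral_fderiv hq hqn hws hwc
    have e1 : ∀ x, ‖h (Φ.P m (x, t)) * χ (x, t)‖ₑ =
        ENNReal.ofReal (h (Φ.P m (x, t)) * χ (x, t)) := fun x =>
      Real.enorm_of_nonneg (mul_nonneg (hh0 _) (hχ0 _))
    simp_rw [e1] at hS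
    refine hS.trans (mul_le_mul_right (lintegral_mono fun x => ?_) _)
    have dP := (hPm.differentiable one_ne_zero (x, t)).hasFDerivAt
    have dχ := (hχ.differentiable one_ne_zero (x, t)).hasFDerivAt
    have dw := (((hh _).comp_hasFDerivAt (x, t) dP).mul dχ).slice_left
    simp only [Function.comp_apply, Pi.mul_apply] at dw
    have hle : ‖fderiv ℝ (fun x => h (Φ.P m (x, t)) * χ (x, t)) x‖ ≤
        |h' (Φ.P m (x, t))| * χ (x, t) * ‖Φ.H m (x, t)‖ +
          h (Φ.P m (x, t)) * ‖spaceDeriv χ (x, t)‖ := by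
      rw [dw.fderiv]
      refine ContinuousLinearMap.opNorm_le_bound _ (hbase m (x, t)) fun v => ?_
      simp only [ContinuousLinearMap.comp_apply, ContinuousLinearMap.inl_apply, _root_.add_apply,
        _root_.smul_apply, smul_eq_mul]
      by_cases hxQ : (x, t) ∈ Q
      · rw [Φ.fderiv_space m _ hxQ, Real.norm_eq_abs]
        have n1 : |inner ℝ (Φ.H m (x, t)) v| ≤ ‖Φ.H m (x, t)‖ * ‖v‖ := abs_real_inner_le_norm _ _
        have n2 : |fderiv ℝ χ (x, t) (v, 0)| ≤ ‖spaceDeriv χ (x, t)‖ * ‖v‖ :=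
          (spaceDeriv χ (x, t)).le_opNorm v
        have hχx := hχ0 (x, t)
        have hhx := hh0 (Φ.P m (x, t))
        refine (abs_add_le _ _).trans ?_
        rw [abs_mul, abs_mul, abs_mul, abs_of_nonneg hχx, abs_of_nonneg hhx]
        calc _ ≤ h (Φ.P m (x, t)) * (‖spaceDeriv χ (x, t)‖ * ‖v‖) +
              χ (x, t) * (|h' (Φ.P m (x, t))| * (‖Φ.H m (x, t)‖ * ‖v‖)) := by gcongr
          _ = _ := by ring
      · have hDx : fderiv ℝ χ (x, t) (v, 0) = 0 := by rw [← spaceDeriv_apply, (hz _ hxQ).2]; rfl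
        rw [hDx]
        simp [hz _ hxQ]
    rw [hD', ← ENNReal.ofReal_rpow_of_nonneg (hbase m (x, t)) hq0.le]
    refine ENNReal.rpow_le_rpow ?_ hq0.le
    rw [← ofReal_norm]
    exact ENNReal.ofReal_le_ofReal hle
  have hmeas : ∀ m, Measurable fun t : ℝ => ∫⁻ x : Euc n, ENNReal.ofReal (D' m (x, t)) := fun m =>
    Measurable.lintegral_prod_left' (f := fun z : Euc n × ℝ => ENNReal.ofReal (D' m z))
      (hD'c m).measurable.ennreal_ofReal
  calc _ ≤ ∫⁻ t in Iic τ, liminf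
        (fun m => sobolevConst n q * ∫⁻ x, ENNReal.ofReal (D' m (x, t))) atTop := by
        refine lintegral_mono_ae (ae_restrict_of_ae ?_)
        -- Fatou's lemma is used twice: here in space on a fixed slice, and afterwards in time. The
        -- outer power passes through the lower limit because it is monotone and continuous.
        filter_upwards [ae_ae_slice_of_ae Φ.tendsto] with t ht
        have hc : ∀ m, Continuous fun x => h (Φ.P m (x, t)) * χ (x, t) := fun m =>
          (hhc.comp ((hPc m).comp (hsl t))).mul (hχ.continuous.comp (hsl t))
        have h1 := lintegral_le_liminf_of_ae_tendsto (μ := volume)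
          (f := fun m x => ENNReal.ofReal (h (Φ.P m (x, t)) * χ (x, t)) ^ (n * q / (n - q)))
          (f₀ := fun x => ENNReal.ofReal (h (p (x, t)) * χ (x, t)) ^ (n * q / (n - q)))
          (fun m => ((hc m).measurable.ennreal_ofReal.pow_const _).aemeasurable) (by
            filter_upwards [ht] with x hx
            refine (ENNReal.continuous_rpow_const.tendsto _).comp
              ((ENNReal.continuous_ofReal.tendsto _).comp ?_)
            by_cases hxQ : (x, t) ∈ Q
            · exact ((hhc.tendsto _).comp (hx hxQ).1).mul_const _
            · simp [hz _ hxQ])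
        have hr : 0 ≤ (n - q) / n := by positivity
        refine (ENNReal.rpow_le_rpow h1 hr).trans ?_
        have h2 := (ENNReal.monotone_rpow_of_nonneg hr).map_liminf_of_continuousAt (F := atTop)
          (fun m => ∫⁻ x, ENNReal.ofReal (h (Φ.P m (x, t)) * χ (x, t)) ^ (n * q / (n - q)))
          ENNReal.continuous_rpow_const.continuousAt
        rw [h2]
        exact liminf_le_liminf (Eventually.of_forall fun m => hslice m t)
    _ ≤ liminf (fun m => ∫⁻ t in Iic τ,
        sobolevConst n q * ∫⁻ x, ENNReal.ofReal (D' m (x, t))) atTop :=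
      lintegral_liminf_le fun m => (hmeas m).const_mul _
    _ = liminf (fun m => sobolevConst n q *
        ENNReal.ofReal (∫ z in univ ×ˢ Iic τ, D' m z)) atTop := by
      congr 1 with m
      rw [lintegral_const_mul _ (hmeas m)]
      congr 1
      rw [ofReal_integral_eq_lintegral_ofReal _ (Eventually.of_forall (hD'0 m)),
        restrict_univ_prod_Iic, lintegral_prod_symm _
          (hD'c m).measurable.ennreal_ofReal.aemeasurable]
      refine ((hD'c m).integrable_of_hasCompactSupport
        (HasCompactSupport.intro hQ fun z hzQ => ?_)).restrict
      simp [hD', hz z hzQ, hq0.ne']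
    _ = _ := by
      refine (ENNReal.Tendsto.const_mul ((ENNReal.continuous_ofReal.tendsto _).comp
        (hDt _ (MeasurableSet.univ.prod measurableSet_Iic)))
        (Or.inr (sobolevConst_ne_top n hq0.le))).liminf_eq

end Sobolev

/-! ### Pointwise algebra behind Caccioppoli's inequality. -/

section Pointwise

/-- Absorption of the flux term into the dissipation, for the cutoff `z ^ k`. -/
theorem test_absorption {F f f' K₀ κ γ z R Λ β t s : ℝ} {k : ℕ} (hk : 2 ≤ k) (hF : 0 ≤ F)
    (hf' : 0 < f') (hβ : 0 ≤ β) (hf : f ^ 2 ≤ 2 * (1 + β) * F * f') (hκ : 0 ≤ κ) (hκK : κ ≤ K₀)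
    (hz : 0 ≤ z) (hz1 : z ≤ 1) (ht : |t| ≤ Λ) (hs : |s| ≤ R * (κ * γ)) :
    F * (k * z ^ (k - 1) * t) - f' * z ^ k * (κ * γ ^ 2) - f * (k * z ^ (k - 1) * s) ≤
      (k * Λ + K₀ * (1 + β) * k ^ 2 * R ^ 2) * (F * z ^ (k - 2)) -
        1 / 2 * f' * z ^ k * (κ * γ ^ 2) := by
  obtain ⟨j, rfl⟩ : ∃ j, k = j + 2 := ⟨k - 2, by omega⟩
  have e1 : j + 2 - 1 = j + 1 := by omega
  have e2 : j + 2 - 2 = j := by omega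
  rw [e1, e2]
  set c : ℝ := ((j + 2 : ℕ) : ℝ) with hc
  have hc0 : 0 ≤ c := Nat.cast_nonneg _
  have hzj : 0 ≤ z ^ j := pow_nonneg hz j
  have hΛ : 0 ≤ Λ := (abs_nonneg t).trans ht
  have h1 : F * (c * z ^ (j + 1) * t) ≤ c * Λ * (F * z ^ j) := by
    have : z * t ≤ Λ := by
      calc z * t ≤ z * |t| := mul_le_mul_of_nonneg_left (le_abs_self t) hz
        _ ≤ 1 * Λ := mul_le_mul hz1 ht (abs_nonneg _) zero_le_one
        _ = Λ := one_mul _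
    calc F * (c * z ^ (j + 1) * t) = (F * c * z ^ j) * (z * t) := by ring
      _ ≤ (F * c * z ^ j) * Λ := mul_le_mul_of_nonneg_left this (by positivity)
      _ = _ := by ring
  -- Young's inequality from the square of `f' z γ - |f| c R`, using the bound on `f²` and then
  -- dividing by `f' > 0`. Multiplied by half of `z^j κ`, it costs exactly half of the dissipation.
  have h2 : 2 * (z * γ * |f| * c * R) ≤ f' * z ^ 2 * γ ^ 2 + 2 * (1 + β) * F * (c ^ 2 * R ^ 2) := by
    have a1 : 0 ≤ (f' * (z * γ) - |f| * (c * R)) ^ 2 := sq_nonneg _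
    have a2 : |f| ^ 2 * (c * R) ^ 2 ≤ 2 * (1 + β) * F * f' * (c * R) ^ 2 := by
      rw [sq_abs]; gcongr
    have a3 : f' * (2 * (z * γ * |f| * c * R)) ≤
        f' * (f' * z ^ 2 * γ ^ 2 + 2 * (1 + β) * F * (c ^ 2 * R ^ 2)) := by nlinarith
    exact le_of_mul_le_mul_left a3 hf'
  have h3 : - (f * (c * z ^ (j + 1) * s)) ≤ |f| * (c * z ^ (j + 1)) * (R * (κ * γ)) := by
    calc - (f * (c * z ^ (j + 1) * s)) ≤ |f * (c * z ^ (j + 1) * s)| := neg_le_abs _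
      _ = |f| * (c * z ^ (j + 1)) * |s| := by
        rw [abs_mul, abs_mul, abs_of_nonneg (by positivity : 0 ≤ c * z ^ (j + 1))]; ring
      _ ≤ _ := by gcongr
  have h4 : |f| * (c * z ^ (j + 1)) * (R * (κ * γ)) ≤
      1 / 2 * (z ^ j * κ) * (f' * z ^ 2 * γ ^ 2 + 2 * (1 + β) * F * (c ^ 2 * R ^ 2)) := by
    calc _ = 1 / 2 * (z ^ j * κ) * (2 * (z * γ * |f| * c * R)) := by ring
      _ ≤ _ := mul_le_mul_of_nonneg_left h2 (by positivity)
  have h5 : κ * ((1 + β) * F * (c ^ 2 * R ^ 2) * z ^ j) ≤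
      K₀ * ((1 + β) * F * (c ^ 2 * R ^ 2) * z ^ j) := by gcongr
  have e3 : f' * z ^ (j + 2) * (κ * γ ^ 2) = (z ^ j * κ) * (f' * z ^ 2 * γ ^ 2) := by ring
  have e4 : 1 / 2 * f' * z ^ (j + 2) * (κ * γ ^ 2) =
      1 / 2 * ((z ^ j * κ) * (f' * z ^ 2 * γ ^ 2)) := by ring
  rw [e3, e4]
  nlinarith

/-- The gradient of `h(p) z ^ k` in terms of the energy density and the dissipation. -/
theorem root_gradient_le {q h h' F f' c B Cg κ γ z R r : ℝ} {k : ℕ} (hk : 2 ≤ k) (hq : 1 ≤ q)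
    (hq2 : q ≤ 2) (hh : 0 ≤ h) (hhF : h ^ q ≤ F) (hc : 0 ≤ c) (hcF : c ≤ F) (hcf : 2 * c ≤ f')
    (hB : 0 ≤ B) (hh' : |h'| ^ q ≤ B * c) (hκ : 0 ≤ κ) (hγ : 0 ≤ γ) (hCg : 0 ≤ Cg)
    (hcoer : γ ^ q ≤ Cg * (1 + κ * γ ^ 2)) (hz : 0 ≤ z) (hz1 : z ≤ 1) (hr : 0 ≤ r) (hrR : r ≤ R) :
    (|h'| * z ^ k * γ + h * (k * z ^ (k - 1) * r)) ^ q ≤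
      (4 * (B * Cg + k ^ 2 * (1 + R ^ 2))) * (F * z ^ (k - 2)) +
        4 * (B * Cg) * (1 / 2 * f' * z ^ k * (κ * γ ^ 2)) := by
  have hq0 : 0 ≤ q := by linarith
  have hR : 0 ≤ R := hr.trans hrR
  have hk1 : (1 : ℝ) ≤ k := by exact_mod_cast (by omega : 1 ≤ k)
  -- Since `q ≥ 1`, the power `q` of a cutoff factor may be dropped, which leaves the integer powers
  -- occurring in the energy estimate.
  have pow_le : ∀ {y : ℝ}, 0 ≤ y → y ≤ 1 → y ^ q ≤ y := fun h0 h1 => by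
    simpa using Real.rpow_le_rpow_of_exponent_ge_of_imp h0 h1 hq
      (fun _ h => by linarith)
  have hzk : z ^ k ≤ z ^ (k - 2) := pow_le_pow_of_le_one hz hz1 (by omega)
  have hzk1 : z ^ (k - 1) ≤ z ^ (k - 2) := pow_le_pow_of_le_one hz hz1 (by omega)
  have hF : 0 ≤ F := hc.trans hcF
  have hzk0 : 0 ≤ z ^ k := by positivity
  have e1 : (|h'| * z ^ k * γ) ^ q ≤ B * Cg * (F * z ^ (k - 2)) +
      B * Cg * (1 / 2 * f' * z ^ k * (κ * γ ^ 2)) := by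
    rw [Real.mul_rpow (by positivity) hγ, Real.mul_rpow (abs_nonneg _) hzk0]
    calc _ ≤ B * c * z ^ k * (Cg * (1 + κ * γ ^ 2)) := by
          gcongr
          exact pow_le hzk0 (pow_le_one₀ hz hz1)
      _ = B * Cg * (c * z ^ k) + B * Cg * (c * z ^ k * (κ * γ ^ 2)) := by ring
      _ ≤ B * Cg * (F * z ^ (k - 2)) + B * Cg * (1 / 2 * f' * z ^ k * (κ * γ ^ 2)) := by
          gcongr
          linarith
  have e2 : (h * (k * z ^ (k - 1) * r)) ^ q ≤ (k ^ 2 * (1 + R ^ 2)) * (F * z ^ (k - 2)) := by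
    rw [Real.mul_rpow hh (by positivity), Real.mul_rpow (by positivity) hr,
      Real.mul_rpow (by positivity) (by positivity)]
    have f1 : (k : ℝ) ^ q ≤ k ^ 2 := by
      rw [← Real.rpow_two]; exact Real.rpow_le_rpow_of_exponent_le hk1 hq2
    have f2 : (z ^ (k - 1)) ^ q ≤ z ^ (k - 2) :=
      (pow_le (by positivity) (pow_le_one₀ hz hz1)).trans hzk1
    have f3 : r ^ q ≤ 1 + R ^ 2 := by
      rcases le_total r 1 with h | h
      · have := Real.rpow_le_one hr h hq0
        nlinarith [sq_nonneg R]
      · calc r ^ q ≤ r ^ (2 : ℝ) := Real.rpow_le_rpow_of_exponent_le h hq2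
          _ = r ^ 2 := Real.rpow_two r
          _ ≤ 1 + R ^ 2 := by nlinarith
    calc _ ≤ F * (k ^ 2 * z ^ (k - 2) * (1 + R ^ 2)) := by gcongr
      _ = _ := by ring
  have e3 := add_rpow_le_four_mul (x := |h'| * z ^ k * γ) (y := h * (k * z ^ (k - 1) * r))
    (by positivity) (by positivity) hq0 hq2
  nlinarith

end Pointwise

/-- The negative part of `f` is moved to the other side, the inequality is integrated, and the
finite integral of that part is cancelled. Neither `V` nor `R` has to be measurable or of finite
integral. -/
theorem ofReal_integral_add_lintegral_le {X : Type*} [MeasurableSpace X] {μ : Measure X}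
    {f V R : X → ℝ} (hf : Integrable f μ) (hf0 : 0 ≤ ∫ x, f x ∂μ) (hV : ∀ x, 0 ≤ V x)
    (hle : ∀ᵐ x ∂μ, f x ≤ R x - V x) :
    ENNReal.ofReal (∫ x, f x ∂μ) + ∫⁻ x, ENNReal.ofReal (V x) ∂μ ≤
      ∫⁻ x, ENNReal.ofReal (R x) ∂μ := by
  have hpos := hf.lintegral_lt_top
  have hneg := hf.neg.lintegral_lt_top
  simp only [Pi.neg_apply] at hneg
  set a := ∫⁻ x, ENNReal.ofReal (f x) ∂μ
  set b := ∫⁻ x, ENNReal.ofReal (-f x) ∂μ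
  have h1 : a + ∫⁻ x, ENNReal.ofReal (V x) ∂μ ≤ b + ∫⁻ x, ENNReal.ofReal (R x) ∂μ := by
    rw [← lintegral_add_left' hf.1.aemeasurable.ennreal_ofReal,
      ← lintegral_add_left' (f := fun x => ENNReal.ofReal (-f x))
        hf.1.aemeasurable.neg.ennreal_ofReal]
    refine lintegral_mono_ae ?_
    filter_upwards [hle] with x hx
    have hVx := hV x
    rcases le_total 0 (f x) with h | h
    · rw [ENNReal.ofReal_of_nonpos (by linarith : -f x ≤ 0), zero_add,
        ← ENNReal.ofReal_add h hVx]
      exact ENNReal.ofReal_le_ofReal (by linarith)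
    · rw [ENNReal.ofReal_of_nonpos h, zero_add]
      rcases le_total 0 (R x) with hR | hR
      · rw [← ENNReal.ofReal_add (by linarith) hR]
        exact ENNReal.ofReal_le_ofReal (by linarith)
      · refine le_trans (ENNReal.ofReal_le_ofReal (by linarith)) le_self_add
  have h2 : ENNReal.ofReal (∫ x, f x ∂μ) + b = a := by
    have e := integral_eq_lintegral_pos_part_sub_lintegral_neg_part hf
    rw [e] at hf0 ⊢
    rw [ENNReal.ofReal_sub _ ENNReal.toReal_nonneg, ENNReal.ofReal_toReal hpos.ne,
      ENNReal.ofReal_toReal hneg.ne]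
    refine tsub_add_cancel_of_le ?_
    rwa [sub_nonneg, ENNReal.toReal_le_toReal hneg.ne hpos.ne] at hf0
  rw [← h2, add_comm _ b, add_assoc] at h1
  exact (ENNReal.add_le_add_iff_left hneg.ne).1 h1

/-! ### Caccioppoli's inequality. -/

/-- A space-time cutoff function in `U × (T₀, ∞)`, with bounds for its derivatives up to the
time `T₁`. -/
structure IsCutoff {n : ℕ} (U : Set (Euc n)) (T₀ T₁ R Λ : ℝ) (ζ : Euc n × ℝ → ℝ) : Prop where
  contDiff : ContDiff ℝ 1 ζ
  hasCompactSupport : HasCompactSupport ζ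
  tsupport_subset : tsupport ζ ⊆ U ×ˢ Ioi T₀
  nonneg : ∀ z, 0 ≤ ζ z
  le_one : ∀ z, ζ z ≤ 1
  space_le : ∀ z, z.2 ≤ T₁ → ‖spaceDeriv ζ z‖ ≤ R
  time_le : ∀ z, z.2 ≤ T₁ → |fderiv ℝ ζ z (0, 1)| ≤ Λ

section Caccioppoli

variable {n : ℕ} {U : Set (Euc n)} {T₀ T₁ R Λ : ℝ} {ζ : Euc n × ℝ → ℝ}

theorem IsCutoff.mem_of_mem_tsupport (hζ : IsCutoff U T₀ T₁ R Λ ζ) {z : Euc n × ℝ}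
    (hz : z ∈ tsupport ζ) (hzT : z.2 ≤ T₁) : z ∈ U ×ˢ Ioc T₀ T₁ :=
  ⟨(hζ.tsupport_subset hz).1, (hζ.tsupport_subset hz).2, hzT⟩

theorem IsCutoff.fderiv_pow (hζ : IsCutoff U T₀ T₁ R Λ ζ) (k : ℕ) (z : Euc n × ℝ) :
    fderiv ℝ (fun z => ζ z ^ k) z = (k * ζ z ^ (k - 1)) • fderiv ℝ ζ z := by
  have h := ((hζ.contDiff.differentiable one_ne_zero z).hasFDerivAt.pow k).fderiv
  rw [h]; simp

theorem IsCutoff.norm_spaceDeriv_pow (hζ : IsCutoff U T₀ T₁ R Λ ζ) (k : ℕ) (z : Euc n × ℝ) :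
    ‖spaceDeriv (fun z => ζ z ^ k) z‖ = k * ζ z ^ (k - 1) * ‖spaceDeriv ζ z‖ := by
  have := hζ.nonneg z
  have h : spaceDeriv (fun z => ζ z ^ k) z = (k * ζ z ^ (k - 1)) • spaceDeriv ζ z := by
    unfold spaceDeriv; rw [hζ.fderiv_pow, ContinuousLinearMap.smul_comp]
  rw [h, norm_smul, Real.norm_of_nonneg (by positivity)]

theorem tsupport_pow_subset {X : Type*} [TopologicalSpace X] (f : X → ℝ) {k : ℕ} (hk : k ≠ 0) :
    tsupport (fun z => f z ^ k) ⊆ tsupport f :=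
  closure_mono fun z hz => by
    rw [Function.mem_support] at hz ⊢
    exact fun h => hz (by rw [h, zero_pow hk])

theorem ForchheimerPolynomial.holderConjugate (g : ForchheimerPolynomial) :
    (2 - g.a).HolderConjugate ((2 - g.a) / (1 - g.a)) := by
  have ha := g.a_lt_one
  have h1 : 1 - g.a ≠ 0 := by linarith
  have h2 : 2 - g.a ≠ 0 := by linarith
  rw [Real.holderConjugate_iff]
  refine ⟨by linarith, ?_⟩
  field_simp; ring

variable {g : ForchheimerPolynomial} {p : ℝ → Euc n → ℝ}

theorem IsLocalWeakSolution.aemeasurable_comp_mul (hp : IsLocalWeakSolution g U p)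
    {S : Set (Euc n × ℝ)} (hS : S ⊆ U ×ˢ Ioi (0 : ℝ)) {f : ℝ → ℝ} (hf : Continuous f)
    {w : Euc n × ℝ → ℝ} (hw : Continuous w) :
    AEMeasurable (fun z : Euc n × ℝ => f (p z.2 z.1) * w z) (volume.restrict S) := by
  have h := hp.aestronglyMeasurable.aemeasurable.mono_measure (Measure.restrict_mono hS le_rfl)
  exact (hf.measurable.comp_aemeasurable h).mul hw.aemeasurable

/-- Caccioppoli's inequality for truncated powers of a solution, with the slice Sobolev inequality
applied to the dissipation. -/
theorem IsLocalWeakSolution.caccioppoli (hp : IsLocalWeakSolution g U p) (hU : IsOpen U)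
    (hn : 2 ≤ n) {Cg : ℝ} (hCg : 0 ≤ Cg)
    (hcoer : ∀ ξ : ℝ, 0 ≤ ξ → ξ ^ (2 - g.a) ≤ Cg * (1 + g.K ξ * ξ ^ 2)) (hT₀ : 0 ≤ T₀)
    (hζ : IsCutoff U T₀ T₁ R Λ ζ) {k : ℕ} (hk : 2 ≤ k) {M β : ℝ} (hM : 0 < M) (hβ : 0 ≤ β)
    {C₁ C₂ : ℝ} (hC₁ : C₁ = k * Λ + 1 / g.coeff 0 * (1 + β) * k ^ 2 * R ^ 2) (hC₁0 : 0 ≤ C₁)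
    (hC₂ : C₂ = 4 * ((1 + 2 * β) ^ 2 * Cg + k ^ 2 * (1 + R ^ 2)) +
      4 * ((1 + 2 * β) ^ 2 * Cg) * C₁) {Y : ℝ≥0∞}
    (hY : Y = ∫⁻ z in U ×ˢ Ioc T₀ T₁,
      ENNReal.ofReal (truncEnergy M β (p z.2 z.1) * ζ z ^ (k - 2))) :
    (∀ᵐ τ, τ ≤ T₁ → ∫⁻ x, ENNReal.ofReal (truncEnergy M β (p τ x) * ζ (x, τ) ^ k) ≤
      ENNReal.ofReal C₁ * Y) ∧
    ∫⁻ t in Iic T₁, (∫⁻ x, ENNReal.ofReal (truncRoot M β (2 - g.a) (p t x) * ζ (x, t) ^ k) ^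
        (n * (2 - g.a) / (n - (2 - g.a)))) ^ ((n - (2 - g.a)) / n) ≤
      sobolevConst n (2 - g.a) * (ENNReal.ofReal C₂ * Y) := by
  have ha := g.a_lt_one
  have ha0 := g.a_pos
  have hn' : (2 : ℝ) ≤ n := by exact_mod_cast hn
  have hk0 : k ≠ 0 := by omega
  obtain ⟨G, hGL, hGw, heq⟩ := hp.equation
  have hQ : IsCompact (tsupport ζ) := hζ.hasCompactSupport
  have hQU : tsupport ζ ⊆ U ×ˢ Ioi (0 : ℝ) :=
    hζ.tsupport_subset.trans (prod_mono_right (Ioi_subset_Ioi hT₀))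
  obtain ⟨Φ⟩ := hp.nonempty_fluxApproximation hU hGL hGw heq hQ hQU
  set q := 2 - g.a with hq
  set S := U ×ˢ Ioc T₀ T₁ with hS
  have hSm : MeasurableSet S := hU.measurableSet.prod measurableSet_Ioc
  have hη : ContDiff ℝ 1 fun z => ζ z ^ k := hζ.contDiff.pow k
  have hη0 : ∀ z, 0 ≤ ζ z ^ k := fun z => pow_nonneg (hζ.nonneg z) k
  have hηQ : tsupport (fun z => ζ z ^ k) ⊆ tsupport ζ := tsupport_pow_subset ζ hk0
  have hMβ : 0 < M ^ β := by positivity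
  have hsat : ∀ s : ℝ, 0 < satPow M β (1 + s ^ 2) := fun s => satPow_pos hM (by positivity)
  have hsatM : ∀ s : ℝ, satPow M β (1 + s ^ 2) ≤ M ^ β := fun s =>
    satPow_le hM hβ (by positivity)
  have hf'pos : ∀ s, 0 < truncTestDeriv M β s := fun s =>
    (by linarith [hsat s] : 0 < 2 * satPow M β (1 + s ^ 2)).trans_le
      (satPow_le_truncTestDeriv hM hβ s)
  have hFle : ∀ s, truncEnergy M β s ≤ M ^ β * (1 + s ^ 2) := fun s => by
    unfold truncEnergy
    rw [mul_comm]
    exact mul_le_mul_of_nonneg_right (hsatM s) (by positivity)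
  set V : Euc n × ℝ → ℝ := fun z => 1 / 2 * truncTestDeriv M β (p z.2 z.1) * ζ z ^ k *
    (g.K ‖G z.2 z.1‖ * ‖G z.2 z.1‖ ^ 2) with hV
  have hV0 : ∀ z, 0 ≤ V z := fun z => by
    have := g.K_nonneg (norm_nonneg (G z.2 z.1))
    have := (hf'pos (p z.2 z.1)).le
    have := hη0 z
    positivity
  set W : Euc n × ℝ → ℝ := fun z => truncEnergy M β (p z.2 z.1) * ζ z ^ (k - 2) with hW
  have hW0 : ∀ z, 0 ≤ W z := fun z =>
    mul_nonneg (truncEnergy_pos hM _).le (pow_nonneg (hζ.nonneg z) _)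
  -- The indicator confines the integral to the cylinder, so one bound serves all the half-spaces
  -- `{t ≤ τ}`.
  have hWint : ∀ c : ℝ, 0 ≤ c → ∀ T : Set (Euc n × ℝ),
      ∫⁻ z in T, ENNReal.ofReal (S.indicator (fun z => c * W z) z) ≤ ENNReal.ofReal c * Y := by
    intro c hc T
    refine (setLIntegral_le_lintegral _ _).trans ?_
    rw [hY, ← lintegral_const_mul' _ _ ENNReal.ofReal_ne_top, ← lintegral_indicator hSm]
    refine lintegral_mono fun z => ?_
    by_cases hz : z ∈ S
    · simp only [indicator_of_mem hz]
      rw [ENNReal.ofReal_mul hc]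
    · simp [indicator_of_notMem hz]
  -- the energy inequality
  have hL1 : 1 ≤ 1 + 2 * β := by linarith
  obtain ⟨hXi, hX0, hXs⟩ := Φ.energy_le hQ g.holderConjugate
    (by rw [le_div_iff₀ (by linarith)]; linarith) hη hη0 hηQ
    (F := truncEnergy M β) (f := truncTest M β) (f' := truncTestDeriv M β)
    (hasDerivAt_truncEnergy hM) (hasDerivAt_truncTest hM) (continuous_truncTestDeriv hM)
    (L := 2 * (1 + β) * (1 + 2 * β) * M ^ β)
    (fun s => by
      rw [abs_of_pos (hf'pos s)]
      exact (truncTestDeriv_le hM hβ s).trans (by gcongr; exact hsatM s))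
    (fun s => (abs_truncTest_le hM hβ s).trans 
      (mul_le_mul_of_nonneg_right (mul_le_mul_of_nonneg_right
        (le_mul_of_one_le_right (by positivity) hL1) hMβ.le) (abs_nonneg s)))
    (fun s => (truncEnergy_pos hM s).le)
    (fun s => (hFle s).trans (by
      gcongr
      refine le_mul_of_one_le_left hMβ.le ?_
      nlinarith))
    (X := fun z => truncEnergy M β (p z.2 z.1) * fderiv ℝ (fun z => ζ z ^ k) z (0, 1)
      - truncTestDeriv M β (p z.2 z.1) * ζ z ^ k *
        inner ℝ (G z.2 z.1) (g.K ‖G z.2 z.1‖ • G z.2 z.1)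
      - truncTest M β (p z.2 z.1) *
        fderiv ℝ (fun z => ζ z ^ k) z (g.K ‖G z.2 z.1‖ • G z.2 z.1, 0)) (fun z => rfl)
  set X : Euc n × ℝ → ℝ := fun z =>
    truncEnergy M β (p z.2 z.1) * fderiv ℝ (fun z => ζ z ^ k) z (0, 1)
      - truncTestDeriv M β (p z.2 z.1) * ζ z ^ k *
        inner ℝ (G z.2 z.1) (g.K ‖G z.2 z.1‖ • G z.2 z.1)
      - truncTest M β (p z.2 z.1) *
        fderiv ℝ (fun z => ζ z ^ k) z (g.K ‖G z.2 z.1‖ • G z.2 z.1, 0) with hX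
  have hXle : ∀ z, z.2 ≤ T₁ → X z ≤ S.indicator (fun z => C₁ * W z) z - V z := by
    intro z hzT
    by_cases hz : z ∈ tsupport ζ
    · rw [indicator_of_mem (hζ.mem_of_mem_tsupport hz hzT)]
      have hK0 := g.K_nonneg (norm_nonneg (G z.2 z.1))
      have h := test_absorption hk (truncEnergy_pos (β := β) hM (p z.2 z.1)).le
        (hf'pos (p z.2 z.1)) hβ (truncTest_sq_le hM hβ (p z.2 z.1)) hK0
        (g.K_le (norm_nonneg (G z.2 z.1))) (γ := ‖G z.2 z.1‖) (hζ.nonneg z) (hζ.le_one z)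
        (hζ.time_le z hzT) (s := fderiv ℝ ζ z (g.K ‖G z.2 z.1‖ • G z.2 z.1, 0)) (R := R) (by
          rw [← spaceDeriv_apply]
          refine ((spaceDeriv ζ z).le_opNorm _).trans ?_
          rw [norm_smul, Real.norm_of_nonneg hK0]
          gcongr
          exact hζ.space_le z hzT)
      rw [← hC₁] at h
      simp only [hX, hV, hW, hζ.fderiv_pow, _root_.smul_apply, smul_eq_mul, inner_smul_right,
        real_inner_self_eq_norm_sq]
      exact h
    · have h1 : ζ z = 0 := image_eq_zero_of_notMem_tsupport hz
      have h2 : fderiv ℝ ζ z = 0 := fderiv_of_notMem_tsupport (𝕜 := ℝ) hz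
      have h3 : 0 ≤ S.indicator (fun z => C₁ * W z) z :=
        indicator_nonneg (fun z _ => mul_nonneg hC₁0 (hW0 z)) z
      simp only [hX, hV, hζ.fderiv_pow, h2, h1, smul_zero, zero_pow hk0]
      simpa using h3
  have hIic : ∀ τ : ℝ, MeasurableSet ((univ : Set (Euc n)) ×ˢ Iic τ) := fun τ =>
    MeasurableSet.univ.prod measurableSet_Iic
  -- Both halves of the estimate come from this line: dropping the dissipation gives the bound on
  -- slices, dropping the first term at `τ = T₁` bounds the dissipation.
  have hEn : ∀ τ ≤ T₁, ENNReal.ofReal (∫ z in univ ×ˢ Iic τ, X z) +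
      ∫⁻ z in univ ×ˢ Iic τ, ENNReal.ofReal (V z) ≤ ENNReal.ofReal C₁ * Y := fun τ hτ =>
    (ofReal_integral_add_lintegral_le hXi.restrict (hX0 τ) hV0
      ((ae_restrict_mem (hIic τ)).mono fun z hz => hXle z (le_trans hz.2 hτ))).trans
      (hWint C₁ hC₁0 _)
  refine ⟨?_, ?_⟩
  · filter_upwards [hXs] with τ hτ hτT
    exact hτ.trans (le_self_add.trans (hEn τ hτT))
  -- the Sobolev inequality
  obtain ⟨hDi, hDle⟩ := Φ.sobolev_le hQ (by linarith) (by linarith) (by linarith) hη hη0 hηQ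
    (h := truncRoot M β q) (h' := truncRootDeriv M β q) (hasDerivAt_truncRoot hM)
    (continuous_truncRootDeriv hM) (L := 1 + (1 + 2 * β) ^ 2 * M ^ β)
    -- The constant `L` must bound `|h'|`, while the estimate at hand is for `|h'|^q`; the added `1`
    -- covers the values `|h'| ≤ 1`.
    (fun s => by
      have h1 := abs_truncRootDeriv_rpow_le (q := q) hM hβ (by linarith) (by linarith) s
      have h2 : (1 + 2 * β) ^ 2 * satPow M β (1 + s ^ 2) ≤ (1 + 2 * β) ^ 2 * M ^ β := by
        gcongr; exact hsatM s
      rcases le_total |truncRootDeriv M β q s| 1 with h | h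
      · have : 0 ≤ (1 + 2 * β) ^ 2 * M ^ β := by positivity
        linarith
      · have h3 := Real.rpow_le_rpow_of_exponent_le h (by linarith : (1 : ℝ) ≤ q)
        rw [Real.rpow_one] at h3
        linarith)
    (truncRoot_nonneg hM)
    (fun s => (truncRoot_rpow_le hM (by linarith) (by linarith) s).trans ((hFle s).trans (by
      gcongr
      linarith [le_mul_of_one_le_left hMβ.le (one_le_pow₀ (n := 2) hL1)])))
    (D := fun z => (|truncRootDeriv M β q (p z.2 z.1)| * ζ z ^ k * ‖G z.2 z.1‖ +
      truncRoot M β q (p z.2 z.1) * ‖spaceDeriv (fun z => ζ z ^ k) z‖) ^ q) (fun z => rfl) T₁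
  refine hDle.trans (mul_le_mul_right ?_ _)
  set D : Euc n × ℝ → ℝ := fun z => (|truncRootDeriv M β q (p z.2 z.1)| * ζ z ^ k * ‖G z.2 z.1‖ +
      truncRoot M β q (p z.2 z.1) * ‖spaceDeriv (fun z => ζ z ^ k) z‖) ^ q with hD
  have hD0 : ∀ z, 0 ≤ D z := fun z => by
    have := hη0 z
    have := truncRoot_nonneg (β := β) (q := q) hM (p z.2 z.1)
    positivity
  set c₀ : ℝ := 4 * ((1 + 2 * β) ^ 2 * Cg + k ^ 2 * (1 + R ^ 2)) with hc₀
  set c₁ : ℝ := 4 * ((1 + 2 * β) ^ 2 * Cg) with hc₁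
  have hc₀0 : 0 ≤ c₀ := by positivity
  have hc₁0 : 0 ≤ c₁ := by positivity
  have hDle' : ∀ z, z.2 ≤ T₁ → D z ≤ S.indicator (fun z => c₀ * W z) z + c₁ * V z := by
    intro z hzT
    by_cases hz : z ∈ tsupport ζ
    · rw [indicator_of_mem (hζ.mem_of_mem_tsupport hz hzT)]
      have h := root_gradient_le (q := q) (R := R) hk (by linarith) (by linarith)
        (truncRoot_nonneg (β := β) (q := q) hM (p z.2 z.1))
        (truncRoot_rpow_le hM (by linarith) (by linarith) (p z.2 z.1))
        (hsat (p z.2 z.1)).le (le_mul_of_one_le_left (hsat _).le (by nlinarith))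
        (satPow_le_truncTestDeriv hM hβ (p z.2 z.1)) (B := (1 + 2 * β) ^ 2) (by positivity)
        (abs_truncRootDeriv_rpow_le (q := q) hM hβ (by linarith) (by linarith) _)
        (g.K_nonneg (norm_nonneg (G z.2 z.1))) (norm_nonneg (G z.2 z.1)) hCg
        (hcoer _ (norm_nonneg _)) (hζ.nonneg z) (hζ.le_one z) (norm_nonneg (spaceDeriv ζ z))
        (hζ.space_le z hzT)
      simp only [hD, hζ.norm_spaceDeriv_pow]
      exact h
    · have h1 : ζ z = 0 := image_eq_zero_of_notMem_tsupport hz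
      have h3 : 0 ≤ S.indicator (fun z => c₀ * W z) z :=
        indicator_nonneg (fun z _ => mul_nonneg hc₀0 (hW0 z)) z
      have h4 : D z = 0 := by
        simp only [hD, hζ.norm_spaceDeriv_pow, h1, zero_pow hk0,
          zero_pow (by omega : k - 1 ≠ 0)]
        simp [Real.zero_rpow (by linarith : q ≠ 0)]
      rw [h4]
      exact add_nonneg h3 (mul_nonneg hc₁0 (hV0 z))
  rw [ofReal_integral_eq_lintegral_ofReal hDi.restrict (Eventually.of_forall hD0)]
  have hWm : AEMeasurable fun z => ENNReal.ofReal (S.indicator (fun z => c₀ * W z) z) := by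
    have h1 : AEMeasurable W (volume.restrict S) :=
      hp.aemeasurable_comp_mul (prod_mono_right fun t ht => hT₀.trans_lt ht.1)
        (continuous_iff_continuousAt.2 fun s => (hasDerivAt_truncEnergy hM s).continuousAt)
        (hζ.contDiff.continuous.pow _)
    exact ((aemeasurable_indicator_iff hSm).2 (h1.const_mul c₀)).ennreal_ofReal
  calc _ ≤ ∫⁻ z in univ ×ˢ Iic T₁, (ENNReal.ofReal (S.indicator (fun z => c₀ * W z) z) +
        ENNReal.ofReal c₁ * ENNReal.ofReal (V z)) := by
        refine setLIntegral_mono' (hIic T₁) fun z hz => ?_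
        rw [← ENNReal.ofReal_mul hc₁0, ← ENNReal.ofReal_add
          (indicator_nonneg (fun z _ => mul_nonneg hc₀0 (hW0 z)) z) (mul_nonneg hc₁0 (hV0 z))]
        exact ENNReal.ofReal_le_ofReal (hDle' z hz.2)
    _ = (∫⁻ z in univ ×ˢ Iic T₁, ENNReal.ofReal (S.indicator (fun z => c₀ * W z) z)) +
        ENNReal.ofReal c₁ * ∫⁻ z in univ ×ˢ Iic T₁, ENNReal.ofReal (V z) := by
        rw [lintegral_add_left' hWm.restrict, lintegral_const_mul' _ _ ENNReal.ofReal_ne_top]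
    _ ≤ ENNReal.ofReal c₀ * Y + ENNReal.ofReal c₁ * (ENNReal.ofReal C₁ * Y) := by
        gcongr
        · exact hWint c₀ hc₀0 _
        · exact le_add_self.trans (hEn T₁ le_rfl)
    _ = ENNReal.ofReal C₂ * Y := by
        rw [← mul_assoc, ← add_mul, ← ENNReal.ofReal_mul hc₁0,
          ← ENNReal.ofReal_add hc₀0 (by positivity), hC₂]

end Caccioppoli

/-! ### One step of the iteration: gain of integrability. -/

section MoserStep

variable {n : ℕ} {U : Set (Euc n)} {T₀ T₁ R Λ : ℝ} {ζ : Euc n × ℝ → ℝ}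
  {g : ForchheimerPolynomial} {p : ℝ → Euc n → ℝ}

theorem volume_restrict_prod (U : Set (Euc n)) (I : Set ℝ) :
    (volume : Measure (Euc n × ℝ)).restrict (U ×ˢ I) =
      (volume.restrict U).prod (volume.restrict I) := by
  rw [Measure.volume_eq_prod, ← Measure.prod_restrict]

/-- The parabolic Sobolev embedding for truncated powers of a solution. -/
theorem IsLocalWeakSolution.truncated_moser_step (hp : IsLocalWeakSolution g U p) (hU : IsOpen U)
    (hn : 2 ≤ n) {Cg : ℝ} (hCg : 0 ≤ Cg)
    (hcoer : ∀ ξ : ℝ, 0 ≤ ξ → ξ ^ (2 - g.a) ≤ Cg * (1 + g.K ξ * ξ ^ 2)) (hT₀ : 0 ≤ T₀)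
    (hζ : IsCutoff U T₀ T₁ R Λ ζ) {k : ℕ} (hk : 2 ≤ k) {M β : ℝ} (hM : 0 < M) (hβ : 0 ≤ β)
    {C₁ C₂ : ℝ} (hC₁ : C₁ = k * Λ + 1 / g.coeff 0 * (1 + β) * k ^ 2 * R ^ 2) (hC₁0 : 0 ≤ C₁)
    (hC₂ : C₂ = 4 * ((1 + 2 * β) ^ 2 * Cg + k ^ 2 * (1 + R ^ 2)) +
      4 * ((1 + 2 * β) ^ 2 * Cg) * C₁) {Y : ℝ≥0∞}
    (hY : Y = ∫⁻ z in U ×ˢ Ioc T₀ T₁,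
      ENNReal.ofReal (truncEnergy M β (p z.2 z.1) * ζ z ^ (k - 2))) (hYtop : Y ≠ ⊤) :
    ∫⁻ z in U ×ˢ Ioc T₀ T₁,
      ENNReal.ofReal (truncRoot M β (2 - g.a) (p z.2 z.1) * ζ z ^ k) ^ (2 - g.a) *
        ENNReal.ofReal (truncEnergy M β (p z.2 z.1) * ζ z ^ k) ^ ((2 - g.a) / n) ≤
      sobolevConst n (2 - g.a) * (ENNReal.ofReal C₂ * Y) *
        (ENNReal.ofReal C₁ * Y) ^ ((2 - g.a) / n) := by
  have ha := g.a_lt_one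
  have ha0 := g.a_pos
  have hn' : (2 : ℝ) ≤ n := by exact_mod_cast hn
  obtain ⟨hsup, hsob⟩ := hp.caccioppoli hU hn hCg hcoer hT₀ hζ hk hM hβ hC₁ hC₁0 hC₂ hY
  set q := 2 - g.a with hq
  have hn0 : (0 : ℝ) < n := by linarith
  have hnq : (0 : ℝ) < n - q := by linarith
  have hSU : U ×ˢ Ioc T₀ T₁ ⊆ U ×ˢ Ioi (0 : ℝ) := prod_mono_right fun t ht => hT₀.trans_lt ht.1
  have hcF : Continuous (truncEnergy M β) :=
    continuous_iff_continuousAt.2 fun s => (hasDerivAt_truncEnergy hM s).continuousAt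
  have hch : Continuous (truncRoot M β q) :=
    continuous_iff_continuousAt.2 fun s => (hasDerivAt_truncRoot hM s).continuousAt
  have hcζ : Continuous fun z => ζ z ^ k := hζ.contDiff.continuous.pow k
  have m1 := (hp.aemeasurable_comp_mul hSU hch hcζ).ennreal_ofReal
  have m2 := (hp.aemeasurable_comp_mul hSU hcF hcζ).ennreal_ofReal
  rw [volume_restrict_prod] at m1 m2 ⊢
  have hjoint : AEMeasurable (fun z : Euc n × ℝ =>
      ENNReal.ofReal (truncRoot M β q (p z.2 z.1) * ζ z ^ k) ^ q *
        ENNReal.ofReal (truncEnergy M β (p z.2 z.1) * ζ z ^ k) ^ (q / n))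
      ((volume.restrict U).prod (volume.restrict (Ioc T₀ T₁))) :=
    (m1.pow_const _).mul (m2.pow_const _)
  rw [lintegral_prod_symm _ hjoint]
  have s1 := m1.aestronglyMeasurable.prod_swap.prodMk_left
  have s2 := m2.aestronglyMeasurable.prod_swap.prodMk_left
  calc _ ≤ ∫⁻ t in Ioc T₀ T₁, (∫⁻ x, ENNReal.ofReal (truncRoot M β q (p t x) * ζ (x, t) ^ k) ^
          (n * q / (n - q))) ^ ((n - q) / n) * (ENNReal.ofReal C₁ * Y) ^ (q / n) := by
        refine lintegral_mono_ae ?_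
        filter_upwards [s1, s2, ae_restrict_of_ae hsup, ae_restrict_mem measurableSet_Ioc]
          with t h1 h2 h3 ht
        -- Hölder on a slice with weights `(n-q)/n` and `q/n`: the first factor is the Sobolev norm
        -- to the power `q`, the second is bounded uniformly in time by the energy estimate.
        have hH := ENNReal.lintegral_mul_norm_pow_le (μ := volume.restrict U)
          (f := fun x => ENNReal.ofReal (truncRoot M β q (p t x) * ζ (x, t) ^ k) ^
            (n * q / (n - q)))
          (g := fun x => ENNReal.ofReal (truncEnergy M β (p t x) * ζ (x, t) ^ k))
          (h1.aemeasurable.pow_const _) h2.aemeasurable (p := (n - q) / n) (q := q / n)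
          (by positivity) (by have : 0 < q := by linarith
                              positivity) (by field_simp; ring)
        have e : (n * q / (n - q)) * ((n - q) / n) = q := by field_simp
        simp only [← ENNReal.rpow_mul, e] at hH
        refine hH.trans (mul_le_mul' (ENNReal.rpow_le_rpow (setLIntegral_le_lintegral _ _)
          (by positivity)) (ENNReal.rpow_le_rpow ?_ ?_))
        · exact (setLIntegral_le_lintegral _ _).trans (h3 ht.2)
        · have : 0 < q := by linarith
          positivity
    _ ≤ _ := by
        have hq0 : 0 ≤ q / n := by
          have : 0 < q := by linarith
          positivity
        rw [lintegral_mul_const' _ _ (ENNReal.rpow_ne_top_of_nonneg hq0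
          (ENNReal.mul_ne_top ENNReal.ofReal_ne_top hYtop))]
        gcongr
        exact (lintegral_mono_set Ioc_subset_Iic_self).trans hsob

/-- The number `E` is free of `β`, `k` and `Λ`. Polynomial growth in `β` and `k` is harmless in the
iteration, while linearity in `1 + Λ` determines the power of `1 + (θT)⁻¹` in the final estimate. -/
theorem moser_constants_le {K₀ Cg k β : ℝ} (hK₀ : 0 ≤ K₀) (hCg : 0 ≤ Cg) (hk : 1 ≤ k)
    (hβ : 0 ≤ β) (hΛ : 0 ≤ Λ) {C₁ C₂ E : ℝ}
    (hC₁ : C₁ = k * Λ + K₀ * (1 + β) * k ^ 2 * R ^ 2)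
    (hC₂ : C₂ = 4 * ((1 + 2 * β) ^ 2 * Cg + k ^ 2 * (1 + R ^ 2)) +
      4 * ((1 + 2 * β) ^ 2 * Cg) * C₁)
    (hE : E = (1 + 16 * Cg) * (1 + K₀ * R ^ 2) + 16 * Cg + 4 * (1 + R ^ 2)) :
    0 ≤ C₁ ∧ C₁ ≤ E * (2 * (1 + β)) ^ 3 * k ^ 2 * (1 + Λ) ∧
      C₂ ≤ E * (2 * (1 + β)) ^ 3 * k ^ 2 * (1 + Λ) := by
  set b := 1 + β with hb
  have hb1 : 1 ≤ b := by linarith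
  have hR2 : 0 ≤ R ^ 2 := sq_nonneg R
  have hC₁0 : 0 ≤ C₁ := by rw [hC₁]; positivity
  set N := k ^ 2 * (1 + Λ) with hN
  have hk2 : 1 ≤ k ^ 2 := one_le_pow₀ hk
  have hkk : k ≤ k ^ 2 := by nlinarith
  have hN1 : 1 ≤ N := by nlinarith
  have hkN : k ^ 2 ≤ N := le_mul_of_one_le_right (by positivity) (by linarith)
  have hb3 : b ≤ b ^ 3 := le_self_pow₀ hb1 (by norm_num)
  have hb23 : b ^ 2 ≤ b ^ 3 := pow_le_pow_right₀ hb1 (by norm_num)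
  have hb13 : 1 ≤ b ^ 3 := one_le_pow₀ hb1
  have hΛN : k * Λ ≤ N := by
    calc k * Λ ≤ k ^ 2 * (1 + Λ) := by gcongr; linarith
      _ = N := rfl
  have h1 : C₁ ≤ (1 + K₀ * R ^ 2) * b * N := by
    have i1 : k * Λ ≤ b * N := hΛN.trans (le_mul_of_one_le_left (by positivity) hb1)
    have i2 : K₀ * b * k ^ 2 * R ^ 2 ≤ K₀ * R ^ 2 * b * N := by
      calc _ = K₀ * R ^ 2 * b * k ^ 2 := by ring
        _ ≤ _ := by gcongr
    rw [hC₁]; linarith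
  have h1' : C₁ ≤ (1 + K₀ * R ^ 2) * b ^ 3 * N := h1.trans (by gcongr)
  have h2b : (1 + 2 * β) ^ 2 ≤ 4 * b ^ 2 := by
    calc (1 + 2 * β) ^ 2 ≤ (2 * b) ^ 2 := by gcongr; linarith
      _ = _ := by ring
  have h2 : C₂ ≤ (16 * Cg + 4 * (1 + R ^ 2) + 16 * Cg * (1 + K₀ * R ^ 2)) * (b ^ 3 * N) := by
    have j1 : (1 + 2 * β) ^ 2 * Cg ≤ 4 * Cg * (b ^ 3 * N) := by
      calc (1 + 2 * β) ^ 2 * Cg ≤ 4 * b ^ 2 * Cg := by gcongr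
        _ = 4 * Cg * (b ^ 2 * 1) := by ring
        _ ≤ _ := by gcongr
    have j2 : k ^ 2 * (1 + R ^ 2) ≤ (1 + R ^ 2) * (b ^ 3 * N) := by
      rw [mul_comm]
      refine mul_le_mul_of_nonneg_left ?_ (by positivity)
      exact hkN.trans (le_mul_of_one_le_left (by positivity) hb13)
    have j3 : (1 + 2 * β) ^ 2 * Cg * C₁ ≤ 4 * Cg * (1 + K₀ * R ^ 2) * (b ^ 3 * N) := by
      calc (1 + 2 * β) ^ 2 * Cg * C₁ ≤ 4 * b ^ 2 * Cg * ((1 + K₀ * R ^ 2) * b * N) := by gcongr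
        _ = _ := by ring
    rw [hC₂]; linarith
  have hbN : b ^ 3 * N ≤ (2 * b) ^ 3 * N := by gcongr; linarith
  have hKR : 0 ≤ K₀ * R ^ 2 := by positivity
  have hCK : 0 ≤ Cg * (1 + K₀ * R ^ 2) := by positivity
  refine ⟨hC₁0, ?_, ?_⟩
  · calc C₁ ≤ (1 + K₀ * R ^ 2) * (b ^ 3 * N) := by linarith
      _ ≤ E * ((2 * b) ^ 3 * N) := by
        refine mul_le_mul ?_ hbN (by positivity) ?_
        · rw [hE]; nlinarith
        · rw [hE]; positivity
      _ = _ := by rw [hN]; ring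
  · refine h2.trans ?_
    calc _ ≤ E * ((2 * b) ^ 3 * N) := by
          refine mul_le_mul ?_ hbN (by positivity) ?_
          · rw [hE]; nlinarith
          · rw [hE]; positivity
      _ = _ := by rw [hN]; ring

/-- One step of Moser's iteration. -/
theorem exists_moser_step (g : ForchheimerPolynomial) (hn : 2 ≤ n) (R : ℝ) :
    ∃ C₀ : ℝ, 1 ≤ C₀ ∧ ∀ {U : Set (Euc n)} {p : ℝ → Euc n → ℝ}, IsOpen U →
      IsLocalWeakSolution g U p → ∀ {T₀ T₁ Λ : ℝ} {ζ : Euc n × ℝ → ℝ}, 0 ≤ T₀ → 0 ≤ Λ →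
      IsCutoff U T₀ T₁ R Λ ζ → ∀ {k : ℕ} {α : ℝ}, 2 ≤ k → 2 ≤ α →
      ∫⁻ z in U ×ˢ Ioc T₀ T₁,
        ENNReal.ofReal ((1 + p z.2 z.1 ^ 2) ^ (kappa0 g.a n α / 2) * ζ z ^ (3 * k)) ≤
      (ENNReal.ofReal (C₀ * α ^ 3 * k ^ 2 * (1 + Λ)) * ∫⁻ z in U ×ˢ Ioc T₀ T₁,
        ENNReal.ofReal ((1 + p z.2 z.1 ^ 2) ^ (α / 2) * ζ z ^ (k - 2))) ^
          (1 + (2 - g.a) / n) := by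
  have ha := g.a_lt_one
  have ha0 := g.a_pos
  have hn' : (2 : ℝ) ≤ n := by exact_mod_cast hn
  have hn0 : (0 : ℝ) < n := by linarith
  have hq0 : 0 < 2 - g.a := by linarith
  have hqn : 0 < (2 - g.a) / n := by positivity
  have hK₀ : 0 ≤ 1 / g.coeff 0 := one_div_nonneg.2 g.coeff_zero_pos.le
  obtain ⟨Cg, hCg1, hcoer⟩ := g.exists_rpow_le_K_mul_sq
  have hCg : 0 ≤ Cg := by linarith
  set s := (sobolevConst n (2 - g.a)).toReal with hs
  have hs0 : 0 ≤ s := ENNReal.toReal_nonneg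
  have hsob : sobolevConst n (2 - g.a) = ENNReal.ofReal s :=
    (ENNReal.ofReal_toReal (sobolevConst_ne_top n hq0.le)).symm
  set E := (1 + 16 * Cg) * (1 + 1 / g.coeff 0 * R ^ 2) + 16 * Cg + 4 * (1 + R ^ 2) with hE
  have hE1 : 1 ≤ E := by
    have : 0 ≤ 1 / g.coeff 0 * R ^ 2 := by positivity
    nlinarith [sq_nonneg R]
  refine ⟨(1 + s) * E, by nlinarith, ?_⟩
  intro U p hU hp T₀ T₁ Λ ζ hT₀ hΛ hζ k α hk hα
  set S := U ×ˢ Ioc T₀ T₁ with hS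
  set Y := ∫⁻ z in S, ENNReal.ofReal ((1 + p z.2 z.1 ^ 2) ^ (α / 2) * ζ z ^ (k - 2)) with hY
  have hk1 : (1 : ℝ) ≤ k := by exact_mod_cast (by omega : 1 ≤ k)
  have hB : 0 < (1 + s) * E * α ^ 3 * k ^ 2 * (1 + Λ) := by positivity
  -- The infinite case is trivial and is removed because the truncated step requires a finite
  -- integral.
  by_cases hYtop : Y = ⊤
  · rw [hYtop, ENNReal.mul_top (by simpa using hB), ENNReal.top_rpow_of_pos (by positivity)]
    exact le_top
  -- Chosen so that `(1+s²)^{1+β} = (1+s²)^{α/2}`; the hypothesis `α ≥ 2` makes it nonnegative.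
  set β := (α - 2) / 2 with hβ
  have hβ0 : 0 ≤ β := by rw [hβ]; linarith
  set C₁ := k * Λ + 1 / g.coeff 0 * (1 + β) * k ^ 2 * R ^ 2 with hC₁
  set C₂ := 4 * ((1 + 2 * β) ^ 2 * Cg + k ^ 2 * (1 + R ^ 2)) +
    4 * ((1 + 2 * β) ^ 2 * Cg) * C₁ with hC₂
  obtain ⟨hC₁0, hC₁E, hC₂E⟩ := moser_constants_le hK₀ hCg hk1 hβ0 hΛ hC₁ hC₂ hE
  have hα2 : 2 * (1 + β) = α := by rw [hβ]; ring
  rw [hα2] at hC₁E hC₂E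
  set B := (1 + s) * E * α ^ 3 * k ^ 2 * (1 + Λ) with hBdef
  have hN : 0 ≤ E * α ^ 3 * k ^ 2 * (1 + Λ) := by positivity
  have hBs : B = (1 + s) * (E * α ^ 3 * k ^ 2 * (1 + Λ)) := by rw [hBdef]; ring
  have hC₁B : C₁ ≤ B := by rw [hBs]; nlinarith
  have hC₂B : s * C₂ ≤ B := by rw [hBs]; nlinarith
  -- the truncated functions
  set Ψ : ℕ → Euc n × ℝ → ℝ≥0∞ := fun m z =>
    ENNReal.ofReal (truncRoot (m + 1) β (2 - g.a) (p z.2 z.1) * ζ z ^ k) ^ (2 - g.a) *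
      ENNReal.ofReal (truncEnergy (m + 1) β (p z.2 z.1) * ζ z ^ k) ^ ((2 - g.a) / n) with hΨ
  have hM : ∀ m : ℕ, (0 : ℝ) < m + 1 := fun m => by positivity
  have hΨle : ∀ m, ∫⁻ z in S, Ψ m z ≤ (ENNReal.ofReal B * Y) ^ (1 + (2 - g.a) / n) := by
    intro m
    set Z := ∫⁻ z in S, ENNReal.ofReal (truncEnergy (m + 1) β (p z.2 z.1) * ζ z ^ (k - 2))
    have hZY : Z ≤ Y := by
      refine lintegral_mono fun z => ENNReal.ofReal_le_ofReal ?_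
      refine mul_le_mul_of_nonneg_right ?_ (pow_nonneg (hζ.nonneg z) _)
      have hx : 0 < 1 + p z.2 z.1 ^ 2 := by positivity
      calc truncEnergy (m + 1) β (p z.2 z.1)
          ≤ (1 + p z.2 z.1 ^ 2) * (1 + p z.2 z.1 ^ 2) ^ β :=
            mul_le_mul_of_nonneg_left (satPow_le_rpow (hM m) hβ0 hx) hx.le
        _ = (1 + p z.2 z.1 ^ 2) ^ (α / 2) := by
            rw [← Real.rpow_one_add' hx.le (by positivity)]
            congr 1; rw [hβ]; ring
    refine (hp.truncated_moser_step hU hn hCg hcoer hT₀ hζ hk (hM m) hβ0 hC₁ hC₁0 hC₂ rfl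
      (ne_top_of_le_ne_top hYtop hZY)).trans ?_
    rw [ENNReal.rpow_add_of_nonneg _ _ zero_le_one hqn.le, ENNReal.rpow_one]
    refine mul_le_mul' ?_ (ENNReal.rpow_le_rpow ?_ hqn.le)
    · rw [hsob, ← mul_assoc, ← ENNReal.ofReal_mul hs0]
      exact mul_le_mul' (ENNReal.ofReal_le_ofReal hC₂B) hZY
    · exact mul_le_mul' (ENNReal.ofReal_le_ofReal hC₁B) hZY
  set Ψ₀ : Euc n × ℝ → ℝ := fun z => (1 + p z.2 z.1 ^ 2) ^ ((2 - g.a) / 2) *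
    (1 + p z.2 z.1 ^ 2) ^ β * (ζ z ^ k) ^ (2 - g.a) *
      ((1 + p z.2 z.1 ^ 2) * (1 + p z.2 z.1 ^ 2) ^ β * ζ z ^ k) ^ ((2 - g.a) / n) with hΨ₀
  have hΨt : ∀ z, Tendsto (fun m => Ψ m z) atTop (𝓝 (ENNReal.ofReal (Ψ₀ z))) := by
    intro z
    have hζk : 0 ≤ ζ z ^ k := pow_nonneg (hζ.nonneg z) k
    have hx : 0 < 1 + p z.2 z.1 ^ 2 := by positivity
    have hΨm : ∀ m, Ψ m z = ENNReal.ofReal ((1 + p z.2 z.1 ^ 2) ^ ((2 - g.a) / 2) *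
        satPow (m + 1) β (1 + p z.2 z.1 ^ 2) * (ζ z ^ k) ^ (2 - g.a) *
          ((1 + p z.2 z.1 ^ 2) * satPow (m + 1) β (1 + p z.2 z.1 ^ 2) * ζ z ^ k) ^
            ((2 - g.a) / n)) := by
      intro m
      have h1 := truncRoot_nonneg (β := β) (q := 2 - g.a) (hM m) (p z.2 z.1)
      have h2 := (truncEnergy_pos (β := β) (hM m) (p z.2 z.1)).le
      have h3 := satPow_pos (β := β) (hM m) hx
      simp only [hΨ]
      rw [ENNReal.ofReal_rpow_of_nonneg (by positivity) hq0.le,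
        ENNReal.ofReal_rpow_of_nonneg (by positivity) hqn.le,
        ← ENNReal.ofReal_mul (by positivity), Real.mul_rpow h1 hζk, truncRoot_rpow (hM m) hq0]
      rfl
    simp_rw [hΨm]
    refine (ENNReal.continuous_ofReal.tendsto _).comp ?_
    have ht := tendsto_satPow β hx
    exact ((ht.const_mul _).mul_const _).mul
      (((ht.const_mul _).mul_const _).rpow_const (Or.inr hqn.le))
  have hSU : S ⊆ U ×ˢ Ioi (0 : ℝ) := prod_mono_right fun t ht => hT₀.trans_lt ht.1
  have hcζ : Continuous fun z => ζ z ^ k := hζ.contDiff.continuous.pow k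
  have hΨmeas : ∀ m, AEMeasurable (Ψ m) (volume.restrict S) := fun m =>
    ((hp.aemeasurable_comp_mul hSU (continuous_iff_continuousAt.2 fun s =>
      (hasDerivAt_truncRoot (hM m) s).continuousAt) hcζ).ennreal_ofReal.pow_const _).mul
    ((hp.aemeasurable_comp_mul hSU (continuous_iff_continuousAt.2 fun s =>
      (hasDerivAt_truncEnergy (hM m) s).continuousAt) hcζ).ennreal_ofReal.pow_const _)
  -- The truncation level `m + 1` tends to infinity; the bounds `hΨle` do not depend on it.
  have hfatou := lintegral_le_liminf_of_ae_tendsto hΨmeas (Eventually.of_forall hΨt)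
  refine le_trans (lintegral_mono fun z => ENNReal.ofReal_le_ofReal ?_)
    (hfatou.trans (liminf_le_of_frequently_le' (Frequently.of_forall hΨle)))
  have hx : 0 < 1 + p z.2 z.1 ^ 2 := by positivity
  have hζk : 0 ≤ ζ z ^ k := pow_nonneg (hζ.nonneg z) k
  have hζk1 : ζ z ^ k ≤ 1 := pow_le_one₀ (hζ.nonneg z) (hζ.le_one z)
  have hΨ₀' : Ψ₀ z = (1 + p z.2 z.1 ^ 2) ^ (kappa0 g.a n α / 2) *
      (ζ z ^ k) ^ (2 - g.a + (2 - g.a) / n) := by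
    simp only [hΨ₀]
    rw [Real.mul_rpow (by positivity) hζk, Real.mul_rpow hx.le (by positivity),
      ← Real.rpow_mul hx.le, Real.rpow_add_of_nonneg hζk hq0.le hqn.le]
    -- Exponent count: the root contributes `α - a` and the energy factor `α(2-a)/n`, with sum `κ₀`.
    have e : (1 + p z.2 z.1 ^ 2) ^ (kappa0 g.a n α / 2) =
        (1 + p z.2 z.1 ^ 2) ^ ((2 - g.a) / 2) * (1 + p z.2 z.1 ^ 2) ^ β *
          ((1 + p z.2 z.1 ^ 2) ^ ((2 - g.a) / n) *
            (1 + p z.2 z.1 ^ 2) ^ (β * ((2 - g.a) / n))) := by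
      rw [← Real.rpow_add hx, ← Real.rpow_add hx, ← Real.rpow_add hx]
      congr 1
      rw [hβ, kappa0]; field_simp; ring
    rw [e]; ring
  rw [hΨ₀']
  refine mul_le_mul_of_nonneg_left ?_ (by positivity)
  rw [mul_comm 3 k, pow_mul]
  have h3 : (ζ z ^ k) ^ 3 = (ζ z ^ k) ^ (3 : ℝ) := by norm_cast
  rw [h3]
  refine Real.rpow_le_rpow_of_exponent_ge_of_imp hζk hζk1 ?_ (fun _ h => by linarith)
  -- The exponent `3k` has its origin here: the cutoff appears to the power `k(q + q/n)`, and `q +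
  -- q/n ≤ 3`.
  have : (2 - g.a) / n ≤ 1 := by rw [div_le_one hn0]; linarith
  linarith

end MoserStep

/-! ### The iteration and its limit. -/

section Iteration

/-- A bound for powers of `u` with exponents tending to infinity bounds `u` itself. -/
theorem ae_le_of_lintegral_rpow_le {X : Type*} [MeasurableSpace X] {μ : Measure X} {u : X → ℝ}
    (hu : AEMeasurable u μ) {W ν δ : ℝ} (hW : 1 ≤ W) (hν : 1 < ν)
    (hδ : 0 < δ) {e : ℕ → ℝ} (he : ∀ j, δ * ν ^ j ≤ e j)
    (hle : ∀ j, ∫⁻ x, ENNReal.ofReal (u x ^ e j) ∂μ ≤ ENNReal.ofReal (W ^ (ν ^ j))) :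
    ∀ᵐ x ∂μ, u x ≤ W ^ (1 / δ) := by
  have key : ∀ L : ℝ, W ^ (1 / δ) < L → μ {x | L ≤ u x} = 0 := by
    intro L hL
    have hL1 : 1 ≤ L := (Real.one_le_rpow hW (by positivity)).trans hL.le
    have hL0 : 0 < L := by linarith
    have hLδ : W < L ^ δ := by
      have h := Real.rpow_lt_rpow (by positivity) hL hδ
      rwa [← Real.rpow_mul (by linarith), one_div_mul_cancel hδ.ne', Real.rpow_one] at h
    set ρ := W / L ^ δ with hρ
    have hρ0 : 0 ≤ ρ := by positivity
    have hρ1 : ρ < 1 := (div_lt_one (by positivity)).2 hLδ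
    -- Chebyshev's inequality for the exponent `e j`. As `ρ < 1` and `ν^j → ∞`, the level set is
    -- null.
    have hb : ∀ j, μ {x | L ≤ u x} ≤ ENNReal.ofReal (ρ ^ (ν ^ j)) := by
      intro j
      have hνj : 0 < ν ^ j := by positivity
      have hej : 0 < e j := lt_of_lt_of_le (by positivity) (he j)
      have h1 := mul_meas_ge_le_lintegral₀ (μ := μ) (f := fun x => ENNReal.ofReal (u x ^ e j))
        ((hu.pow_const _).ennreal_ofReal) (ENNReal.ofReal (L ^ e j))
      have hsub : {x | L ≤ u x} ⊆ {x | ENNReal.ofReal (L ^ e j) ≤ ENNReal.ofReal (u x ^ e j)} :=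
        fun x hx => ENNReal.ofReal_le_ofReal (Real.rpow_le_rpow hL0.le hx hej.le)
      have h2 : ENNReal.ofReal ((L ^ δ) ^ (ν ^ j)) * μ {x | L ≤ u x} ≤
          ENNReal.ofReal (W ^ (ν ^ j)) := by
        refine le_trans (mul_le_mul' (ENNReal.ofReal_le_ofReal ?_) (measure_mono hsub))
          (h1.trans (hle j))
        rw [← Real.rpow_mul hL0.le]
        exact Real.rpow_le_rpow_of_exponent_le hL1 (he j)
      have hpos : 0 < (L ^ δ) ^ (ν ^ j) := by positivity
      rw [hρ, Real.div_rpow (by linarith) (by positivity), ENNReal.ofReal_div_of_pos hpos,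
        ENNReal.le_div_iff_mul_le (Or.inl (by simpa using hpos)) (Or.inl ENNReal.ofReal_ne_top),
        mul_comm]
      exact h2
    have ht : Tendsto (fun j : ℕ => ENNReal.ofReal (ρ ^ (ν ^ j))) atTop (𝓝 0) := by
      rw [← ENNReal.ofReal_zero]
      refine (ENNReal.continuous_ofReal.tendsto _).comp ?_
      exact (tendsto_rpow_atTop_of_base_lt_one ρ (by linarith) hρ1).comp
        (tendsto_pow_atTop_atTop_of_one_lt hν)
    exact le_antisymm (ge_of_tendsto' ht hb) bot_le
  have hall : ∀ᵐ x ∂μ, ∀ i : ℕ, u x < W ^ (1 / δ) + 1 / (i + 1) := by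
    rw [ae_all_iff]
    intro i
    have h := key (W ^ (1 / δ) + 1 / (i + 1)) (by linarith [Nat.one_div_pos_of_nat (α := ℝ) (n := i)])
    rw [ae_iff]
    simpa using h
  filter_upwards [hall] with x hx
  have ht : Tendsto (fun i : ℕ => W ^ (1 / δ) + 1 / ((i : ℝ) + 1)) atTop (𝓝 (W ^ (1 / δ) + 0)) :=
    tendsto_const_nhds.add tendsto_one_div_add_atTop_nhds_zero_nat
  rw [add_zero] at ht
  exact ge_of_tendsto' ht fun i => (hx i).le

/-- Solution of the recursive inequality of Moser's iteration. -/
theorem moser_recursion {Y : ℕ → ℝ≥0∞} {A D ν y : ℝ} (hA : 1 ≤ A) (hD : 1 ≤ D) (hν : 1 < ν)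
    (hy : 0 ≤ y) (hY0 : Y 0 ≤ ENNReal.ofReal y)
    (hY : ∀ j, Y (j + 1) ≤ (ENNReal.ofReal (A * D ^ j) * Y j) ^ ν) (j : ℕ) :
    Y j ≤ ENNReal.ofReal ((A ^ (ν / (ν - 1)) * D ^ (ν / (ν - 1) ^ 2) * y) ^ (ν ^ j)) := by
  have hν1 : 0 < ν - 1 := by linarith
  have hA0 : 0 < A := by linarith
  have hD0 : 0 < D := by linarith
  set a := ν / (ν - 1) with ha
  set d := ν / (ν - 1) ^ 2 with hd
  have ha0 : 0 < a := by rw [ha]; positivity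
  have hd0 : 0 < d := by rw [hd]; positivity
  have ea : ν * (1 - a) = -a := by rw [ha]; field_simp; ring
  have ed : ν * d = a + d := by rw [ha, hd]; field_simp; ring
  set W := A ^ a * D ^ d * y with hW
  have hW0 : 0 ≤ W := by positivity
  clear_value W
  -- The recursion taken with equality is solved exactly by this ansatz: `a` and `d` satisfy `ν(1-a)
  -- = -a` and `νd = a + d`. The correction factor is at most one and is discarded at the end.
  have main : ∀ j : ℕ, Y j ≤ ENNReal.ofReal (W ^ (ν ^ j) * (A ^ (-a) * D ^ (-(j * a + d)))) := by
    intro j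
    induction j with
    | zero =>
      refine hY0.trans (ENNReal.ofReal_le_ofReal (le_of_eq ?_))
      simp only [pow_zero, Real.rpow_one, Nat.cast_zero, zero_mul, zero_add]
      rw [hW, Real.rpow_neg hA0.le, Real.rpow_neg hD0.le]
      field_simp
    | succ j ih =>
      refine (hY j).trans ?_
      refine (ENNReal.rpow_le_rpow (mul_le_mul' le_rfl ih) (by linarith)).trans ?_
      rw [← ENNReal.ofReal_mul (by positivity),
        ENNReal.ofReal_rpow_of_nonneg (by positivity) (by linarith)]
      refine ENNReal.ofReal_le_ofReal (le_of_eq ?_)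
      have e1 : A * D ^ j * (W ^ (ν ^ j) * (A ^ (-a) * D ^ (-(j * a + d)))) =
          W ^ (ν ^ j) * (A ^ (1 - a) * D ^ ((j : ℝ) - (j * a + d))) := by
        rw [sub_eq_add_neg, Real.rpow_add hA0, Real.rpow_one, sub_eq_add_neg (j : ℝ),
          Real.rpow_add hD0, Real.rpow_natCast]
        ring
      rw [e1, Real.mul_rpow (by positivity) (by positivity),
        Real.mul_rpow (by positivity) (by positivity), ← Real.rpow_mul hW0, ← Real.rpow_mul hA0.le,
        ← Real.rpow_mul hD0.le, ← pow_succ]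
      congr 3
      · linarith
      · push_cast
        linear_combination (j : ℝ) * ea - ed
  refine (main j).trans (ENNReal.ofReal_le_ofReal ?_)
  refine mul_le_of_le_one_right (by positivity) (mul_le_one₀ ?_ (by positivity) ?_)
  · exact Real.rpow_le_one_of_one_le_of_nonpos hA (by linarith)
  · refine Real.rpow_le_one_of_one_le_of_nonpos hD ?_
    have : 0 ≤ j * a := by positivity
    linarith

/-- The exponents of Moser's iteration. -/
noncomputable def moserExponent (a : ℝ) (n : ℕ) (α : ℝ) (j : ℕ) : ℝ :=
  alphaStar a n + (1 + (2 - a) / n) ^ j * (α - alphaStar a n)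

/-- The map `κ₀` is affine in `α` with slope `1 + (2-a)/n`, and `α_*` is its fixed point. -/
theorem moserExponent_succ {a : ℝ} {n : ℕ} (hn : 2 ≤ n) (ha : a < 1) (α : ℝ) (j : ℕ) :
    moserExponent a n α (j + 1) = kappa0 a n (moserExponent a n α j) := by
  have hn0 : (n : ℝ) ≠ 0 := by positivity
  have h2 : 2 - a ≠ 0 := by linarith
  unfold moserExponent kappa0 alphaStar
  rw [pow_succ]
  field_simp
  ring

variable {n : ℕ} {U : Set (Euc n)} {T₀ T₁ R Λ : ℝ} {ζ : Euc n × ℝ → ℝ}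
  {g : ForchheimerPolynomial} {p : ℝ → Euc n → ℝ}

/-- Moser's iteration: local boundedness, on the set where the cutoff function is `1`. -/
theorem exists_moser_bound (g : ForchheimerPolynomial) (hn : 2 ≤ n) (R α : ℝ) (hα2 : 2 ≤ α)
    (hα : alphaStar g.a n < α) :
    ∃ A₀ : ℝ, 1 ≤ A₀ ∧ ∀ {U : Set (Euc n)} {p : ℝ → Euc n → ℝ}, IsOpen U →
      IsLocalWeakSolution g U p → ∀ {T₀ T₁ Λ y : ℝ} {ζ : Euc n × ℝ → ℝ}, 0 ≤ T₀ → 0 ≤ Λ → 1 ≤ y →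
      IsCutoff U T₀ T₁ R Λ ζ →
      ∫⁻ z in U ×ˢ Ioc T₀ T₁, ENNReal.ofReal ((1 + p z.2 z.1 ^ 2) ^ (α / 2)) ≤ ENNReal.ofReal y →
      ∀ {Q : Set (Euc n × ℝ)}, MeasurableSet Q → Q ⊆ U ×ˢ Ioc T₀ T₁ → (∀ z ∈ Q, ζ z = 1) →
      ∀ᵐ z ∂(volume.restrict Q), |p z.2 z.1| ≤
        (A₀ * (1 + Λ) ^ ((1 + (2 - g.a) / n) / ((2 - g.a) / n)) * y) ^
          (1 / (α - alphaStar g.a n)) := by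
  have ha := g.a_lt_one
  have ha0 := g.a_pos
  have hn' : (2 : ℝ) ≤ n := by exact_mod_cast hn
  have hn0 : (0 : ℝ) < n := by linarith
  have hq0 : 0 < 2 - g.a := by linarith
  have hqn : 0 < (2 - g.a) / n := by positivity
  have hqn1 : (2 - g.a) / n ≤ 1 := by rw [div_le_one hn0]; linarith
  obtain ⟨C₀, hC₀, hstep⟩ := exists_moser_step g hn R
  set ν := 1 + (2 - g.a) / n with hν
  have hν1 : 1 < ν := by linarith
  have hν2 : ν ≤ 2 := by linarith
  have hνm : ν - 1 = (2 - g.a) / n := by rw [hν]; ring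
  have hαs0 : 0 ≤ alphaStar g.a n := by unfold alphaStar; positivity
  set δ := α - alphaStar g.a n with hδ
  have hδ0 : 0 < δ := by rw [hδ]; linarith
  set B := 9 * C₀ * α ^ 3 with hB
  have hα3 : 1 ≤ α ^ 3 := one_le_pow₀ (by linarith)
  have hB1 : 1 ≤ B := by rw [hB]; nlinarith
  refine ⟨B ^ (ν / (ν - 1)) * 72 ^ (ν / (ν - 1) ^ 2), ?_, ?_⟩
  · refine one_le_mul_of_one_le_of_one_le (Real.one_le_rpow hB1 ?_)
      (Real.one_le_rpow (by norm_num) ?_) <;> rw [hνm] <;> positivity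
  intro U p hU hp T₀ T₁ Λ y ζ hT₀ hΛ hy hζ hY0 Q hQm hQS hQ1
  set S := U ×ˢ Ioc T₀ T₁ with hS
  set e : ℕ → ℝ := moserExponent g.a n α with he
  have hpow1 : ∀ j : ℕ, 1 ≤ ν ^ j := fun j => one_le_pow₀ hν1.le
  have heα : ∀ j, α ≤ e j := fun j => by
    simp only [he, moserExponent, ← hν, ← hδ]
    have := le_mul_of_one_le_left hδ0.le (hpow1 j)
    linarith
  have heδ : ∀ j, δ * ν ^ j ≤ e j := fun j => by
    simp only [he, moserExponent, ← hν, ← hδ]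
    linarith
  have heν : ∀ j, e j ≤ ν ^ j * α := fun j => by
    simp only [he, moserExponent, ← hν]
    have := le_mul_of_one_le_left hαs0 (hpow1 j)
    linarith
  set Y : ℕ → ℝ≥0∞ := fun j => ∫⁻ z in S,
    ENNReal.ofReal ((1 + p z.2 z.1 ^ 2) ^ (e j / 2) * ζ z ^ (3 ^ (j + 1) - 3)) with hYdef
  have hrec : ∀ j, Y (j + 1) ≤ (ENNReal.ofReal (B * (1 + Λ) * 72 ^ j) * Y j) ^ ν := by
    intro j
    have h3 : 3 ≤ 3 ^ (j + 1) := by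
      calc 3 = 3 ^ 1 := rfl
        _ ≤ 3 ^ (j + 1) := Nat.pow_le_pow_right (by norm_num) (by omega)
    -- With this `k` one has `k - 2 = 3^{j+1} - 3` and `3k = 3^{j+2} - 3`, so consecutive steps fit
    -- together. At `j = 0` the exponent is zero and the initial integral carries no cutoff.
    have h := hstep hU hp hT₀ hΛ hζ (k := 3 ^ (j + 1) - 1) (α := e j) (by omega)
      (hα2.trans (heα j))
    have e1 : 3 * (3 ^ (j + 1) - 1) = 3 ^ (j + 1 + 1) - 3 := by rw [pow_succ 3 (j + 1)]; omega
    have e2 : 3 ^ (j + 1) - 1 - 2 = 3 ^ (j + 1) - 3 := by omega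
    rw [e1, e2, he, ← moserExponent_succ hn ha, ← he] at h
    refine h.trans (ENNReal.rpow_le_rpow (mul_le_mul' (ENNReal.ofReal_le_ofReal ?_) le_rfl)
      (by linarith))
    have k1 : (((3 ^ (j + 1) - 1 : ℕ) : ℝ)) ≤ 3 ^ (j + 1) := by
      exact_mod_cast Nat.sub_le _ _
    have k2 : (((3 ^ (j + 1) - 1 : ℕ) : ℝ)) ^ 2 ≤ 9 * 9 ^ j := by
      calc (((3 ^ (j + 1) - 1 : ℕ) : ℝ)) ^ 2 ≤ (3 ^ (j + 1)) ^ 2 := by gcongr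
        _ = 9 * 9 ^ j := by rw [← pow_mul, mul_comm, pow_mul]; norm_num [pow_succ]; ring
    have ej0 : 0 ≤ e j := by linarith [heα j]
    -- Since `ν ≤ 2`, the cube of the exponent grows at most like `8^j`; with `9^j` from `k²` this
    -- gives the base `72`.
    have k3 : e j ^ 3 ≤ 8 ^ j * α ^ 3 := by
      calc e j ^ 3 ≤ (2 ^ j * α) ^ 3 := by
            gcongr
            exact (heν j).trans (by gcongr)
        _ = 8 ^ j * α ^ 3 := by rw [mul_pow, ← pow_mul, mul_comm j, pow_mul]; norm_num
    calc C₀ * e j ^ 3 * (((3 ^ (j + 1) - 1 : ℕ) : ℝ)) ^ 2 * (1 + Λ)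
        ≤ C₀ * (8 ^ j * α ^ 3) * (9 * 9 ^ j) * (1 + Λ) := by gcongr
      _ = B * (1 + Λ) * (8 ^ j * 9 ^ j) := by rw [hB]; ring
      _ = B * (1 + Λ) * 72 ^ j := by rw [← mul_pow]; norm_num
  have hY0' : Y 0 ≤ ENNReal.ofReal y := by
    refine le_trans (le_of_eq ?_) hY0
    simp [hYdef, he, moserExponent]
  have hfin := moser_recursion (A := B * (1 + Λ)) (D := 72) (one_le_mul_of_one_le_of_one_le hB1
    (by linarith)) (by norm_num) hν1 (by linarith) hY0' hrec
  set W := B ^ (ν / (ν - 1)) * 72 ^ (ν / (ν - 1) ^ 2) * (1 + Λ) ^ (ν / ((2 - g.a) / n)) * y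
    with hW
  have hWeq : (B * (1 + Λ)) ^ (ν / (ν - 1)) * 72 ^ (ν / (ν - 1) ^ 2) * y = W := by
    rw [hW, Real.mul_rpow (by linarith) (by linarith), ← hνm]; ring
  rw [hWeq] at hfin
  have hW1 : 1 ≤ W := by
    rw [hW]
    refine one_le_mul_of_one_le_of_one_le (one_le_mul_of_one_le_of_one_le
      (one_le_mul_of_one_le_of_one_le (Real.one_le_rpow hB1 ?_)
      (Real.one_le_rpow (by norm_num) ?_)) (Real.one_le_rpow (by linarith) ?_)) hy
    · rw [hνm]; positivity
    · rw [hνm]; positivity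
    · positivity
  have hSU : S ⊆ U ×ˢ Ioi (0 : ℝ) := prod_mono_right fun t ht => hT₀.trans_lt ht.1
  have hmeas : AEMeasurable (fun z : Euc n × ℝ => (1 + p z.2 z.1 ^ 2) ^ (1 / 2 : ℝ))
      (volume.restrict Q) := by
    have h := hp.aemeasurable_comp_mul (hQS.trans hSU)
      (f := fun s => (1 + s ^ 2) ^ (1 / 2 : ℝ)) (w := fun _ => 1)
      ((continuous_const.add (continuous_pow 2)).rpow_const fun s => Or.inr (by norm_num))
      continuous_const
    simpa using h
  -- Applied to `u = (1+p²)^{1/2}` on the set where the cutoff is `1`, so that its growing exponents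
  -- have no effect.
  have hae := ae_le_of_lintegral_rpow_le hmeas hW1 hν1 hδ0 heδ
    (fun j => by
      refine le_trans ?_ (hfin j)
      refine le_trans ?_ (lintegral_mono_set hQS)
      refine setLIntegral_mono' hQm fun z hz => ENNReal.ofReal_le_ofReal (le_of_eq ?_)
      rw [hQ1 z hz, one_pow, mul_one, ← Real.rpow_mul (by positivity)]
      congr 1; ring)
  filter_upwards [hae] with z hz
  refine le_trans ?_ hz
  rw [← Real.sqrt_eq_rpow]
  exact Real.abs_le_sqrt (by linarith)

end Iteration

/-! ### Construction of the cutoff functions. -/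

section CutoffConstruction

theorem exists_abs_deriv_smoothTransition_le :
    ∃ C : ℝ, 0 ≤ C ∧ ∀ x, |deriv Real.smoothTransition x| ≤ C := by
  have hcont : Continuous (deriv Real.smoothTransition) :=
    (Real.smoothTransition.contDiff (n := 1)).continuous_deriv le_rfl
  have hsupp : HasCompactSupport (deriv Real.smoothTransition) := by
    refine HasCompactSupport.intro (isCompact_Icc (a := 0) (b := 1)) fun x hx => ?_
    rcases lt_or_ge x 0 with h | h
    · have : Real.smoothTransition =ᶠ[𝓝 x] fun _ => 0 := by
        filter_upwards [Iio_mem_nhds h] with y hy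
        exact Real.smoothTransition.zero_of_nonpos (le_of_lt hy)
      rw [this.deriv_eq, deriv_const]
    · have h1 : 1 < x := by
        by_contra hc
        exact hx ⟨h, not_lt.1 hc⟩
      have : Real.smoothTransition =ᶠ[𝓝 x] fun _ => 1 := by
        filter_upwards [Ioi_mem_nhds h1] with y hy
        exact Real.smoothTransition.one_of_one_le (le_of_lt hy)
      rw [this.deriv_eq, deriv_const]
  obtain ⟨C, hC⟩ := hsupp.exists_bound_of_continuous hcont
  exact ⟨C, (norm_nonneg _).trans (hC 0), hC⟩

/-- Cutoff functions in time. -/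
theorem exists_time_cutoff : ∃ C : ℝ, 0 ≤ C ∧ ∀ T₀ T₁ h : ℝ, 0 < h →
    ∃ χ : ℝ → ℝ, ContDiff ℝ 1 χ ∧ (∀ t, 0 ≤ χ t) ∧ (∀ t, χ t ≤ 1) ∧
      tsupport χ ⊆ Icc (T₀ + h / 2) (T₁ + 2) ∧ (∀ t ∈ Icc (T₀ + h) T₁, χ t = 1) ∧
      ∀ t ≤ T₁, |deriv χ t| ≤ C * h⁻¹ := by
  obtain ⟨C, hC0, hC⟩ := exists_abs_deriv_smoothTransition_le
  refine ⟨2 * C, by positivity, fun T₀ T₁ h hh => ?_⟩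
  have hs : ContDiff ℝ 1 Real.smoothTransition := Real.smoothTransition.contDiff (n := 1)
  -- The first factor rises between `T₀ + h/2` and `T₀ + h`. The second only makes the support
  -- compact; it equals `1` up to `T₁ + 1`, so it adds nothing to the derivative at times `t ≤ T₁`.
  refine ⟨fun t => Real.smoothTransition ((t - T₀ - h / 2) / (h / 2)) *
    Real.smoothTransition (T₁ + 2 - t), ?_, ?_, ?_, ?_, ?_, ?_⟩
  · exact (hs.comp (by fun_prop)).mul (hs.comp (by fun_prop))
  · exact fun t => mul_nonneg (Real.smoothTransition.nonneg _) (Real.smoothTransition.nonneg _)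
  · exact fun t => mul_le_one₀ (Real.smoothTransition.le_one _) (Real.smoothTransition.nonneg _)
      (Real.smoothTransition.le_one _)
  · refine closure_minimal (fun t ht => ?_) isClosed_Icc
    by_contra hc
    apply ht
    rcases lt_or_ge t (T₀ + h / 2) with h1 | h1
    · simp only
      rw [Real.smoothTransition.zero_of_nonpos, zero_mul]
      exact div_nonpos_of_nonpos_of_nonneg (by linarith) (by linarith)
    · have : T₁ + 2 < t := by
        by_contra h2
        exact hc ⟨h1, not_lt.1 h2⟩
      simp only
      rw [Real.smoothTransition.zero_of_nonpos (x := T₁ + 2 - t) (by linarith), mul_zero]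
  · intro t ht
    simp only
    rw [Real.smoothTransition.one_of_one_le, Real.smoothTransition.one_of_one_le, one_mul]
    · linarith [ht.2]
    · rw [le_div_iff₀ (by linarith)]; linarith [ht.1]
  · intro t ht
    have he : (fun t => Real.smoothTransition ((t - T₀ - h / 2) / (h / 2)) *
        Real.smoothTransition (T₁ + 2 - t)) =ᶠ[𝓝 t]
        fun t => Real.smoothTransition ((t - T₀ - h / 2) / (h / 2)) := by
      filter_upwards [Iio_mem_nhds (show t < T₁ + 1 by linarith)] with s hs'
      have hs' : s < T₁ + 1 := hs'
      rw [Real.smoothTransition.one_of_one_le (x := T₁ + 2 - s) (by linarith), mul_one]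
    have hd : HasDerivAt (fun t => Real.smoothTransition ((t - T₀ - h / 2) / (h / 2)))
        (deriv Real.smoothTransition ((t - T₀ - h / 2) / (h / 2)) * (1 / (h / 2))) t :=
      (hs.differentiable one_ne_zero _).hasDerivAt.comp t
        ((((hasDerivAt_id t).sub_const T₀).sub_const (h / 2)).div_const (h / 2))
    rw [he.deriv_eq, hd.deriv, abs_mul, abs_of_pos (by positivity : 0 < 1 / (h / 2))]
    calc _ ≤ C * (1 / (h / 2)) := by gcongr; exact hC _
      _ = 2 * C * h⁻¹ := by field_simp

variable {n : ℕ} {U : Set (Euc n)}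

/-- Cutoff functions in space. -/
theorem exists_space_cutoff {K : Set (Euc n)} (hU : IsOpen U) (hK : IsCompact K) (hKU : K ⊆ U) :
    ∃ ψ : Euc n → ℝ, ContDiff ℝ 1 ψ ∧ HasCompactSupport ψ ∧ tsupport ψ ⊆ U ∧ (∀ x, 0 ≤ ψ x) ∧
      (∀ x, ψ x ≤ 1) ∧ (∀ x ∈ K, ψ x = 1) ∧ ∃ R, ∀ x, ‖fderiv ℝ ψ x‖ ≤ R := by
  obtain ⟨δ, hδ, hδU⟩ := hK.exists_cthickening_subset_open hU hKU
  obtain ⟨f, hf0, hf1, hf⟩ := exists_contMDiffMap_zero_one_of_isClosed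
    (modelWithCornersSelf ℝ (Euc n)) (n := 1) (s := (Metric.thickening δ K)ᶜ) (t := K)
    Metric.isOpen_thickening.isClosed_compl hK.isClosed
    (disjoint_compl_left_iff_subset.2 (Metric.self_subset_thickening hδ K))
  have hfs : tsupport f ⊆ Metric.cthickening δ K := by
    refine closure_minimal (fun x hx => ?_) Metric.isClosed_cthickening
    by_contra hc
    exact hx (hf0 fun h => hc (Metric.thickening_subset_cthickening δ K h))
  have hfc : ContDiff ℝ 1 f := f.contMDiff.contDiff
  have hsupp : HasCompactSupport f :=
    HasCompactSupport.of_support_subset_isCompact hK.cthickening ((subset_tsupport f).trans hfs)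
  refine ⟨f, hfc, hsupp, hfs.trans hδU, fun x => (hf x).1, fun x => (hf x).2,
    fun x hx => hf1 hx, ?_⟩
  exact (hsupp.fderiv ℝ).exists_bound_of_continuous (hfc.continuous_fderiv one_ne_zero)

/-- The product of a cutoff function in space and a cutoff function in time. -/
theorem isCutoff_mul {T₀ T₁ a b R Λ : ℝ} {ψ : Euc n → ℝ} {χ : ℝ → ℝ} (hψ : ContDiff ℝ 1 ψ)
    (hψs : HasCompactSupport ψ) (hψU : tsupport ψ ⊆ U) (hψ0 : ∀ x, 0 ≤ ψ x) (hψ1 : ∀ x, ψ x ≤ 1)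
    (hψR : ∀ x, ‖fderiv ℝ ψ x‖ ≤ R) (hχ : ContDiff ℝ 1 χ) (hχ0 : ∀ t, 0 ≤ χ t)
    (hχ1 : ∀ t, χ t ≤ 1) (hχs : tsupport χ ⊆ Icc a b) (ha : T₀ < a)
    (hχΛ : ∀ t ≤ T₁, |deriv χ t| ≤ Λ) :
    IsCutoff U T₀ T₁ R Λ (fun z => ψ z.1 * χ z.2) := by
  have hsub : tsupport (fun z : Euc n × ℝ => ψ z.1 * χ z.2) ⊆ tsupport ψ ×ˢ Icc a b := by
    refine closure_minimal (fun z hz => ?_) ((isClosed_tsupport ψ).prod isClosed_Icc)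
    have hz' : ψ z.1 * χ z.2 ≠ 0 := hz
    exact ⟨subset_tsupport ψ (left_ne_zero_of_mul hz'),
      hχs (subset_tsupport χ (right_ne_zero_of_mul hz'))⟩
  have hd : ∀ z : Euc n × ℝ, HasFDerivAt (fun z : Euc n × ℝ => ψ z.1 * χ z.2)
      (ψ z.1 • (fderiv ℝ χ z.2).comp (ContinuousLinearMap.snd ℝ (Euc n) ℝ) +
        χ z.2 • (fderiv ℝ ψ z.1).comp (ContinuousLinearMap.fst ℝ (Euc n) ℝ)) z := fun z =>
    ((hψ.differentiable one_ne_zero z.1).hasFDerivAt.comp z hasFDerivAt_fst).mul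
      ((hχ.differentiable one_ne_zero z.2).hasFDerivAt.comp z hasFDerivAt_snd)
  refine ⟨by fun_prop, ?_, ?_, fun z => mul_nonneg (hψ0 _) (hχ0 _),
    fun z => mul_le_one₀ (hψ1 _) (hχ0 _) (hχ1 _), fun z _ => ?_, fun z hz => ?_⟩
  · exact (hψs.isCompact.prod isCompact_Icc).of_isClosed_subset (isClosed_tsupport _) hsub
  · exact hsub.trans (prod_mono hψU fun t ht => ha.trans_le ht.1)
  · have : spaceDeriv (fun z : Euc n × ℝ => ψ z.1 * χ z.2) z = χ z.2 • fderiv ℝ ψ z.1 := by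
      ext v
      simp [spaceDeriv, (hd z).fderiv]
    rw [this, norm_smul, Real.norm_of_nonneg (hχ0 _)]
    exact (mul_le_of_le_one_left (norm_nonneg _) (hχ1 _)).trans (hψR _)
  · have : fderiv ℝ (fun z : Euc n × ℝ => ψ z.1 * χ z.2) z (0, 1) = ψ z.1 * deriv χ z.2 := by
      simp [(hd z).fderiv]
    rw [this, abs_mul, abs_of_nonneg (hψ0 _)]
    exact (mul_le_of_le_one_left (abs_nonneg _) (hψ1 _)).trans (hχΛ _ hz)

end CutoffConstruction

/-! ### From almost every time to every time, and comparison of exponents. -/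

section LocalBoundedness

theorem lintegral_one_add_sq_rpow_le {X : Type*} [MeasurableSpace X] {μ : Measure X} (f : X → ℝ)
    {α : ℝ} (hα : 0 < α) :
    ∫⁻ x, ENNReal.ofReal ((1 + f x ^ 2) ^ (α / 2)) ∂μ ≤
      ENNReal.ofReal (2 ^ α) * (μ univ + eLpNorm f (ENNReal.ofReal α) μ ^ α) := by
  have hpt : ∀ s : ℝ, (1 + s ^ 2) ^ (α / 2) ≤ 2 ^ α * (1 + |s| ^ α) := by
    intro s
    have h1 : (1 + s ^ 2) ^ (α / 2) ≤ (2 * max 1 |s|) ^ α := by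
      have e : (2 * max 1 |s|) ^ α = ((2 * max 1 |s|) ^ 2) ^ (α / 2) := by
        rw [← Real.rpow_natCast, ← Real.rpow_mul (by positivity)]
        congr 1; push_cast; ring
      rw [e]
      refine Real.rpow_le_rpow (by positivity) ?_ (by positivity)
      have h1 := le_max_left 1 |s|
      have h2 := le_max_right 1 |s|
      have h3 : s ^ 2 ≤ max 1 |s| ^ 2 := by rw [← sq_abs]; gcongr
      nlinarith
    refine h1.trans ?_
    rw [Real.mul_rpow (by norm_num) (by positivity)]
    gcongr
    rcases le_total 1 |s| with h | h
    · rw [max_eq_right h]; linarith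
    · rw [max_eq_left h, Real.one_rpow]
      have : 0 ≤ |s| ^ α := by positivity
      linarith
  have hnorm : eLpNorm f (ENNReal.ofReal α) μ ^ α = ∫⁻ x, ENNReal.ofReal (|f x| ^ α) ∂μ := by
    rw [eLpNorm_eq_lintegral_rpow_enorm_toReal (by simpa using hα) ENNReal.ofReal_ne_top,
      ENNReal.toReal_ofReal hα.le, ← ENNReal.rpow_mul, one_div_mul_cancel hα.ne', ENNReal.rpow_one]
    refine lintegral_congr fun x => ?_
    rw [← Real.norm_eq_abs, ← ENNReal.ofReal_rpow_of_nonneg (norm_nonneg _) hα.le,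
      ofReal_norm]
  rw [hnorm, ← lintegral_one, ← lintegral_add_left measurable_const,
    ← lintegral_const_mul' _ _ ENNReal.ofReal_ne_top]
  refine lintegral_mono fun x => ?_
  simp only
  rw [← ENNReal.ofReal_one, ← ENNReal.ofReal_add zero_le_one (by positivity),
    ← ENNReal.ofReal_mul (by positivity)]
  exact ENNReal.ofReal_le_ofReal (hpt _)

variable {n : ℕ} {U : Set (Euc n)} {g : ForchheimerPolynomial} {p : ℝ → Euc n → ℝ}

/-- By continuity in time, a space-time bound holds at every time. -/
theorem IsLocalWeakSolution.ae_abs_le_of_prod (hp : IsLocalWeakSolution g U p) {V : Set (Euc n)}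
    (hV : IsCompact V) (hVU : V ⊆ U) {s₀ s₁ B : ℝ} (hs₀ : 0 < s₀) (hs : s₀ < s₁)
    (h : ∀ᵐ z ∂(volume.restrict (V ×ˢ Ioc s₀ s₁)), |p z.2 z.1| ≤ B) {t : ℝ}
    (ht : t ∈ Icc s₀ s₁) : ∀ᵐ x ∂(volume.restrict V), |p t x| ≤ B := by
  have hVm := hV.isClosed.measurableSet
  have ht0 : 0 < t := hs₀.trans_le ht.1
  rw [ae_restrict_iff' (hVm.prod measurableSet_Ioc)] at h
  have hgood := ae_ae_slice_of_ae h
  have hdense := Measure.dense_of_ae hgood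
  -- Near `t` there are times `s` at which `|p(s)| ≤ B` almost everywhere, and then `(|p(t)| - B)⁺ ≤
  -- |p(t) - p(s)|`. Taking `s` in the open interval also treats both endpoints.
  have hle : ∀ ε : ℝ≥0∞, 0 < ε →
      eLpNorm (fun x => max (|p t x| - B) 0) 2 (volume.restrict V) ≤ ε := by
    intro ε hε
    have hev := (hp.continuous_two V hV hVU t ht0).eventually (Iio_mem_nhds hε)
    obtain ⟨O, hO, hOo, htO⟩ := eventually_nhds_iff.1 hev
    have hne : (O ∩ Ioo s₀ s₁).Nonempty := by
      have : t ∈ closure (Ioo s₀ s₁) := by rwa [closure_Ioo hs.ne]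
      exact mem_closure_iff.1 this O hOo htO
    obtain ⟨s, ⟨hsO, hsI⟩, hsg⟩ := hdense.inter_open_nonempty _ (hOo.inter isOpen_Ioo) hne
    refine le_trans (eLpNorm_mono_ae ?_) (hO s hsO).le
    rw [ae_restrict_iff' hVm]
    have hsg : ∀ᵐ x, (x, s) ∈ V ×ˢ Ioc s₀ s₁ → |p s x| ≤ B := hsg
    filter_upwards [hsg] with x hx hxV
    have h1 := hx ⟨hxV, Ioo_subset_Ioc_self hsI⟩
    rw [Real.norm_of_nonneg (le_max_right _ _), Real.norm_eq_abs]
    refine max_le ?_ (abs_nonneg _)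
    have := abs_sub_abs_le_abs_sub (p t x) (p s x)
    rw [abs_sub_comm] at this
    linarith
  have h0 : eLpNorm (fun x => max (|p t x| - B) 0) 2 (volume.restrict V) = 0 :=
    le_antisymm (le_of_forall_pos_le_add fun ε hε => by simpa using hle ε hε) bot_le
  have hm : AEStronglyMeasurable (fun x => max (|p t x| - B) 0) (volume.restrict V) := by
    have := (hp.memLp_two V hV hVU t ht0).aestronglyMeasurable
    exact (continuous_abs.sub continuous_const |>.max continuous_const).comp_aestronglyMeasurable
      this
  rw [eLpNorm_eq_zero_iff hm (by norm_num)] at h0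
  filter_upwards [h0] with x hx
  have : max (|p t x| - B) 0 = 0 := hx
  linarith [le_max_left (|p t x| - B) 0]

/-- Shows that a step gains integrability precisely above the threshold `α_*`. -/
theorem kappa0_sub {a : ℝ} {n : ℕ} (hn : n ≠ 0) (ha : a < 1) (α : ℝ) :
    kappa0 a n α - α = (2 - a) / n * (α - alphaStar a n) := by
  have hn0 : (n : ℝ) ≠ 0 := by exact_mod_cast hn
  have h2 : 2 - a ≠ 0 := by linarith
  unfold kappa0 alphaStar
  field_simp
  ring

theorem kappa1_eq {a : ℝ} {n : ℕ} {α : ℝ} (h0 : kappa0 a n α ≠ 0) :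
    kappa1 a n α = kappa0 a n α / (kappa0 a n α - α) := by
  unfold kappa1
  rw [one_sub_div h0, one_div_div]

variable {a α : ℝ}

theorem kappa0_pos (hn : 2 ≤ n) (ha : a < 1) (hα2 : 2 ≤ α) (hα : alphaStar a n < α) :
    0 < kappa0 a n α := by
  have h := kappa0_sub (n := n) (by omega) ha α
  have hn0 : (0 : ℝ) < n := by positivity
  have : 0 < (2 - a) / n * (α - alphaStar a n) :=
    mul_pos (div_pos (by linarith) hn0) (by linarith)
  linarith

/-- After cancelling `κ₀ - α` the claim is `(1 + (2-a)/n)(α - a) ≤ κ₀`, and the difference is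
`a(2-a)/n`. -/
theorem moser_exponent_le_kappa1_div_sub (hn : 2 ≤ n) (ha0 : 0 < a) (ha : a < 1) (hα2 : 2 ≤ α)
    (hα : alphaStar a n < α) :
    (1 + (2 - a) / n) / ((2 - a) / n) * (1 / (α - alphaStar a n)) ≤ kappa1 a n α / (α - a) := by
  have hn0 : (0 : ℝ) < n := by positivity
  have hq : 0 < (2 - a) / n := div_pos (by linarith) hn0
  have hδ : 0 < α - alphaStar a n := by linarith
  rw [kappa1_eq (kappa0_pos hn ha hα2 hα).ne', kappa0_sub (by omega) ha, div_mul_div_comm, mul_one,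
    div_right_comm (kappa0 a n α)]
  refine div_le_div_of_nonneg_right ?_ (mul_pos hq hδ).le
  rw [le_div_iff₀ (by linarith), kappa0]
  have : 0 < (2 - a) / n * a := by positivity
  linarith

/-- The right side equals `1/(κ₀ - α)`, and `κ₀ - α` is `α - α_*` times `(2-a)/n ≤ 1`. -/
theorem one_div_sub_le_kappa1_div_kappa0 (hn : 2 ≤ n) (ha0 : 0 < a) (ha : a < 1) (hα2 : 2 ≤ α)
    (hα : alphaStar a n < α) :
    1 / (α - alphaStar a n) ≤ kappa1 a n α / kappa0 a n α := by
  have hn0 : (0 : ℝ) < n := by positivity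
  have hn' : (2 : ℝ) ≤ n := by exact_mod_cast hn
  have hq : 0 < (2 - a) / n := div_pos (by linarith) hn0
  have hq1 : (2 - a) / n ≤ 1 := by rw [div_le_one hn0]; linarith
  have hδ : 0 < α - alphaStar a n := by linarith
  have hκ := kappa0_pos hn ha hα2 hα
  rw [kappa1_eq hκ.ne', kappa0_sub (by omega) ha, div_div, mul_comm (_ * _), ← div_div,
    div_self hκ.ne']
  exact one_div_le_one_div_of_le (by positivity) (mul_le_of_le_one_left hδ.le hq1)

/-- The left side is `1/(1 - α_*/α)`; the further factor `1 - a/α ≤ 1` in `κ₂` only enlarges the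
right side. -/
theorem div_sub_le_kappa2 (ha0 : 0 < a) (ha : a < 1) (hα2 : 2 ≤ α) (hα : alphaStar a n < α) :
    α * (1 / (α - alphaStar a n)) ≤ kappa2 a n α := by
  have hα0 : 0 < α := by linarith
  have hδ : 0 < α - alphaStar a n := by linarith
  have e : α * (1 / (α - alphaStar a n)) = 1 / (1 - alphaStar a n / α) := by
    rw [one_sub_div hα0.ne', one_div_div, mul_one_div]
  have hp : 0 < 1 - alphaStar a n / α := by rw [one_sub_div hα0.ne']; positivity
  have hp' : 0 < 1 - a / α := by
    rw [one_sub_div hα0.ne']; exact div_pos (by linarith) hα0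
  rw [e, kappa2]
  refine one_div_le_one_div_of_le (by positivity) (mul_le_of_le_one_left hp.le ?_)
  have : 0 ≤ a / α := by positivity
  linarith

end LocalBoundedness

/-! ### The local bound. -/

theorem theorem4p1 (n : ℕ) (hn : 2 ≤ n) (g : ForchheimerPolynomial)
    (U U' : Set (EuclideanSpace ℝ (Fin n)))
    (hUo : IsOpen U) (hUb : Bornology.IsBounded U)
    (hU'c : IsCompact (closure U')) (hU' : closure U' ⊆ U)
    (α : ℝ) (hα2 : 2 ≤ α) (hα : alphaStar g.a n < α) :
    ∃ C : ℝ, 0 < C ∧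
      ∀ p : ℝ → EuclideanSpace ℝ (Fin n) → ℝ, IsLocalWeakSolution g U p →
      ∀ T₀ T θ : ℝ, 0 ≤ T₀ → 0 < T → 0 < θ → θ < 1 →
        (⨆ t ∈ Icc (T₀ + θ * T) (T₀ + T), eLpNorm (p t) ∞ (volume.restrict U')) ≤
          ENNReal.ofReal (C * (1 + T) ^ (kappa1 g.a n α / kappa0 g.a n α) *
              (1 + (θ * T)⁻¹) ^ (kappa1 g.a n α / (α - g.a))) *
            (1 + eLpNorm (fun z : EuclideanSpace ℝ (Fin n) × ℝ => p z.2 z.1)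
              (ENNReal.ofReal α) (volume.restrict (U ×ˢ Ioo T₀ (T₀ + T)))) ^
              kappa2 g.a n α := by
  have ha := g.a_lt_one
  have ha0 := g.a_pos
  have hα0 : 0 < α := by linarith
  have hδ : 0 < α - alphaStar g.a n := by linarith
  have hκ2 : 0 < kappa2 g.a n α :=
    lt_of_lt_of_le (by positivity) (div_sub_le_kappa2 ha0 ha hα2 hα)
  obtain ⟨Cχ, hCχ, hχ⟩ := exists_time_cutoff
  obtain ⟨ψ, hψ, hψs, hψU, hψ0, hψ1, hψK, R, hψR⟩ := exists_space_cutoff hUo hU'c hU'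
  obtain ⟨A₀, hA₀, hmoser⟩ := exists_moser_bound g hn R α hα2 hα
  have hm1 := moser_exponent_le_kappa1_div_sub hn ha0 ha hα2 hα
  have hm2 := one_div_sub_le_kappa1_div_kappa0 hn ha0 ha hα2 hα
  have hm3 := div_sub_le_kappa2 ha0 ha hα2 hα
  set m := (1 + (2 - g.a) / n) / ((2 - g.a) / n) with hm
  set d := 1 / (α - alphaStar g.a n) with hd
  have hd0 : 0 < d := by positivity
  have hm0 : 0 ≤ m := by
    have : 0 < 2 - g.a := by linarith
    positivity
  set M := (volume U).toReal with hM
  have hM0 : 0 ≤ M := ENNReal.toReal_nonneg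
  have hUM : volume U = ENNReal.ofReal M := (ENNReal.ofReal_toReal hUb.measure_lt_top.ne).symm
  set C₁ := A₀ * (1 + Cχ) ^ m * (2 ^ α * (1 + M)) with hC₁
  have hC₁0 : 0 < C₁ := by positivity
  refine ⟨C₁ ^ d, by positivity, fun p hp T₀ T θ hT₀ hT hθ hθ1 => ?_⟩
  have hh : 0 < θ * T := by positivity
  have hhT : θ * T < T := by nlinarith
  set N := eLpNorm (fun z : EuclideanSpace ℝ (Fin n) × ℝ => p z.2 z.1)
    (ENNReal.ofReal α) (volume.restrict (U ×ˢ Ioo T₀ (T₀ + T))) with hN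
  by_cases hNtop : N = ⊤
  · rw [hNtop, add_top, ENNReal.top_rpow_of_pos hκ2, ENNReal.mul_top]
    · exact le_top
    · simpa using by positivity
  set r := N.toReal with hr
  have hr0 : 0 ≤ r := ENNReal.toReal_nonneg
  have hNr : N = ENNReal.ofReal r := (ENNReal.ofReal_toReal hNtop).symm
  obtain ⟨χ, hχc, hχ0, hχ1, hχs, hχone, hχd⟩ := hχ T₀ (T₀ + T) (θ * T) hh
  have hcut := isCutoff_mul hψ hψs hψU hψ0 hψ1 hψR hχc hχ0 hχ1 hχs
    (by linarith : T₀ < T₀ + θ * T / 2) hχd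
  -- A product form of the bound `2^α(|U| T + r^α)` for the initial integral, which is at least one
  -- and separates the dependence on `T` and on the norm.
  set y := 2 ^ α * (1 + M) * (1 + T) * (1 + r) ^ α with hy
  have hy1 : 1 ≤ y := by
    rw [hy]
    refine one_le_mul_of_one_le_of_one_le (one_le_mul_of_one_le_of_one_le
      (one_le_mul_of_one_le_of_one_le (Real.one_le_rpow (by norm_num) hα0.le) (by linarith))
      (by linarith)) (Real.one_le_rpow (by linarith) hα0.le)
  have hinit : ∫⁻ z in U ×ˢ Ioc T₀ (T₀ + T), ENNReal.ofReal ((1 + p z.2 z.1 ^ 2) ^ (α / 2)) ≤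
      ENNReal.ofReal y := by
    have hrestr : (volume : Measure (Euc n × ℝ)).restrict (U ×ˢ Ioc T₀ (T₀ + T)) =
        volume.restrict (U ×ˢ Ioo T₀ (T₀ + T)) := by
      rw [volume_restrict_prod, volume_restrict_prod, Measure.restrict_congr_set Ioo_ae_eq_Ioc]
    rw [hrestr]
    refine (lintegral_one_add_sq_rpow_le (fun z : Euc n × ℝ => p z.2 z.1) hα0).trans ?_
    rw [← hN, hNr, Measure.restrict_apply_univ, Measure.volume_eq_prod, Measure.prod_prod, hUM,
      Real.volume_Ioo, add_sub_cancel_left, ENNReal.ofReal_rpow_of_nonneg hr0 hα0.le,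
      ← ENNReal.ofReal_mul hM0, ← ENNReal.ofReal_add (by positivity) (by positivity),
      ← ENNReal.ofReal_mul (by positivity)]
    refine ENNReal.ofReal_le_ofReal ?_
    rw [hy, mul_assoc, mul_assoc, ← mul_assoc (1 + M)]
    gcongr
    have k1 : 1 ≤ (1 + r) ^ α := Real.one_le_rpow (by linarith) hα0.le
    have k2 : r ^ α ≤ (1 + r) ^ α := by gcongr; linarith
    have k3 : 0 ≤ M * T := by positivity
    nlinarith [mul_nonneg (add_nonneg hM0 hT.le) (zero_le_one.trans k1),
      mul_nonneg k3 (sub_nonneg.2 k1)]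
  have hae := hmoser hUo hp hT₀ (by positivity) hy1 hcut hinit
    (Q := closure U' ×ˢ Ioc (T₀ + θ * T) (T₀ + T))
    (hU'c.isClosed.measurableSet.prod measurableSet_Ioc)
    (prod_mono hU' (Ioc_subset_Ioc_left (by linarith)))
    (fun z hz => by rw [hψK _ hz.1, hχone _ (Ioc_subset_Icc_self hz.2), one_mul])
  refine iSup₂_le fun t ht => ?_
  -- The half-open time interval used for the space-time bound suffices, since continuity in time
  -- recovers the left endpoint.
  have hbound : ∀ᵐ x ∂(volume.restrict U'), ‖p t x‖ ≤ (A₀ * (1 + Cχ * (θ * T)⁻¹) ^ m * y) ^ d :=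
    ae_mono (Measure.restrict_mono subset_closure le_rfl) (hp.ae_abs_le_of_prod hU'c hU'
      (by linarith) (by linarith) hae ht)
  rw [eLpNorm_exponent_top]
  refine (eLpNormEssSup_le_of_ae_bound hbound).trans ?_
  have hN1 : (1 + N) ^ kappa2 g.a n α = ENNReal.ofReal ((1 + r) ^ kappa2 g.a n α) := by
    rw [hNr, ← ENNReal.ofReal_one, ← ENNReal.ofReal_add zero_le_one hr0,
      ENNReal.ofReal_rpow_of_nonneg (by positivity) hκ2.le]
  rw [hN1, ← ENNReal.ofReal_mul (by positivity)]
  refine ENNReal.ofReal_le_ofReal ?_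
  have hinv : 0 < (θ * T)⁻¹ := by positivity
  calc (A₀ * (1 + Cχ * (θ * T)⁻¹) ^ m * y) ^ d
      ≤ (A₀ * ((1 + Cχ) * (1 + (θ * T)⁻¹)) ^ m * y) ^ d := by
        gcongr
        nlinarith
    _ = (C₁ * ((1 + (θ * T)⁻¹) ^ m * (1 + T) * (1 + r) ^ α)) ^ d := by
        rw [Real.mul_rpow (x := 1 + Cχ) (by positivity) (by positivity), hC₁, hy]
        congr 1
        ring
    _ = C₁ ^ d * (1 + T) ^ d * (1 + (θ * T)⁻¹) ^ (m * d) * (1 + r) ^ (α * d) := by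
        rw [Real.mul_rpow (x := C₁) hC₁0.le (by positivity),
          Real.mul_rpow (y := (1 + r) ^ α) (by positivity) (by positivity),
          Real.mul_rpow (y := 1 + T) (by positivity) (by positivity),
          ← Real.rpow_mul (x := 1 + (θ * T)⁻¹) (by positivity),
          ← Real.rpow_mul (x := 1 + r) (by positivity)]
        ring
    -- All bases are at least one, so the exponents `d`, `m d` and `α d` may be raised to those of
    -- the statement.
    _ ≤ _ := by
        gcongr <;> linarith
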